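/- Let $n\ge 3$, $s\in(0,1)$, and let $\Omega\subset\mathbb{R}^n$ be a bounded open set with $0\in\Omega$. Put $C_{n,s}=2^{2s}\pi^{-n/2}\,\Gamma\!\left(\tfrac{n+2s}{2}\right)/|\Gamma(-s)|$ and $$\mathcal{B}(u,v)=\int_{\mathbb{R}^n}\nabla u\cdot\nabla v\,dx+\frac{C_{n,s}}{2}\iint_{\mathbb{R}^{2n}}\frac{(u(x)-u(y))(v(x)-v(y))}{|x-y|^{n+2s}}\,dx\,dy ,\qquad \rho(u)^2=\mathcal B(u,u).$$ Let $\mathcal{X}^{1,2}(\Omega)$ be the completion of $C_0^\infty(\Omega)$ with respect to $\rho$, and let $W^{1,p}_0(\Omega)$ be the closure of $C_0^\infty(\Omega)$ in $W^{1,p}$; the elements of both spaces are regarded as functions on $\mathbb{R}^n$ vanishing a.e. outside $\Omega$. For $g=(g_k)_{k\ge1}$ in $L^{2n/(n+2)}(\Omega)$, consider the regularized problems: $w_0=0$ and, for every $k\ge1$, $w_k\in\mathcal{X}^{1,2}(\Omega)$ satisfies $$\mathcal{B}(w_k,v)=\gamma\int_\Omega\frac{w_{k-1}\,v}{|x|^2+1/k}\,dx+\int_\Omega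 g_k v\,dx\qquad\text{for all } v\in\mathcal{X}^{1,2}(\Omega).\tag{$\mathrm{P}_g$}$$ **Theorem 1.4.** Let $1<m<\frac{2n}{n+2}$, let $f\in L^m(\Omega)$ with $f\ge0$ a.e. in $\Omega$ and $f\not\equiv0$, and let $$0<\gamma<\gamma(m):=\frac{n(m-1)(n-2m)}{m^2}.$$ Let $m^*=\frac{nm}{n-m}$. Then there is a function $u\in W^{1,m^*}_0(\Omega)$ with the following properties. 1. $u>0$ a.e. in $\Omega$, and $u$ is a distributional solution of $$-\Delta u+(-\Delta)^su-\gamma\frac{u}{|x|^2}=f\ \text{ in }\Omega,\qquad u=0\ \text{ in }\mathbb{R}^n\setminus\Omega,$$ that is, $u=0$ a.e. in $\mathbb{R}^n\setminus\Omega$, $u/|x|^2\in L^1(\Omega)$ and, for every $v\in C_0^\infty(\Omega)$, all the integrals below converge absolutely and $$\mathcal{B}(u,v)-\gamma\int_{\mathbb{R}^n}\frac{u\,v}{|x|^2}\,dx=\int_\Omega f v\,dx .$$ 2. $u$ is the limit of truncated approximating problems: there is a solution $(\varphi_k)_k$ of $(\mathrm{P}_g)$ with $g_k=\min\{f,k\}$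 which is nonnegative and nondecreasing in $k$ a.e. in $\Omega$ and satisfies, as $k\to\infty$, $\varphi_k\to u$ a.e. in $\Omega$, $\varphi_k\rightharpoonup u$ weakly in $W^{1,m^*}_0(\Omega)$, and $\varphi_k/|x|^2\to u/|x|^2$ in $L^1(\Omega)$. 3. This solution obtained as a limit of approximations (SOLA) is unique: if $g_k\in L^{2n/(n+2)}(\Omega)$ is any sequence with $g_k\to f$ in $L^m(\Omega)$, $(w_k)_k$ solves $(\mathrm{P}_g)$, and a subsequence of $(w_k)_k$ converges a.e. in $\Omega$ to a function $w$, then $w=u$ a.e. in $\Omega$. -/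

import Mathlib

open MeasureTheory Filter Topology
open scoped ENNReal ContDiff

/-- The Euclidean space `ℝⁿ`. -/
abbrev Eucl (n : ℕ) : Type := EuclideanSpace ℝ (Fin n)

/-- `v ∈ C₀^∞(Ω)`, extended by zero to the whole of `ℝⁿ`. -/
def IsTestFunction {n : ℕ} (Ω : Set (Eucl n)) (v : Eucl n → ℝ) : Prop :=
  ContDiff ℝ ∞ v ∧ HasCompactSupport v ∧ tsupport v ⊆ Ω

/-- `G` is the weak (distributional) gradient of `u` on `ℝⁿ`. -/
def HasWeakGradient {n : ℕ} (u : Eucl n → ℝ) (G : Eucl n → Eucl n) : Prop :=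
  LocallyIntegrable u ∧ LocallyIntegrable G ∧
    ∀ v : Eucl n → ℝ, IsTestFunction Set.univ v →
      ∫ x, u x • gradient v x = - ∫ x, v x • G x

/-- `u ∈ W₀^{1,p}(Ω)` (extended by zero to `ℝⁿ`) with weak gradient `G`: `u` belongs to the closure
of `C₀^∞(Ω)` with respect to the norm of `W^{1,p}`. -/
def MemSobolevZero {n : ℕ} (p : ℝ≥0∞) (Ω : Set (Eucl n)) (u : Eucl n → ℝ)
    (G : Eucl n → Eucl n) : Prop :=
  MemLp u p ∧ MemLp G p ∧ HasWeakGradient u G ∧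
    ∃ φ : ℕ → Eucl n → ℝ, (∀ j, IsTestFunction Ω (φ j)) ∧
      Tendsto (fun j => eLpNorm (fun x => φ j x - u x) p volume) atTop (𝓝 0) ∧
      Tendsto (fun j => eLpNorm (fun x => gradient (φ j) x - G x) p volume) atTop (𝓝 0)

/-- The normalization constant `C_{n,s}` of the fractional Laplacian `(-Δ)^s` on `ℝⁿ`. -/
noncomputable def fracConst (n : ℕ) (s : ℝ) : ℝ :=
  2 ^ (2 * s) * Real.pi ^ (-(n : ℝ) / 2) * Real.Gamma (((n : ℝ) + 2 * s) / 2) / |Real.Gamma (-s)|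

/-- The square `ρ(u)²` of the mixed global norm of a function `u` on `ℝⁿ` with gradient `G`, as an
extended nonnegative number. -/
noncomputable def mixedEnergy {n : ℕ} (s : ℝ) (u : Eucl n → ℝ) (G : Eucl n → Eucl n) : ℝ≥0∞ :=
  (∫⁻ x, ‖G x‖ₑ ^ 2) + ENNReal.ofReal (fracConst n s / 2) *
    ∫⁻ q : Eucl n × Eucl n,
      ENNReal.ofReal ((u q.1 - u q.2) ^ 2 / ‖q.1 - q.2‖ ^ ((n : ℝ) + 2 * s))

/-- `u ∈ 𝒳^{1,2}(Ω)` with weak gradient `G`, for a bounded open set `Ω`. The space `𝒳^{1,2}(Ω)` is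
the completion of `C₀^∞(Ω)` with respect to the norm `ρ`; by the Poincaré inequality, every
`ρ`-Cauchy sequence of test functions converges in `L²(ℝⁿ)`, and the element of the completion is
identified with its limit. -/
def MemX12 {n : ℕ} (s : ℝ) (Ω : Set (Eucl n)) (u : Eucl n → ℝ) (G : Eucl n → Eucl n) : Prop :=
  MemLp u 2 ∧ MemLp G 2 ∧ HasWeakGradient u G ∧
    ∃ φ : ℕ → Eucl n → ℝ, (∀ j, IsTestFunction Ω (φ j)) ∧
      Tendsto (fun j => eLpNorm (fun x => φ j x - u x) 2 volume) atTop (𝓝 0) ∧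
      Tendsto (fun j => mixedEnergy s (fun x => φ j x - u x) (fun x => gradient (φ j) x - G x))
        atTop (𝓝 0)

/-- The integrand `(u(x)-u(y)) (v(x)-v(y)) / |x-y|^{n+2s}` of the nonlocal part of the form `ℬ`. -/
noncomputable def nonlocalKernel {n : ℕ} (s : ℝ) (u v : Eucl n → ℝ) (q : Eucl n × Eucl n) : ℝ :=
  (u q.1 - u q.2) * (v q.1 - v q.2) / ‖q.1 - q.2‖ ^ ((n : ℝ) + 2 * s)

/-- The bilinear form `ℬ(u,v)` of `-Δ + (-Δ)^s`, where `G`, `V` are the gradients of `u`, `v`. -/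
noncomputable def mixedForm {n : ℕ} (s : ℝ) (u : Eucl n → ℝ) (G : Eucl n → Eucl n)
    (v : Eucl n → ℝ) (V : Eucl n → Eucl n) : ℝ :=
  (∫ x, inner ℝ (G x) (V x)) +
    fracConst n s / 2 * ∫ q : Eucl n × Eucl n, nonlocalKernel s u v q

/-- `u`, with weak gradient `G`, is a distributional solution of the problem
`-Δu + (-Δ)^s u - γ u/|x|² = f` in `Ω`, `u = 0` in `ℝⁿ \ Ω`; all the integrals that occur are
required to converge absolutely. -/
def IsDistributionalSolution {n : ℕ} (s γ : ℝ) (Ω : Set (Eucl n)) (f : Eucl n → ℝ)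
    (u : Eucl n → ℝ) (G : Eucl n → Eucl n) : Prop :=
  (∀ᵐ x, x ∉ Ω → u x = 0) ∧
  IntegrableOn (fun x => u x / ‖x‖ ^ 2) Ω ∧
  ∀ v : Eucl n → ℝ, IsTestFunction Ω v →
    Integrable (fun x => inner ℝ (G x) (gradient v x)) ∧
    Integrable (nonlocalKernel s u v) ∧
    Integrable (fun x => u x * v x / ‖x‖ ^ 2) ∧
    IntegrableOn (fun x => f x * v x) Ω ∧
    mixedForm s u G v (gradient v) - γ * ∫ x, u x * v x / ‖x‖ ^ 2 = ∫ x in Ω, f x * v x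

/-- The regularized problems: `w₀ = 0` and, for every `k ≥ 1`, `w_k ∈ 𝒳^{1,2}(Ω)`, with weak
gradient `W_k`, is a weak solution of `-Δw_k + (-Δ)^s w_k = γ w_{k-1} / (|x|² + 1/k) + g_k` in `Ω`,
`w_k = 0` in `ℝⁿ \ Ω`. -/
def IsApproximatingSequence {n : ℕ} (s γ : ℝ) (Ω : Set (Eucl n)) (g : ℕ → Eucl n → ℝ)
    (w : ℕ → Eucl n → ℝ) (W : ℕ → Eucl n → Eucl n) : Prop :=
  w 0 =ᵐ[volume] 0 ∧
  (∀ k, MemX12 s Ω (w k) (W k)) ∧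
  ∀ k : ℕ, ∀ (v : Eucl n → ℝ) (V : Eucl n → Eucl n), MemX12 s Ω v V →
    mixedForm s (w (k + 1)) (W (k + 1)) v V =
      γ * (∫ x in Ω, w k x * v x / (‖x‖ ^ 2 + 1 / ((k : ℝ) + 1))) + ∫ x in Ω, g (k + 1) x * v x

/-- Weak convergence of `w_k` (with gradients `W_k`) to `u` (with gradient `G`) in `W₀^{1,p}(Ω)`,
tested against the functionals given by the conjugate space `L^{p'}`, `p' = p/(p-1)`. -/
def TendstoWeaklySobolevZero {n : ℕ} (p : ℝ) (Ω : Set (Eucl n))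
    (w : ℕ → Eucl n → ℝ) (W : ℕ → Eucl n → Eucl n)
    (u : Eucl n → ℝ) (G : Eucl n → Eucl n) : Prop :=
  (∀ k, MemSobolevZero (ENNReal.ofReal p) Ω (w k) (W k)) ∧
  MemSobolevZero (ENNReal.ofReal p) Ω u G ∧
  (∀ h : Eucl n → ℝ, MemLp h (ENNReal.ofReal (p / (p - 1))) →
    Tendsto (fun k => ∫ x, w k x * h x) atTop (𝓝 (∫ x, u x * h x))) ∧
  (∀ H : Eucl n → Eucl n, MemLp H (ENNReal.ofReal (p / (p - 1))) →
    Tendsto (fun k => ∫ x, inner ℝ (W k x) (H x)) atTop (𝓝 (∫ x, inner ℝ (G x) (H x))))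

/-- `w` is obtained as a limit of approximations (SOLA): for some sequence of data
`g_k ∈ L^{2n/(n+2)}(Ω)` converging to `f` in `L^m(Ω)`, a subsequence of the solutions of the
corresponding regularized problems converges to `w` almost everywhere in `Ω`. -/
def IsLimitOfApproximations {n : ℕ} (s γ m : ℝ) (Ω : Set (Eucl n)) (f w : Eucl n → ℝ) : Prop :=
  ∃ (g : ℕ → Eucl n → ℝ) (wk : ℕ → Eucl n → ℝ) (Wk : ℕ → Eucl n → Eucl n) (σ : ℕ → ℕ),
    (∀ k, MemLp (g k) (ENNReal.ofReal (2 * (n : ℝ) / ((n : ℝ) + 2))) (volume.restrict Ω)) ∧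
    Tendsto (fun k => eLpNorm (fun x => g k x - f x) (ENNReal.ofReal m) (volume.restrict Ω))
      atTop (𝓝 0) ∧
    IsApproximatingSequence s γ Ω g wk Wk ∧
    StrictMono σ ∧
    ∀ᵐ x ∂(volume.restrict Ω), Tendsto (fun j => wk (σ j) x) atTop (𝓝 (w x))

/-!
# Solutions obtained as limits of approximations for a mixed local-nonlocal Hardy problem

The whole theorem rests on one a priori estimate, `exists_a_priori_estimate`. Let `d` be an element
of `W₀^{1,2}(Ω)` that solves `-Δd + (-Δ)^s d = F/|x|² + h`. Put `α = n(m-1)/(n-2m)`, so that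
`0 < α < 1`, and let `ν` be the measure `1_Ω |x|⁻² dx` (`hardyMeasure`). The equation is tested with
a regularization (`oddPower`) of `|d|^{α-1} d`. This function of `d` is nondecreasing, so the
nonlocal term has a favourable sign and can be dropped; what remains bounds
`∫ |d|^{α-1} |∇d|²` by `R/α`, where `R = ∫ |F| |d|^α dν + ∫ |h| |d|^α`. Applied to `|d|^{(α+1)/2}`
(regularized by `halfPower`), Hardy's inequality with its best constant `(n-2)²/4` bounds
`∫ |d|^{α+1} dν`, and Sobolev's inequality bounds the norm of `d` in `L^{nm/(n-2m)}`. Since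
`γ(m) = α (n-2)² / (α+1)²`, Hölder's inequality for `R` gives
`‖d‖ ≤ ‖F‖ / γ(m) + C ‖h‖_m` in the norm of `L^{α+1}(ν)`, and Hölder's inequality for
`|d|^{(1-α)/2} · |d|^{(α-1)/2} |∇d|` bounds `∇d` in `L^{m*}` by the same data.

The difference of two approximating sequences solves such an equation, with `F` equal to `γ` times
the difference of the preceding members, up to a factor that tends to one (`hardyCutoff`). For
`γ < γ(m)` this is a contraction (`exists_approximation_estimate`), and everything follows.

* The approximations `φ_k` for the data `min{f, k}` exist by the Lax–Milgram theorem
  (`exists_weak_solution`), and are nonnegative and nondecreasing by the comparison principle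
  (`MemSobolevZero.nonneg_of_supersolution`). The contraction bounds them in `L^{α+1}(ν)`, so they
  increase to a function `u` and converge to it in `L^{α+1}(ν)`. The gradient estimate then
  makes `∇φ_k` a Cauchy sequence in `L^{m*}` (`IsApproximatingSequence.exists_limit`).
* The form `ℬ(·, v)` is continuous on `W₀^{1,1}(Ω)` for a test function `v`
  (`exists_nonlocalKernel_bound`), so that the limit solves the equation
  (`IsApproximatingSequence.isDistributionalSolution`).
* The limit is positive because it lies above `φ_1`, a nontrivial nonnegative supersolution
  (`MemSobolevZero.pos_of_supersolution`).
* For any other approximating sequence `w_k` whose data converge to `f` in `L^m(Ω)`, the contraction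
  forces `w_k - φ_k → 0` in `L^{α+1}(ν)` (`IsLimitOfApproximations.ae_eq`).

The space `𝒳^{1,2}(Ω)` coincides with `W₀^{1,2}(Ω)` (`memX12_iff`), because the nonlocal energy is
controlled by the `W^{1,2}`-norm.
-/


/-! ### Test functions and their gradients -/

section TestFunctions

variable {n : ℕ} {Ω : Set (Eucl n)} {v w : Eucl n → ℝ}

theorem norm_gradient_eq (v : Eucl n → ℝ) (x : Eucl n) : ‖gradient v x‖ = ‖fderiv ℝ v x‖ := by
  rw [gradient, LinearIsometryEquiv.norm_map]

theorem IsTestFunction.differentiable (hv : IsTestFunction Ω v) : Differentiable ℝ v :=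
  hv.1.differentiable (by simp)

theorem IsTestFunction.continuous_gradient (hv : IsTestFunction Ω v) :
    Continuous (gradient v) :=
  (InnerProductSpace.toDual ℝ (Eucl n)).symm.continuous.comp (hv.1.continuous_fderiv (by simp))

theorem tsupport_gradient_subset (v : Eucl n → ℝ) : tsupport (gradient v) ⊆ tsupport v := by
  refine subset_trans ?_ (tsupport_fderiv_subset ℝ (f := v))
  refine closure_mono fun x hx => ?_
  contrapose! hx
  simp only [Function.mem_support, not_not] at hx ⊢
  rw [gradient, hx, map_zero]

theorem IsTestFunction.hasCompactSupport_gradient (hv : IsTestFunction Ω v) :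
    HasCompactSupport (gradient v) :=
  hv.2.1.mono' (subset_trans (subset_tsupport _) (tsupport_gradient_subset v))

theorem IsTestFunction.memLp (hv : IsTestFunction Ω v) (p : ℝ≥0∞) : MemLp v p :=
  hv.1.continuous.memLp_of_hasCompactSupport hv.2.1

theorem IsTestFunction.memLp_gradient (hv : IsTestFunction Ω v) (p : ℝ≥0∞) :
    MemLp (gradient v) p :=
  hv.continuous_gradient.memLp_of_hasCompactSupport hv.hasCompactSupport_gradient

theorem IsTestFunction.eq_zero (hv : IsTestFunction Ω v) {x : Eucl n} (hx : x ∉ Ω) : v x = 0 :=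
  image_eq_zero_of_notMem_tsupport fun h => hx (hv.2.2 h)

theorem IsTestFunction.gradient_eq_zero (hv : IsTestFunction Ω v) {x : Eucl n} (hx : x ∉ Ω) :
    gradient v x = 0 :=
  image_eq_zero_of_notMem_tsupport fun h => hx (hv.2.2 (tsupport_gradient_subset v h))

theorem IsTestFunction.add (hv : IsTestFunction Ω v) (hw : IsTestFunction Ω w) :
    IsTestFunction Ω (fun x => v x + w x) :=
  ⟨hv.1.add hw.1, hv.2.1.add hw.2.1,
    (tsupport_add v w).trans (Set.union_subset hv.2.2 hw.2.2)⟩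

theorem IsTestFunction.const_mul (hv : IsTestFunction Ω v) (c : ℝ) :
    IsTestFunction Ω (fun x => c * v x) :=
  ⟨contDiff_const.mul hv.1, hv.2.1.mul_left, (tsupport_mul_subset_right).trans hv.2.2⟩

theorem isTestFunction_zero : IsTestFunction Ω (fun _ => 0) :=
  ⟨contDiff_const, HasCompactSupport.zero, by
    rw [show (fun _ : Eucl n => (0 : ℝ)) = 0 from rfl, tsupport, Function.support_zero]; simp⟩

theorem IsTestFunction.comp (hv : IsTestFunction Ω v) {Φ : ℝ → ℝ} (hΦ : ContDiff ℝ ∞ Φ)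
    (hΦ0 : Φ 0 = 0) : IsTestFunction Ω (fun x => Φ (v x)) :=
  ⟨hΦ.comp hv.1, hv.2.1.comp_left hΦ0,
    (closure_mono (Function.support_comp_subset hΦ0 v)).trans hv.2.2⟩

theorem IsTestFunction.gradient_add (hv : IsTestFunction Ω v) (hw : IsTestFunction Ω w)
    (x : Eucl n) : gradient (fun x => v x + w x) x = gradient v x + gradient w x := by
  rw [gradient, fderiv_fun_add (hv.differentiable x) (hw.differentiable x), map_add]; rfl

theorem IsTestFunction.gradient_const_mul (hv : IsTestFunction Ω v) (c : ℝ) (x : Eucl n) :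
    gradient (fun x => c * v x) x = c • gradient v x := by
  rw [gradient, fderiv_const_mul (hv.differentiable x), map_smul]; rfl

theorem IsTestFunction.gradient_comp (hv : IsTestFunction Ω v) {Φ : ℝ → ℝ}
    (hΦ : ContDiff ℝ ∞ Φ) (x : Eucl n) :
    gradient (fun x => Φ (v x)) x = deriv Φ (v x) • gradient v x := by
  have h1 : HasDerivAt Φ (deriv Φ (v x)) (v x) := (hΦ.differentiable (by simp) _).hasDerivAt
  have h2 := h1.comp_hasFDerivAt x (hv.differentiable x).hasFDerivAt
  have h3 : fderiv ℝ (fun x => Φ (v x)) x = deriv Φ (v x) • fderiv ℝ v x := h2.fderiv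
  rw [gradient, h3, map_smul]; rfl

/-- Integration by parts for test functions. -/
theorem IsTestFunction.integral_smul_gradient {Ω' : Set (Eucl n)} (hv : IsTestFunction Ω v)
    (hw : IsTestFunction Ω' w) : ∫ x, v x • gradient w x = - ∫ x, w x • gradient v x := by
  have h1 : Integrable (fun x => v x • gradient w x) :=
    (hv.1.continuous.smul hw.continuous_gradient).integrable_of_hasCompactSupport
      (hv.2.1.smul_right)
  have h2 : Integrable (fun x => w x • gradient v x) :=
    (hw.1.continuous.smul hv.continuous_gradient).integrable_of_hasCompactSupport
      (hw.2.1.smul_right)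
  refine ext_inner_left ℝ fun e => ?_
  rw [inner_neg_right, ← integral_inner h1, ← integral_inner h2]
  have h3 (x) : inner ℝ e (v x • gradient w x) = v x * fderiv ℝ w x e := by
    rw [inner_smul_right, real_inner_comm, inner_gradient_left]
  have h4 (x) : inner ℝ e (w x • gradient v x) = fderiv ℝ v x e * w x := by
    rw [inner_smul_right, real_inner_comm, inner_gradient_left, mul_comm]
  simp_rw [h3, h4]
  refine integral_mul_fderiv_eq_neg_fderiv_mul_of_integrable ?_ ?_ ?_
    (fun x _ => hv.differentiable x) (fun x _ => hw.differentiable x)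
  · simp_rw [← h4]; exact h2.const_inner e
  · simp_rw [← h3]; exact h1.const_inner e
  · exact (hv.1.continuous.mul hw.1.continuous).integrable_of_hasCompactSupport hv.2.1.mul_right

end TestFunctions

/-! ### Convergence in Lebesgue spaces -/

section Lebesgue

variable {X : Type*} [MeasurableSpace X] {μ : Measure X}

/-- Continuity of the duality pairing of `L^p` and `L^q` given by a bounded bilinear map. -/
theorem tendsto_integral_bilin {E F H : Type*} [NormedAddCommGroup E] [NormedSpace ℝ E]
    [NormedAddCommGroup F] [NormedSpace ℝ F] [NormedAddCommGroup H] [NormedSpace ℝ H]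
    (b : E →L[ℝ] F →L[ℝ] H) {p q : ℝ≥0∞} [p.HolderConjugate q] {ι : Type*} {l : Filter ι}
    {f : X → E} {fj : ι → X → E} {g : X → F} (hf : MemLp f p μ) (hfj : ∀ j, MemLp (fj j) p μ)
    (hg : MemLp g q μ) (h : Tendsto (fun j => eLpNorm (fun x => fj j x - f x) p μ) l (𝓝 0)) :
    Tendsto (fun j => ∫ x, b (fj j x) (g x) ∂μ) l (𝓝 (∫ x, b (f x) (g x) ∂μ)) := by
  refine tendsto_integral_of_L1' _ (b.memLp_of_bilin 1 hf hg).1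
    (Eventually.of_forall fun j => memLp_one_iff_integrable.1 (b.memLp_of_bilin 1 (hfj j) hg)) ?_
  have key (j) : eLpNorm ((fun x => b (fj j x) (g x)) - fun x => b (f x) (g x)) 1 μ
      ≤ ‖b‖₊ * eLpNorm (fun x => fj j x - f x) p μ * eLpNorm g q μ := by
    have := eLpNorm_le_eLpNorm_mul_eLpNorm_of_nnnorm (r := 1) (p := p) (q := q)
      ((hfj j).sub hf).1 hg.1 (fun x y => b x y) ‖b‖₊
      (Eventually.of_forall fun _ => b.le_opNorm₂ _ _)
    refine le_trans (le_of_eq ?_) this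
    congr 1; ext x; simp
  refine tendsto_of_tendsto_of_tendsto_of_le_of_le tendsto_const_nhds ?_ (fun _ => zero_le)
    key
  have h1 := ENNReal.Tendsto.mul_const (b := eLpNorm g q μ)
    (ENNReal.Tendsto.const_mul (a := (‖b‖₊ : ℝ≥0∞)) h (Or.inr ENNReal.coe_ne_top))
    (Or.inr hg.2.ne)
  simpa using h1

/-- A sequence that converges in `L^p` has a subsequence that converges almost everywhere. -/
theorem exists_subseq_tendsto_ae {E : Type*} [NormedAddCommGroup E] {p : ℝ≥0∞} (hp : p ≠ 0)
    {f : X → E} {fj : ℕ → X → E} (hfj : ∀ j, AEStronglyMeasurable (fj j) μ)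
    (hf : AEStronglyMeasurable f μ)
    (h : Tendsto (fun j => eLpNorm (fun x => fj j x - f x) p μ) atTop (𝓝 0)) :
    ∃ σ : ℕ → ℕ, StrictMono σ ∧ ∀ᵐ x ∂μ, Tendsto (fun j => fj (σ j) x) atTop (𝓝 (f x)) :=
  (tendstoInMeasure_of_tendsto_eLpNorm hp hfj hf h).exists_seq_tendsto_ae

theorem tendsto_eLpNorm_of_tendsto_sub {E : Type*} [NormedAddCommGroup E] {p : ℝ≥0∞}
    (hp : 1 ≤ p) {f : X → E} {fj : ℕ → X → E} (hfj : ∀ j, MemLp (fj j) p μ)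
    (hf : MemLp f p μ)
    (h : Tendsto (fun j => eLpNorm (fun x => fj j x - f x) p μ) atTop (𝓝 0)) :
    Tendsto (fun j => eLpNorm (fj j) p μ) atTop (𝓝 (eLpNorm f p μ)) := by
  have : Fact (1 ≤ p) := ⟨hp⟩
  have h1 : Tendsto (fun j => (hfj j).toLp (fj j)) atTop (𝓝 (hf.toLp f)) := by
    rw [Lp.tendsto_Lp_iff_tendsto_eLpNorm'']; exact h
  have h2 := (continuous_norm.tendsto _).comp h1
  have h3 := (ENNReal.continuous_ofReal.tendsto _).comp h2
  simpa [Function.comp_def, Lp.norm_toLp, ENNReal.ofReal_toReal (hfj _).2.ne,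
    ENNReal.ofReal_toReal hf.2.ne] using h3

end Lebesgue

section Lebesgue

variable {X : Type*} [MeasurableSpace X] {μ : Measure X}

/-- Dominated convergence in `L^p`, for a limit equal to zero. -/
theorem tendsto_eLpNorm_zero_of_dominated {E : Type*} [NormedAddCommGroup E] {p : ℝ≥0∞}
    (hp0 : p ≠ 0) (hp : p ≠ ⊤) {fj : ℕ → X → E} {g : X → ℝ} (hg : MemLp g p μ)
    (hfj : ∀ j, AEStronglyMeasurable (fj j) μ) (hb : ∀ j, ∀ᵐ x ∂μ, ‖fj j x‖ ≤ g x)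
    (h : ∀ᵐ x ∂μ, Tendsto (fun j => fj j x) atTop (𝓝 0)) :
    Tendsto (fun j => eLpNorm (fj j) p μ) atTop (𝓝 0) := by
  have hpp : 0 < p.toReal := ENNReal.toReal_pos hp0 hp
  have key : Tendsto (fun j => ∫⁻ x, ‖fj j x‖ₑ ^ p.toReal ∂μ) atTop (𝓝 (∫⁻ _, 0 ∂μ)) := by
    refine tendsto_lintegral_of_dominated_convergence' (fun x => ‖g x‖ₑ ^ p.toReal)
      (fun j => (hfj j).enorm.pow_const _) (fun j => ?_) ?_ ?_
    · filter_upwards [hb j] with x hx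
      refine ENNReal.rpow_le_rpow ?_ hpp.le
      exact enorm_le_iff_norm_le.2 (hx.trans (le_abs_self _))
    · exact (lintegral_rpow_enorm_lt_top_of_eLpNorm_lt_top hp0 hp hg.2).ne
    · filter_upwards [h] with x hx
      have := (ENNReal.continuous_rpow_const (y := p.toReal)).tendsto (‖(0 : E)‖ₑ)
      have := this.comp ((continuous_enorm.tendsto _).comp hx)
      simpa [Function.comp_def, hpp] using this
  have h2 := ((ENNReal.continuous_rpow_const (y := 1 / p.toReal)).tendsto _).comp key
  simp_rw [eLpNorm_eq_lintegral_rpow_enorm_toReal hp0 hp]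
  simpa [Function.comp_def, hpp] using h2

theorem eLpNorm_eq_restrict_of_ae_eq_zero {E : Type*} [NormedAddCommGroup E] {p : ℝ≥0∞}
    {s : Set X} (hs : MeasurableSet s) {f : X → E} (h : ∀ᵐ x ∂μ, x ∉ s → f x = 0) :
    eLpNorm f p (μ.restrict s) = eLpNorm f p μ := by
  rw [← eLpNorm_indicator_eq_eLpNorm_restrict hs]
  refine eLpNorm_congr_ae ?_
  filter_upwards [h] with x hx
  by_cases hxs : x ∈ s
  · simp [hxs]
  · simp [hxs, hx hxs]

end Lebesgue

/-! ### The spaces `W₀^{1,p}(Ω)` -/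

section Sobolev

variable {n : ℕ} {Ω : Set (Eucl n)} {u v : Eucl n → ℝ} {G V : Eucl n → Eucl n} {p q : ℝ≥0∞}

/-- The limit of test functions in the norm of `W^{1,p}` has a weak gradient, and so belongs to
`W₀^{1,p}(Ω)`. -/
theorem memSobolevZero_of_tendsto (hp : 1 ≤ p) (hu : MemLp u p) (hG : MemLp G p)
    {φ : ℕ → Eucl n → ℝ} (hφ : ∀ j, IsTestFunction Ω (φ j))
    (h1 : Tendsto (fun j => eLpNorm (fun x => φ j x - u x) p volume) atTop (𝓝 0))
    (h2 : Tendsto (fun j => eLpNorm (fun x => gradient (φ j) x - G x) p volume) atTop (𝓝 0)) :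
    MemSobolevZero p Ω u G := by
  refine ⟨hu, hG, ⟨hu.locallyIntegrable hp, hG.locallyIntegrable hp, fun v hv => ?_⟩,
    φ, hφ, h1, h2⟩
  have := ENNReal.HolderConjugate.conjExponent hp
  have l1 := tendsto_integral_bilin (ContinuousLinearMap.lsmul ℝ ℝ) (q := p.conjExponent) hu
    (fun j => (hφ j).memLp p) (hv.memLp_gradient _) h1
  have l2 := tendsto_integral_bilin (ContinuousLinearMap.lsmul ℝ ℝ (E := Eucl n)).flip
    (q := p.conjExponent) hG (fun j => (hφ j).memLp_gradient p) (hv.memLp _) h2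
  simp only [ContinuousLinearMap.lsmul_apply, ContinuousLinearMap.flip_apply] at l1 l2
  refine tendsto_nhds_unique l1 ?_
  simp_rw [(hφ _).integral_smul_gradient hv]
  exact l2.neg

theorem IsTestFunction.memSobolevZero (hv : IsTestFunction Ω v) (hp : 1 ≤ p) :
    MemSobolevZero p Ω v (gradient v) :=
  memSobolevZero_of_tendsto hp (hv.memLp p) (hv.memLp_gradient p) (fun _ => hv)
    (by simp) (by simp)

/-- `W₀^{1,p}(Ω)` is closed with respect to convergence in `W^{1,p}`. -/
theorem MemSobolevZero.of_tendsto (hp : 1 ≤ p) {uj : ℕ → Eucl n → ℝ}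
    {Gj : ℕ → Eucl n → Eucl n} (hj : ∀ j, MemSobolevZero p Ω (uj j) (Gj j))
    (hu : MemLp u p) (hG : MemLp G p)
    (h1 : Tendsto (fun j => eLpNorm (fun x => uj j x - u x) p volume) atTop (𝓝 0))
    (h2 : Tendsto (fun j => eLpNorm (fun x => Gj j x - G x) p volume) atTop (𝓝 0)) :
    MemSobolevZero p Ω u G := by
  have key (j : ℕ) : ∃ φ, IsTestFunction Ω φ ∧
      eLpNorm (fun x => φ x - uj j x) p volume ≤ ((j : ℝ≥0∞) + 1)⁻¹ ∧
      eLpNorm (fun x => gradient φ x - Gj j x) p volume ≤ ((j : ℝ≥0∞) + 1)⁻¹ := by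
    obtain ⟨-, -, -, φ, hφ, a1, a2⟩ := hj j
    have hpos : (0 : ℝ≥0∞) < ((j : ℝ≥0∞) + 1)⁻¹ := by simp
    obtain ⟨i, hi1, hi2⟩ := ((a1.eventually_le_const hpos).and
      (a2.eventually_le_const hpos)).exists
    exact ⟨φ i, hφ i, hi1, hi2⟩
  choose φ hφ k1 k2 using key
  have lim0 : Tendsto (fun j : ℕ => ((j : ℝ≥0∞) + 1)⁻¹) atTop (𝓝 0) := by
    have := (tendsto_add_atTop_iff_nat 1).2 ENNReal.tendsto_inv_nat_nhds_zero
    simpa using this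
  refine memSobolevZero_of_tendsto hp hu hG hφ ?_ ?_
  · have := lim0.add h1
    rw [add_zero] at this
    refine tendsto_of_tendsto_of_tendsto_of_le_of_le tendsto_const_nhds this
      (fun _ => zero_le) fun j => ?_
    have e : (fun x => φ j x - u x) = (fun x => φ j x - uj j x) + fun x => uj j x - u x := by
      ext x; simp
    rw [e]
    exact (eLpNorm_add_le (((hφ j).memLp p).1.sub (hj j).1.1) ((hj j).1.1.sub hu.1) hp).trans
      (add_le_add_left (k1 j) _)
  · have := lim0.add h2
    rw [add_zero] at this
    refine tendsto_of_tendsto_of_tendsto_of_le_of_le tendsto_const_nhds this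
      (fun _ => zero_le) fun j => ?_
    have e : (fun x => gradient (φ j) x - G x)
        = (fun x => gradient (φ j) x - Gj j x) + fun x => Gj j x - G x := by
      ext x; simp
    rw [e]
    exact (eLpNorm_add_le (((hφ j).memLp_gradient p).1.sub (hj j).2.1.1)
      ((hj j).2.1.1.sub hG.1) hp).trans (add_le_add_left (k2 j) _)

theorem MemSobolevZero.congr (hp : 1 ≤ p) (h : MemSobolevZero p Ω u G) (huv : u =ᵐ[volume] v)
    (hGV : G =ᵐ[volume] V) : MemSobolevZero p Ω v V := by
  obtain ⟨a, b, -, φ, hφ, h1, h2⟩ := h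
  refine memSobolevZero_of_tendsto hp (a.ae_eq huv) (b.ae_eq hGV) hφ ?_ ?_
  · refine h1.congr fun j => eLpNorm_congr_ae ?_
    filter_upwards [huv] with x hx; rw [hx]
  · refine h2.congr fun j => eLpNorm_congr_ae ?_
    filter_upwards [hGV] with x hx; rw [hx]

theorem MemSobolevZero.zero (hp : 1 ≤ p) :
    MemSobolevZero p Ω (fun _ => 0) (fun _ => (0 : Eucl n)) := by
  have h := (isTestFunction_zero (Ω := Ω)).memSobolevZero hp
  rwa [gradient_fun_const'] at h

theorem MemSobolevZero.add (hp : 1 ≤ p) (h : MemSobolevZero p Ω u G)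
    (h' : MemSobolevZero p Ω v V) :
    MemSobolevZero p Ω (fun x => u x + v x) (fun x => G x + V x) := by
  obtain ⟨a, b, -, φ, hφ, h1, h2⟩ := h
  obtain ⟨a', b', -, φ', hφ', h1', h2'⟩ := h'
  refine memSobolevZero_of_tendsto hp (a.add a') (b.add b') (fun j => (hφ j).add (hφ' j)) ?_ ?_
  · have := h1.add h1'
    rw [add_zero] at this
    refine tendsto_of_tendsto_of_tendsto_of_le_of_le tendsto_const_nhds this
      (fun _ => zero_le) fun j => ?_
    have e : (fun x => φ j x + φ' j x - (u x + v x))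
        = (fun x => φ j x - u x) + fun x => φ' j x - v x := by
      ext x; simp; ring
    simp only [e]
    exact eLpNorm_add_le (((hφ j).memLp p).1.sub a.1) (((hφ' j).memLp p).1.sub a'.1) hp
  · have := h2.add h2'
    rw [add_zero] at this
    refine tendsto_of_tendsto_of_tendsto_of_le_of_le tendsto_const_nhds this
      (fun _ => zero_le) fun j => ?_
    have e : (fun x => gradient (fun x => φ j x + φ' j x) x - (G x + V x))
        = (fun x => gradient (φ j) x - G x) + fun x => gradient (φ' j) x - V x := by
      ext1 x; simp only [(hφ j).gradient_add (hφ' j), Pi.add_apply]; abel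
    simp only [e]
    exact eLpNorm_add_le (((hφ j).memLp_gradient p).1.sub b.1)
      (((hφ' j).memLp_gradient p).1.sub b'.1) hp

theorem MemSobolevZero.const_mul (hp : 1 ≤ p) (h : MemSobolevZero p Ω u G) (c : ℝ) :
    MemSobolevZero p Ω (fun x => c * u x) (fun x => c • G x) := by
  obtain ⟨a, b, -, φ, hφ, h1, h2⟩ := h
  refine memSobolevZero_of_tendsto hp (a.const_mul c) (b.const_smul c)
    (fun j => (hφ j).const_mul c) ?_ ?_
  · have e (j) : eLpNorm (fun x => c * φ j x - c * u x) p volume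
        = ‖c‖ₑ * eLpNorm (fun x => φ j x - u x) p volume := by
      rw [← eLpNorm_const_smul]; congr 1; ext x; simp; ring
    simp_rw [e]
    simpa using ENNReal.Tendsto.const_mul h1 (Or.inr (enorm_ne_top (x := c)))
  · have e (j) : eLpNorm (fun x => gradient (fun x => c * φ j x) x - c • G x) p volume
        = ‖c‖ₑ * eLpNorm (fun x => gradient (φ j) x - G x) p volume := by
      rw [← eLpNorm_const_smul]; congr 1; ext1 x
      simp only [(hφ j).gradient_const_mul, Pi.smul_apply, smul_sub]
    simp_rw [e]
    simpa using ENNReal.Tendsto.const_mul h2 (Or.inr (enorm_ne_top (x := c)))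

theorem MemSobolevZero.sub (hp : 1 ≤ p) (h : MemSobolevZero p Ω u G)
    (h' : MemSobolevZero p Ω v V) :
    MemSobolevZero p Ω (fun x => u x - v x) (fun x => G x - V x) := by
  simpa [sub_eq_add_neg] using h.add hp (h'.const_mul hp (-1))

theorem ae_eq_zero_of_tendsto_of_eq_zero {E : Type*} [NormedAddCommGroup E] (hΩ : IsOpen Ω)
    (hp : p ≠ 0) {f : Eucl n → E} {fj : ℕ → Eucl n → E} (hf : AEStronglyMeasurable f)
    (hfj : ∀ j x, x ∉ Ω → fj j x = 0)
    (h : Tendsto (fun j => eLpNorm (fun x => fj j x - f x) p volume) atTop (𝓝 0)) :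
    ∀ᵐ x, x ∉ Ω → f x = 0 := by
  have hm : MeasurableSet Ωᶜ := hΩ.measurableSet.compl
  have h1 : eLpNorm f p (volume.restrict Ωᶜ) = 0 := by
    refine le_antisymm (ge_of_tendsto' h fun j => ?_) zero_le
    refine le_trans (le_of_eq ?_) 
      (eLpNorm_mono_measure _ (Measure.restrict_le_self (s := Ωᶜ)))
    refine eLpNorm_congr_norm_ae ?_
    filter_upwards [ae_restrict_mem hm] with x hx
    rw [hfj j x hx, zero_sub, norm_neg]
  rw [eLpNorm_eq_zero_iff hf.restrict hp] at h1
  exact (ae_restrict_iff' hm).1 h1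

theorem MemSobolevZero.ae_eq_zero (hΩ : IsOpen Ω) (hp : 1 ≤ p) (h : MemSobolevZero p Ω u G) :
    ∀ᵐ x, x ∉ Ω → u x = 0 := by
  obtain ⟨a, b, -, φ, hφ, h1, h2⟩ := h
  exact ae_eq_zero_of_tendsto_of_eq_zero hΩ (by positivity) a.1
    (fun j x hx => (hφ j).eq_zero hx) h1

theorem MemSobolevZero.gradient_ae_eq_zero (hΩ : IsOpen Ω) (hp : 1 ≤ p)
    (h : MemSobolevZero p Ω u G) : ∀ᵐ x, x ∉ Ω → G x = 0 := by
  obtain ⟨a, b, -, φ, hφ, h1, h2⟩ := h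
  exact ae_eq_zero_of_tendsto_of_eq_zero hΩ (by positivity) b.1
    (fun j x hx => (hφ j).gradient_eq_zero hx) h2

/-- Comparison of the Lebesgue norms of functions that vanish outside a bounded set. -/
theorem eLpNorm_le_of_ae_eq_zero {E : Type*} [NormedAddCommGroup E] (hΩ : IsOpen Ω)
    {f : Eucl n → E} (hpq : p ≤ q) (hf : AEStronglyMeasurable f)
    (h : ∀ᵐ x, x ∉ Ω → f x = 0) :
    eLpNorm f p volume ≤ eLpNorm f q volume *
      volume Ω ^ (1 / p.toReal - 1 / q.toReal) := by
  rw [← eLpNorm_eq_restrict_of_ae_eq_zero hΩ.measurableSet h (p := p),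
    ← eLpNorm_eq_restrict_of_ae_eq_zero hΩ.measurableSet h (p := q)]
  simpa using eLpNorm_le_eLpNorm_mul_rpow_measure_univ (μ := volume.restrict Ω) hpq hf.restrict

theorem rpow_measure_ne_top (hΩb : Bornology.IsBounded Ω) (hp : 1 ≤ p) (hpq : p ≤ q) :
    volume Ω ^ (1 / p.toReal - 1 / q.toReal) ≠ ⊤ := by
  rcases eq_or_ne q ⊤ with rfl | hq
  · refine ENNReal.rpow_ne_top_of_nonneg (by simp) hΩb.measure_lt_top.ne
  refine ENNReal.rpow_ne_top_of_nonneg ?_ hΩb.measure_lt_top.ne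
  have h1 := ENNReal.toReal_mono hq hpq
  have h2 : 0 < p.toReal := ENNReal.toReal_pos (by positivity) (ne_top_of_le_ne_top hq hpq)
  have := one_div_le_one_div_of_le h2 h1
  linarith

theorem memLp_of_ae_eq_zero {E : Type*} [NormedAddCommGroup E] (hΩ : IsOpen Ω)
    (hΩb : Bornology.IsBounded Ω) {f : Eucl n → E} (hp : 1 ≤ p) (hpq : p ≤ q) (hf : MemLp f q)
    (h : ∀ᵐ x, x ∉ Ω → f x = 0) : MemLp f p :=
  ⟨hf.1, (eLpNorm_le_of_ae_eq_zero hΩ hpq hf.1 h).trans_lt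
    (ENNReal.mul_lt_top hf.2 (rpow_measure_ne_top hΩb hp hpq).lt_top)⟩

/-- On a bounded set, `W₀^{1,q} ⊆ W₀^{1,p}` for `p ≤ q`. -/
theorem MemSobolevZero.mono_exponent (hΩ : IsOpen Ω) (hΩb : Bornology.IsBounded Ω) (hp : 1 ≤ p)
    (hpq : p ≤ q) (h : MemSobolevZero q Ω u G) : MemSobolevZero p Ω u G := by
  have z1 := h.ae_eq_zero hΩ (hp.trans hpq)
  have z2 := h.gradient_ae_eq_zero hΩ (hp.trans hpq)
  obtain ⟨a, b, -, φ, hφ, h1, h2⟩ := h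
  have fin := rpow_measure_ne_top hΩb hp hpq
  refine memSobolevZero_of_tendsto hp (memLp_of_ae_eq_zero hΩ hΩb hp hpq a z1)
    (memLp_of_ae_eq_zero hΩ hΩb hp hpq b z2) hφ ?_ ?_
  · refine tendsto_of_tendsto_of_tendsto_of_le_of_le tendsto_const_nhds
      ((ENNReal.Tendsto.mul_const h1 (Or.inr fin)).trans (by simp)) (fun _ => zero_le) fun j => ?_
    refine eLpNorm_le_of_ae_eq_zero hΩ hpq (((hφ j).memLp p).1.sub a.1) ?_
    filter_upwards [z1] with x hx hxΩ
    rw [hx hxΩ, (hφ j).eq_zero hxΩ, sub_zero]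
  · refine tendsto_of_tendsto_of_tendsto_of_le_of_le tendsto_const_nhds
      ((ENNReal.Tendsto.mul_const h2 (Or.inr fin)).trans (by simp)) (fun _ => zero_le) fun j => ?_
    refine eLpNorm_le_of_ae_eq_zero hΩ hpq (((hφ j).memLp_gradient p).1.sub b.1) ?_
    filter_upwards [z2] with x hx hxΩ
    rw [hx hxΩ, (hφ j).gradient_eq_zero hxΩ, sub_zero]

/-- Chain rule: `W₀^{1,p}(Ω)` is stable under composition with smooth functions that vanish at `0`
and have a bounded derivative. -/
theorem MemSobolevZero.comp (hp : 1 ≤ p) (hp' : p ≠ ⊤) (h : MemSobolevZero p Ω u G)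
    {Φ : ℝ → ℝ} (hΦ : ContDiff ℝ ∞ Φ) (hΦ0 : Φ 0 = 0) {L : ℝ} (hL : ∀ t, |deriv Φ t| ≤ L) :
    MemSobolevZero p Ω (fun x => Φ (u x)) (fun x => deriv Φ (u x) • G x) := by
  obtain ⟨a, b, -, φ, hφ, h1, h2⟩ := h
  have hp0 : p ≠ 0 := by positivity
  obtain ⟨σ, hσ, hσu⟩ := exists_subseq_tendsto_ae hp0 (fun j => ((hφ j).memLp p).1) a.1 h1
  have hL0 : 0 ≤ L := (abs_nonneg _).trans (hL 0)
  have lip (s t : ℝ) : |Φ s - Φ t| ≤ L * |s - t| := by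
    have := convex_univ.norm_image_sub_le_of_norm_deriv_le (f := Φ) (C := L) (x := t) (y := s)
      (fun x _ => hΦ.differentiable (by simp) x) (fun x _ => hL x) trivial trivial
    simpa using this
  have cd : Continuous (deriv Φ) := hΦ.continuous_deriv (by simp)
  have mΦ : MemLp (fun x => Φ (u x)) p := by
    refine a.of_le_mul (c := L) (hΦ.continuous.comp_aestronglyMeasurable a.1)
      (Eventually.of_forall fun x => ?_)
    simpa [hΦ0] using lip (u x) 0
  have mD : AEStronglyMeasurable (fun x => deriv Φ (u x)) volume :=
    cd.comp_aestronglyMeasurable a.1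
  have mG : MemLp (fun x => deriv Φ (u x) • G x) p := by
    refine b.of_le_mul (c := L) (mD.smul b.1) (Eventually.of_forall fun x => ?_)
    rw [norm_smul]
    exact mul_le_mul_of_nonneg_right (hL _) (norm_nonneg _)
  refine memSobolevZero_of_tendsto hp mΦ mG (fun j => (hφ (σ j)).comp hΦ hΦ0) ?_ ?_
  · have := ENNReal.Tendsto.const_mul (h1.comp hσ.tendsto_atTop)
      (Or.inr (ENNReal.ofReal_ne_top (r := L)))
    rw [mul_zero] at this
    refine tendsto_of_tendsto_of_tendsto_of_le_of_le tendsto_const_nhds this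
      (fun _ => zero_le) fun j => ?_
    exact eLpNorm_le_mul_eLpNorm_of_ae_le_mul (Eventually.of_forall fun x => lip _ _) p
  · have t1 := ENNReal.Tendsto.const_mul (h2.comp hσ.tendsto_atTop)
      (Or.inr (ENNReal.ofReal_ne_top (r := L)))
    rw [mul_zero] at t1
    have mj (j) : AEStronglyMeasurable (fun x => deriv Φ (φ (σ j) x)) volume :=
      (cd.comp (hφ (σ j)).1.continuous).aestronglyMeasurable
    have t2 : Tendsto (fun j => eLpNorm
        (fun x => (deriv Φ (φ (σ j) x) - deriv Φ (u x)) • G x) p volume) atTop (𝓝 0) := by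
      refine tendsto_eLpNorm_zero_of_dominated hp0 hp' (g := fun x => 2 * L * ‖G x‖)
        (b.norm.const_mul _) (fun j => ((mj j).sub mD).smul b.1)
        (fun j => Eventually.of_forall fun x => ?_) ?_
      · rw [norm_smul]
        refine mul_le_mul_of_nonneg_right ?_ (norm_nonneg _)
        refine (norm_sub_le _ _).trans ?_
        have := hL (φ (σ j) x)
        have := hL (u x)
        simp only [Real.norm_eq_abs]
        linarith
      · filter_upwards [hσu] with x hx
        have := (((cd.tendsto _).comp hx).sub_const (deriv Φ (u x))).smul_const (G x)
        simpa using this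
    have := t1.add t2
    rw [add_zero] at this
    refine tendsto_of_tendsto_of_tendsto_of_le_of_le tendsto_const_nhds this
      (fun _ => zero_le) fun j => ?_
    have e : (fun x => gradient (fun x => Φ (φ (σ j) x)) x - deriv Φ (u x) • G x)
        = (fun x => deriv Φ (φ (σ j) x) • (gradient (φ (σ j)) x - G x))
          + fun x => (deriv Φ (φ (σ j) x) - deriv Φ (u x)) • G x := by
      ext1 x
      simp only [(hφ (σ j)).gradient_comp hΦ, Pi.add_apply, smul_sub, sub_smul]; abel
    simp only [e]
    refine (eLpNorm_add_le ((mj j).smul (((hφ (σ j)).memLp_gradient p).1.sub b.1))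
      (((mj j).sub mD).smul b.1) hp).trans (add_le_add_left ?_ _)
    refine eLpNorm_le_mul_eLpNorm_of_ae_le_mul (Eventually.of_forall fun x => ?_) p
    exact (norm_smul (deriv Φ (φ (σ j) x)) _).trans_le
      (mul_le_mul_of_nonneg_right (hL _) (norm_nonneg _))

/-- The gradient of a Sobolev function vanishes almost everywhere on its zero set. To see this,
pass to the limit `ε → 0` in the weak formulation of `∇ (ε arctan (u/ε)) = ∇u / (1 + (u/ε)²)`:
the left-hand side tends to `0` and the right-hand side to `∇u` on the zero set. -/
theorem MemSobolevZero.gradient_eq_zero_of_eq_zero (hp : 1 ≤ p) (hp' : p ≠ ⊤)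
    (h : MemSobolevZero p Ω u G) : ∀ᵐ x, u x = 0 → G x = 0 := by
  let ε : ℕ → ℝ := fun j => 1 / ((j : ℝ) + 1)
  have ε0 (j) : 0 < ε j := Nat.one_div_pos_of_nat
  have εlim : Tendsto ε atTop (𝓝 0) := tendsto_one_div_add_atTop_nhds_zero_nat
  let T : ℕ → ℝ → ℝ := fun j t => ε j * Real.arctan (t / ε j)
  have hT (j) : ContDiff ℝ ∞ (T j) :=
    contDiff_const.mul (Real.contDiff_arctan.comp (contDiff_id.div_const _))
  have hT' (j t) : HasDerivAt (T j) (1 / (1 + (t / ε j) ^ 2)) t := by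
    have := ((Real.hasDerivAt_arctan (t / ε j)).comp t
      ((hasDerivAt_id t).div_const (ε j))).const_mul (ε j)
    refine this.congr_deriv ?_
    have := (ε0 j).ne'
    field_simp
  have hbd (j t) : |deriv (T j) t| ≤ 1 := by
    rw [(hT' j t).deriv, abs_of_nonneg (by positivity)]
    exact div_le_one_of_le₀ (by nlinarith [sq_nonneg (t / ε j)]) (by positivity)
  have hS (j) := h.comp hp hp' (hT j) (by simp [T]) (hbd j)
  have mset : NullMeasurableSet {x | u x = 0} :=
    h.1.1.aemeasurable.nullMeasurable (measurableSet_singleton 0)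
  have key := ae_eq_zero_of_integral_contDiff_smul_eq_zero
    (f := Set.indicator {x | u x = 0} G) (μ := volume) ?_ (fun g hg hgc => ?_)
  · filter_upwards [key] with x hx hux
    rwa [Set.indicator_of_mem (by exact hux)] at hx
  · refine MemLp.locallyIntegrable (p := p) ?_ hp
    exact ⟨h.2.1.1.indicator₀ mset, (eLpNorm_indicator_le _).trans_lt h.2.1.2⟩
  have tg : IsTestFunction Set.univ g := ⟨hg, hgc, Set.subset_univ _⟩
  have l1 : Tendsto (fun j => ∫ x, g x • (deriv (T j) (u x) • G x)) atTop
      (𝓝 (∫ x, g x • Set.indicator {x | u x = 0} G x)) := by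
    refine tendsto_integral_of_dominated_convergence (fun x => ‖g x • G x‖) (fun j => ?_)
      (h.2.2.1.2.1.integrable_smul_left_of_hasCompactSupport hg.continuous hgc).norm
      (fun j => Eventually.of_forall fun x => ?_) (Eventually.of_forall fun x => ?_)
    · exact hg.continuous.aestronglyMeasurable.smul (hS j).2.1.1
    · rw [norm_smul, norm_smul, norm_smul]
      gcongr
      exact mul_le_of_le_one_left (norm_nonneg _) (hbd j _)
    · refine tendsto_const_nhds.smul ?_
      by_cases hx : u x = 0
      · rw [Set.indicator_of_mem (by exact hx)]
        simp only [(hT' _ _).deriv, hx]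
        simp
      · rw [Set.indicator_of_notMem (by exact hx)]
        simp only [(hT' _ _).deriv]
        have a1 : Tendsto (fun j => (ε j) ^ 2 / ((ε j) ^ 2 + (u x) ^ 2)) atTop
            (𝓝 (0 ^ 2 / (0 ^ 2 + (u x) ^ 2))) :=
          (εlim.pow 2).div ((εlim.pow 2).add_const _) (by simp [hx])
        have a2 := a1.smul_const (G x)
        simp only [ne_eq, OfNat.ofNat_ne_zero, not_false_eq_true, zero_pow, zero_div,
          zero_smul] at a2
        refine a2.congr fun j => ?_
        congr 1
        have := (ε0 j).ne'
        field_simp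
  have l2 : Tendsto (fun j => ∫ x, T j (u x) • gradient g x) atTop (𝓝 0) := by
    have := tendsto_integral_of_dominated_convergence (μ := volume)
      (F := fun j x => T j (u x) • gradient g x) (f := fun _ => 0)
      (fun x => 2 * ‖gradient g x‖) (fun j => ?_)
      ((memLp_one_iff_integrable.1 (tg.memLp_gradient 1)).norm.const_mul 2)
      (fun j => Eventually.of_forall fun x => ?_) (Eventually.of_forall fun x => ?_)
    · simpa using this
    · exact ((hT j).continuous.comp_aestronglyMeasurable h.1.1).smul (tg.memLp_gradient 1).1
    · rw [norm_smul]
      gcongr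
      have h1 : ε j ≤ 1 := by
        simp only [ε]; rw [div_le_one (by positivity)]; linarith [(Nat.cast_nonneg j : (0 : ℝ) ≤ j)]
      have h2 : |Real.arctan (u x / ε j)| ≤ 2 := by
        have := Real.arctan_lt_pi_div_two (u x / ε j)
        have := Real.neg_pi_div_two_lt_arctan (u x / ε j)
        have := Real.pi_lt_four
        rw [abs_le]; constructor <;> linarith
      rw [Real.norm_eq_abs, abs_mul, abs_of_pos (ε0 j)]
      nlinarith [abs_nonneg (Real.arctan (u x / ε j)), ε0 j]
    · have h3 : Tendsto (fun j => T j (u x)) atTop (𝓝 0) := by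
        refine squeeze_zero_norm (a := fun j => ε j * 2) (fun j => ?_) (by simpa using εlim.mul_const 2)
        have h2 : |Real.arctan (u x / ε j)| ≤ 2 := by
          have := Real.arctan_lt_pi_div_two (u x / ε j)
          have := Real.neg_pi_div_two_lt_arctan (u x / ε j)
          have := Real.pi_lt_four
          rw [abs_le]; constructor <;> linarith
        rw [Real.norm_eq_abs, abs_mul, abs_of_pos (ε0 j)]
        gcongr
      simpa using h3.smul_const (gradient g x)
  refine tendsto_nhds_unique l1 ?_
  have e (j) : ∫ x, g x • (deriv (T j) (u x) • G x) = - ∫ x, T j (u x) • gradient g x := by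
    rw [(hS j).2.2.1.2.2 g tg, neg_neg]
  simp_rw [e]
  simpa using l2.neg

end Sobolev

/-! ### The inequalities of Hardy, Sobolev and Poincaré -/

section Inequalities

variable {n : ℕ} {Ω : Set (Eucl n)} {u v : Eucl n → ℝ} {G V : Eucl n → Eucl n} {p q : ℝ≥0∞}

/-- The divergence identity for the field `x / (|x|² + ε)` and the function `φ²`. -/
theorem IsTestFunction.integral_hardy_field (hv : IsTestFunction Ω v) {ε : ℝ} (hε : 0 < ε) :
    ∫ x, 2 * v x * inner ℝ (gradient v x) x / (‖x‖ ^ 2 + ε) =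
      - ∫ x, v x ^ 2 * (n / (‖x‖ ^ 2 + ε) - 2 * ‖x‖ ^ 2 / (‖x‖ ^ 2 + ε) ^ 2) := by
  have hr (x : Eucl n) : ‖x‖ ^ 2 + ε ≠ 0 := by positivity
  have cr : Continuous fun x : Eucl n => ‖x‖ ^ 2 + ε := by fun_prop
  have cs (F : Eucl n → ℝ) (hF : Continuous F) : Integrable (fun x => v x * F x) :=
    (hv.1.continuous.mul hF).integrable_of_hasCompactSupport hv.2.1.mul_right
  have cv := hv.1.continuous
  have cg := hv.continuous_gradient
  have dg (i : Fin n) (x : Eucl n) : HasFDerivAt (fun x : Eucl n => x i * (‖x‖ ^ 2 + ε)⁻¹)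
      (x i • (-((‖x‖ ^ 2 + ε) ^ 2)⁻¹ • (2 • innerSL ℝ x)) +
        (‖x‖ ^ 2 + ε)⁻¹ • (EuclideanSpace.proj i : Eucl n →L[ℝ] ℝ)) x := by
    have a1 : HasFDerivAt (fun x : Eucl n => x i) (EuclideanSpace.proj i : Eucl n →L[ℝ] ℝ) x :=
      (EuclideanSpace.proj i : Eucl n →L[ℝ] ℝ).hasFDerivAt
    have a2 : HasFDerivAt (fun x : Eucl n => ‖x‖ ^ 2 + ε) (2 • innerSL ℝ x) x :=
      (hasStrictFDerivAt_norm_sq x).hasFDerivAt.add_const ε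
    have a3 := (hasDerivAt_inv (hr x)).comp_hasFDerivAt x a2
    exact a1.mul a3
  have df (x : Eucl n) : HasFDerivAt (fun x => v x ^ 2) ((2 * v x) • fderiv ℝ v x) x := by
    have := (hv.differentiable x).hasFDerivAt.pow 2
    simpa using this
  have key (i : Fin n) :
      ∫ x, v x * (2 * (gradient v x i * x i / (‖x‖ ^ 2 + ε))) =
      - ∫ x, v x * (v x * (1 / (‖x‖ ^ 2 + ε) - 2 * x i ^ 2 / (‖x‖ ^ 2 + ε) ^ 2)) := by
    let e : Eucl n := EuclideanSpace.single i 1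
    have e1 (x) : v x * (2 * (gradient v x i * x i / (‖x‖ ^ 2 + ε))) =
        (fderiv ℝ (fun x => v x ^ 2) x) e * (x i * (‖x‖ ^ 2 + ε)⁻¹) := by
      rw [(df x).fderiv, smul_apply, ← inner_gradient_left]
      have : inner ℝ (gradient v x) e = gradient v x i := by
        rw [EuclideanSpace.inner_single_right]; simp
      rw [this, smul_eq_mul]
      ring
    have e2 (x) : v x * (v x * (1 / (‖x‖ ^ 2 + ε) - 2 * x i ^ 2 / (‖x‖ ^ 2 + ε) ^ 2)) =
        v x ^ 2 * (fderiv ℝ (fun x : Eucl n => x i * (‖x‖ ^ 2 + ε)⁻¹) x) e := by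
      rw [(dg i x).fderiv]
      have h1 : inner ℝ x e = x i := by
        rw [EuclideanSpace.inner_single_right]; simp
      have h2 : e i = 1 := by simp [e]
      simp [h1, h2]
      ring
    have i1 := cs (fun x => 2 * (gradient v x i * x i / (‖x‖ ^ 2 + ε))) (by
      have : Continuous fun x => gradient v x i := by fun_prop
      exact continuous_const.mul ((this.mul (by fun_prop)).div cr hr))
    have i2 := cs (fun x => v x * (1 / (‖x‖ ^ 2 + ε) - 2 * x i ^ 2 / (‖x‖ ^ 2 + ε) ^ 2)) (by
      exact cv.mul ((continuous_const.div cr hr).sub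
        ((by fun_prop : Continuous fun x : Eucl n => 2 * x i ^ 2).div (cr.pow 2)
          fun x => pow_ne_zero 2 (hr x))))
    have i3 := cs (fun x => v x * (x i * (‖x‖ ^ 2 + ε)⁻¹))
      (cv.mul ((by fun_prop : Continuous fun x : Eucl n => x i).mul (cr.inv₀ hr)))
    simp_rw [e1, e2] at i1 i2 ⊢
    rw [eq_comm, neg_eq_iff_eq_neg]
    refine integral_mul_fderiv_eq_neg_fderiv_mul_of_integrable i1 i2 ?_
      (fun x _ => (df x).differentiableAt) (fun x _ => (dg i x).differentiableAt)
    refine i3.congr (Eventually.of_forall fun x => ?_)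
    simp only; ring
  have sum1 : ∫ x, 2 * v x * inner ℝ (gradient v x) x / (‖x‖ ^ 2 + ε) =
      ∑ i, ∫ x, v x * (2 * (gradient v x i * x i / (‖x‖ ^ 2 + ε))) := by
    rw [← integral_finsetSum]
    · congr 1; ext x
      rw [PiLp.inner_apply]
      simp_rw [← Finset.mul_sum, ← Finset.sum_div]
      simp [mul_comm]
      ring
    · intro i _
      refine cs _ ?_
      have : Continuous fun x => gradient v x i := by fun_prop
      exact continuous_const.mul ((this.mul (by fun_prop)).div cr hr)
  have sum2 : ∫ x, v x ^ 2 * (n / (‖x‖ ^ 2 + ε) - 2 * ‖x‖ ^ 2 / (‖x‖ ^ 2 + ε) ^ 2) =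
      ∑ i : Fin n, ∫ x, v x * (v x * (1 / (‖x‖ ^ 2 + ε) - 2 * x i ^ 2 / (‖x‖ ^ 2 + ε) ^ 2)) := by
    rw [← integral_finsetSum]
    · congr 1; ext x
      simp_rw [← Finset.mul_sum, Finset.sum_sub_distrib, ← Finset.sum_div, ← Finset.mul_sum]
      rw [EuclideanSpace.norm_sq_eq]
      simp
      ring
    · intro i _
      refine cs _ ?_
      exact cv.mul ((continuous_const.div cr hr).sub
        ((by fun_prop : Continuous fun x : Eucl n => 2 * x i ^ 2).div (cr.pow 2)
          fun x => pow_ne_zero 2 (hr x)))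
  rw [sum1, sum2, ← Finset.sum_neg_distrib]
  exact Finset.sum_congr rfl fun i _ => key i

/-- The Hardy inequality for test functions, with a regularized weight: expand
`0 ≤ |∇φ + (n-2)/2 · φ X|²` for the field `X = x / (|x|² + ε)` and integrate by parts. -/
theorem IsTestFunction.hardy_regularized (hv : IsTestFunction Ω v) (hn : 3 ≤ n) {ε : ℝ}
    (hε : 0 < ε) :
    ((n : ℝ) - 2) ^ 2 / 4 * ∫ x, v x ^ 2 / (‖x‖ ^ 2 + ε) ≤ ∫ x, ‖gradient v x‖ ^ 2 := by
  have hr (x : Eucl n) : 0 < ‖x‖ ^ 2 + ε := by positivity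
  have cr : Continuous fun x : Eucl n => ‖x‖ ^ 2 + ε := by fun_prop
  have cs (F : Eucl n → ℝ) (hF : Continuous F) : Integrable (fun x => v x * F x) :=
    (hv.1.continuous.mul hF).integrable_of_hasCompactSupport hv.2.1.mul_right
  have cv := hv.1.continuous
  have cg := hv.continuous_gradient
  have hn' : (3 : ℝ) ≤ n := by exact_mod_cast hn
  set t : ℝ := ((n : ℝ) - 2) / 2 with ht
  have i1 : Integrable (fun x => v x ^ 2 / (‖x‖ ^ 2 + ε)) :=
    (cs (fun x => v x / (‖x‖ ^ 2 + ε)) (cv.div cr fun x => (hr x).ne')).congr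
      (Eventually.of_forall fun x => by simp only; ring)
  have i2 : Integrable (fun x => ‖gradient v x‖ ^ 2) :=
    (memLp_two_iff_integrable_sq_norm (hv.memLp_gradient 2).1).1 (hv.memLp_gradient 2)
  have i3 : Integrable (fun x => 2 * v x * inner ℝ (gradient v x) x / (‖x‖ ^ 2 + ε)) :=
    (cs (fun x => 2 * inner ℝ (gradient v x) x / (‖x‖ ^ 2 + ε))
      (((continuous_const.mul (cg.inner continuous_id)).div cr fun x => (hr x).ne'))).congr
      (Eventually.of_forall fun x => by simp only; ring)
  have i4 : Integrable
      (fun x => v x ^ 2 * (n / (‖x‖ ^ 2 + ε) - 2 * ‖x‖ ^ 2 / (‖x‖ ^ 2 + ε) ^ 2)) :=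
    (cs (fun x => v x * (n / (‖x‖ ^ 2 + ε) - 2 * ‖x‖ ^ 2 / (‖x‖ ^ 2 + ε) ^ 2))
      (cv.mul ((continuous_const.div cr fun x => (hr x).ne').sub
        ((by fun_prop : Continuous fun x : Eucl n => 2 * ‖x‖ ^ 2).div (cr.pow 2)
          fun x => pow_ne_zero 2 (hr x).ne')))).congr
      (Eventually.of_forall fun x => by simp only; ring)
  have pt (x) : (2 * t * t) * (v x ^ 2 / (‖x‖ ^ 2 + ε)) - t ^ 2 * (v x ^ 2 / (‖x‖ ^ 2 + ε)) ≤
      ‖gradient v x‖ ^ 2 + t * (2 * v x * inner ℝ (gradient v x) x / (‖x‖ ^ 2 + ε)) +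
        t * (v x ^ 2 * (n / (‖x‖ ^ 2 + ε) - 2 * ‖x‖ ^ 2 / (‖x‖ ^ 2 + ε) ^ 2)) := by
    have h0 := sq_nonneg ‖gradient v x + (t * v x / (‖x‖ ^ 2 + ε)) • x‖
    rw [norm_add_sq_real, norm_smul, inner_smul_right, mul_pow, Real.norm_eq_abs, sq_abs] at h0
    set r := ‖x‖ ^ 2 + ε with hrdef
    have hr0 : 0 < r := hr x
    have hx : ‖x‖ ^ 2 / r ≤ 1 := by rw [div_le_one hr0]; linarith
    have hq : ‖x‖ ^ 2 = (‖x‖ ^ 2 / r) * r := by field_simp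
    have hx0 : 0 ≤ ‖x‖ ^ 2 / r := by positivity
    set y := ‖x‖ ^ 2 / r
    have hv0 : 0 ≤ v x ^ 2 / r := by positivity
    have nt : (n : ℝ) = 2 * t + 2 := by rw [ht]; ring
    rw [hq] at h0 ⊢
    rw [nt]
    have ht0 : 0 ≤ t := by rw [ht]; linarith
    have e1 : (t * v x / r) ^ 2 * (y * r) = t ^ 2 * y * (v x ^ 2 / r) := by field_simp
    have e2 : v x ^ 2 * ((2 * t + 2) / r - 2 * (y * r) / r ^ 2) =
        (2 * t + 2 - 2 * y) * (v x ^ 2 / r) := by field_simp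
    have e3 : 2 * v x * inner ℝ (gradient v x) x / r =
      2 * (v x / r * inner ℝ (gradient v x) x) := by ring
    have e4 : 2 * (t * v x / r * inner ℝ (gradient v x) x) =
      2 * t * (v x / r * inner ℝ (gradient v x) x) := by ring
    rw [e1, e4] at h0
    rw [e2, e3]
    have : 0 ≤ (t * (1 - y)) * (v x ^ 2 / r) :=
      mul_nonneg (mul_nonneg ht0 (by linarith)) hv0
    have : 0 ≤ (t ^ 2 * (1 - y)) * (v x ^ 2 / r) :=
      mul_nonneg (mul_nonneg (by positivity) (by linarith)) hv0
    nlinarith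
  have hI := integral_mono ((i1.const_mul (2 * t * t)).sub (i1.const_mul (t ^ 2)))
    ((i2.add (i3.const_mul t)).add (i4.const_mul t)) pt
  simp only [Pi.add_apply, Pi.sub_apply] at hI
  rw [integral_add (f := fun x => ‖gradient v x‖ ^ 2 +
      t * (2 * v x * inner ℝ (gradient v x) x / (‖x‖ ^ 2 + ε))) (i2.add (i3.const_mul t)) (i4.const_mul t),
    integral_add i2 (i3.const_mul t), integral_sub (i1.const_mul _) (i1.const_mul _)] at hI
  simp only [integral_const_mul] at hI
  rw [hv.integral_hardy_field hε] at hI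
  have : ((n : ℝ) - 2) ^ 2 / 4 = t ^ 2 := by rw [ht]; ring
  rw [this]
  linarith

theorem lintegral_enorm_sq_eq {X E : Type*} [MeasurableSpace X] {μ : Measure X}
    [NormedAddCommGroup E] (f : X → E) : ∫⁻ x, ‖f x‖ₑ ^ 2 ∂μ = eLpNorm f 2 μ ^ 2 := by
  have := eLpNorm_nnreal_pow_eq_lintegral (f := f) (μ := μ) (p := 2) (by norm_num)
  norm_num at this
  rw [this]

theorem IsTestFunction.hardy_lintegral_regularized (hv : IsTestFunction Ω v) (hn : 3 ≤ n)
    {ε : ℝ} (hε : 0 < ε) :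
    ∫⁻ x, ENNReal.ofReal (v x ^ 2 / (‖x‖ ^ 2 + ε)) ≤
      ENNReal.ofReal (4 / ((n : ℝ) - 2) ^ 2) * ∫⁻ x, ‖gradient v x‖ₑ ^ 2 := by
  have hr (x : Eucl n) : 0 < ‖x‖ ^ 2 + ε := by positivity
  have hn' : (3 : ℝ) ≤ n := by exact_mod_cast hn
  have i1 : Integrable (fun x => v x ^ 2 / (‖x‖ ^ 2 + ε)) := by
    have cF : Continuous fun x : Eucl n => v x / (‖x‖ ^ 2 + ε) :=
      hv.1.continuous.div (by fun_prop) fun x => (hr x).ne'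
    refine ((hv.1.continuous.mul cF).integrable_of_hasCompactSupport hv.2.1.mul_right).congr
      (Eventually.of_forall fun x => ?_)
    simp only [Pi.mul_apply]; ring
  have i2 : Integrable (fun x => ‖gradient v x‖ ^ 2) :=
    (memLp_two_iff_integrable_sq_norm (hv.memLp_gradient 2).1).1 (hv.memLp_gradient 2)
  have e : ∫⁻ x, ‖gradient v x‖ₑ ^ 2 = ENNReal.ofReal (∫ x, ‖gradient v x‖ ^ 2) := by
    rw [ofReal_integral_eq_lintegral_ofReal i2 (Eventually.of_forall fun x => by positivity)]
    simp_rw [ENNReal.ofReal_pow (norm_nonneg _), ofReal_norm]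
  rw [e, ← ofReal_integral_eq_lintegral_ofReal i1
    (Eventually.of_forall fun x => by have := hr x; positivity),
    ← ENNReal.ofReal_mul (by positivity)]
  refine ENNReal.ofReal_le_ofReal ?_
  have := hv.hardy_regularized hn hε
  have h2 : 0 < ((n : ℝ) - 2) ^ 2 := by
    have : 0 < (n : ℝ) - 2 := by linarith
    positivity
  rw [div_mul_eq_mul_div, le_div_iff₀ h2]
  linarith

/-- Hardy's inequality with the optimal constant in `W₀^{1,2}(Ω)`. -/
theorem MemSobolevZero.hardy (hn : 3 ≤ n) (h : MemSobolevZero 2 Ω u G) :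
    ∫⁻ x, ENNReal.ofReal (u x ^ 2 / ‖x‖ ^ 2) ≤
      ENNReal.ofReal (4 / ((n : ℝ) - 2) ^ 2) * ∫⁻ x, ‖G x‖ₑ ^ 2 := by
  obtain ⟨a, b, -, φ, hφ, h1, h2⟩ := h
  obtain ⟨σ, hσ, hσu⟩ := exists_subseq_tendsto_ae (by simp) (fun j => ((hφ j).memLp 2).1) a.1 h1
  let ε : ℕ → ℝ := fun j => 1 / ((j : ℝ) + 1)
  have ε0 (j) : 0 < ε j := Nat.one_div_pos_of_nat
  have εlim : Tendsto ε atTop (𝓝 0) := tendsto_one_div_add_atTop_nhds_zero_nat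
  have hlim : Tendsto (fun j => ENNReal.ofReal (4 / ((n : ℝ) - 2) ^ 2) *
      ∫⁻ x, ‖gradient (φ (σ j)) x‖ₑ ^ 2) atTop
      (𝓝 (ENNReal.ofReal (4 / ((n : ℝ) - 2) ^ 2) * ∫⁻ x, ‖G x‖ₑ ^ 2)) := by
    refine ENNReal.Tendsto.const_mul ?_ (Or.inr ENNReal.ofReal_ne_top)
    simp_rw [lintegral_enorm_sq_eq]
    have := tendsto_eLpNorm_of_tendsto_sub (by norm_num) (fun j => (hφ j).memLp_gradient 2) b h2
    exact (ENNReal.continuous_pow 2).tendsto _ |>.comp (this.comp hσ.tendsto_atTop)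
  have hne : ∀ᵐ x : Eucl n, x ≠ 0 := by
    have : Nontrivial (Eucl n) := by
      have : Nonempty (Fin n) := ⟨⟨0, by omega⟩⟩
      infer_instance
    simp [ae_iff]
  have fatou : ∫⁻ x, ENNReal.ofReal (u x ^ 2 / ‖x‖ ^ 2) ≤
      liminf (fun j => ∫⁻ x, ENNReal.ofReal (φ (σ j) x ^ 2 / (‖x‖ ^ 2 + ε j))) atTop := by
    refine le_trans (lintegral_mono_ae ?_) (lintegral_liminf_le' fun j => ?_)
    · filter_upwards [hσu, hne] with x hx hx0
      refine le_of_eq (Tendsto.liminf_eq ?_).symm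
      refine (ENNReal.continuous_ofReal.tendsto _).comp ?_
      have := (hx.pow 2).div (εlim.const_add (‖x‖ ^ 2)) (by simpa using hx0)
      simpa [Pi.div_def] using this
    · refine AEMeasurable.ennreal_ofReal (Continuous.aemeasurable ?_)
      exact ((hφ (σ j)).1.continuous.pow 2).div (by fun_prop)
        fun x => by have := ε0 j; positivity
  refine fatou.trans (le_trans (liminf_le_liminf (Eventually.of_forall fun j =>
    (hφ (σ j)).hardy_lintegral_regularized hn (ε0 j))) hlim.liminf_eq.le)

/-- An inequality between the norms of a test function and its gradient extends to
`W₀^{1,p}(Ω)`. -/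
theorem MemSobolevZero.eLpNorm_le_of_forall (hp : 1 ≤ p) {C : ℝ≥0∞} (hC : C ≠ ⊤)
    (H : ∀ φ : Eucl n → ℝ, IsTestFunction Ω φ → eLpNorm φ q volume ≤
      C * eLpNorm (gradient φ) p volume)
    (h : MemSobolevZero p Ω u G) : eLpNorm u q volume ≤ C * eLpNorm G p volume := by
  obtain ⟨a, b, -, φ, hφ, h1, h2⟩ := h
  obtain ⟨σ, hσ, hσu⟩ :=
    exists_subseq_tendsto_ae (by positivity) (fun j => ((hφ j).memLp p).1) a.1 h1
  have l := tendsto_eLpNorm_of_tendsto_sub hp (fun j => (hφ j).memLp_gradient p) b h2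
  have l' := ENNReal.Tendsto.const_mul (l.comp hσ.tendsto_atTop) (Or.inr hC)
  refine (Lp.eLpNorm_lim_le_liminf_eLpNorm (fun j => ((hφ (σ j)).memLp q).1) u hσu).trans ?_
  exact (liminf_le_liminf (Eventually.of_forall fun j => H _ (hφ (σ j)))).trans l'.liminf_eq.le

/-- Poincaré's inequality in `W₀^{1,p}(Ω)`, `1 ≤ p < n`. -/
theorem exists_poincare (hΩb : Bornology.IsBounded Ω) {p : ℝ} (hp : 1 ≤ p) (hpn : p < n) :
    ∃ C : ℝ≥0∞, C ≠ ⊤ ∧ ∀ (u : Eucl n → ℝ) (G : Eucl n → Eucl n),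
      MemSobolevZero (ENNReal.ofReal p) Ω u G →
      eLpNorm u (ENNReal.ofReal p) volume ≤ C * eLpNorm G (ENNReal.ofReal p) volume := by
  refine ⟨eLpNormLESNormFDerivOfLeConst ℝ volume Ω p.toNNReal p.toNNReal, ENNReal.coe_ne_top,
    fun u G h => h.eLpNorm_le_of_forall (by simpa using hp) ENNReal.coe_ne_top fun φ hφ => ?_⟩
  have := eLpNorm_le_eLpNorm_fderiv (μ := volume) (hφ.1.of_le (by simp))
    ((subset_tsupport φ).trans hφ.2.2) (p := p.toNNReal) (by simpa using hp)
    (by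
      rw [finrank_euclideanSpace_fin, ← NNReal.coe_lt_coe, Real.coe_toNNReal p (by linarith)]
      exact_mod_cast hpn) hΩb
  refine this.trans (le_of_eq ?_)
  congr 1
  exact eLpNorm_congr_norm_ae (Eventually.of_forall fun x => (norm_gradient_eq φ x).symm)

/-- Sobolev's inequality in `W₀^{1,2}(Ω)`. -/
theorem exists_sobolev (hn : 3 ≤ n) (Ω : Set (Eucl n)) :
    ∃ C : ℝ≥0∞, C ≠ ⊤ ∧ ∀ (u : Eucl n → ℝ) (G : Eucl n → Eucl n),
      MemSobolevZero 2 Ω u G →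
      eLpNorm u (ENNReal.ofReal (2 * n / ((n : ℝ) - 2))) volume ≤ C * eLpNorm G 2 volume := by
  have hn' : (3 : ℝ) ≤ n := by exact_mod_cast hn
  refine ⟨SNormLESNormFDerivOfEqConst ℝ (volume : Measure (Eucl n)) 2, ENNReal.coe_ne_top,
    fun u G h => h.eLpNorm_le_of_forall (by simp) ENNReal.coe_ne_top fun φ hφ => ?_⟩
  have := eLpNorm_le_eLpNorm_fderiv_of_eq (μ := volume) (hφ.1.of_le (by simp)) hφ.2.1
    (p := 2) (p' := (2 * n / ((n : ℝ) - 2)).toNNReal) (by simp)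
    (by rw [finrank_euclideanSpace_fin]; omega) (by
      rw [finrank_euclideanSpace_fin, Real.coe_toNNReal _ (by
        apply div_nonneg <;> linarith)]
      have : (n : ℝ) - 2 ≠ 0 := by linarith
      have : (n : ℝ) ≠ 0 := by linarith
      push_cast
      field_simp)
  refine this.trans (le_of_eq ?_)
  congr 1
  exact eLpNorm_congr_norm_ae (Eventually.of_forall fun x => (norm_gradient_eq φ x).symm)

end Inequalities

/-! ### The nonlocal energy -/

section Nonlocal

variable {n : ℕ} {Ω : Set (Eucl n)} {u v : Eucl n → ℝ} {G V : Eucl n → Eucl n} {s : ℝ}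

theorem integrable_min_one_norm_sq_div_rpow (hn : 1 ≤ n) (hs0 : 0 < s) (hs1 : s < 1) :
    Integrable (fun h : Eucl n => min 1 ‖h‖ ^ 2 / ‖h‖ ^ ((n : ℝ) + 2 * s)) := by
  have : Nontrivial (Eucl n) := by
    have : Nonempty (Fin n) := ⟨⟨0, by omega⟩⟩
    infer_instance
  rw [integrable_fun_norm_addHaar volume
    (f := fun y : ℝ => min 1 y ^ 2 / y ^ ((n : ℝ) + 2 * s)), finrank_euclideanSpace_fin,
    ← Set.Ioc_union_Ioi_eq_Ioi zero_le_one]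
  have e (y : ℝ) (hy : 0 < y) : y ^ (n - 1) = y ^ ((n : ℝ) - 1) := by
    rw [← Real.rpow_natCast, Nat.cast_sub hn, Nat.cast_one]
  refine IntegrableOn.union ?_ ?_
  · have h1 : IntegrableOn (fun y : ℝ => y ^ (1 - 2 * s)) (Set.Ioc 0 1) :=
      (intervalIntegrable_iff_integrableOn_Ioc_of_le zero_le_one).1
        (intervalIntegral.intervalIntegrable_rpow' (by linarith))
    refine h1.congr_fun (fun y hy => ?_) measurableSet_Ioc
    simp only [smul_eq_mul]
    rw [e y hy.1, min_eq_right hy.2, ← Real.rpow_natCast y 2, ← Real.rpow_sub hy.1,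
      ← Real.rpow_add hy.1]
    congr 1; push_cast; ring
  · have h1 : IntegrableOn (fun y : ℝ => y ^ (-1 - 2 * s)) (Set.Ioi 1) :=
      integrableOn_Ioi_rpow_of_lt (by linarith) one_pos
    refine h1.congr_fun (fun y hy => ?_) measurableSet_Ioi
    have hy0 : 0 < y := one_pos.trans hy
    simp only [smul_eq_mul]
    rw [e y hy0, min_eq_left (le_of_lt hy), one_pow, one_div, ← Real.rpow_neg hy0.le,
      ← Real.rpow_add hy0]
    congr 1; ring

/-- The mean value inequality in the mean: `‖φ(· + h) - φ‖_p ≤ |h| ‖∇φ‖_p`. -/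
theorem IsTestFunction.lintegral_translate_sub_le (hv : IsTestFunction Ω v) {p : ℕ} (hp : 1 ≤ p)
    (h : Eucl n) : ∫⁻ x, ‖v (x + h) - v x‖ₑ ^ p ≤ ‖h‖ₑ ^ p * ∫⁻ x, ‖gradient v x‖ₑ ^ p := by
  have cg := hv.continuous_gradient
  have pt (x : Eucl n) : ‖v (x + h) - v x‖ₑ ^ p ≤
      ∫⁻ t in Set.Ioc (0 : ℝ) 1, ‖h‖ₑ ^ p * ‖gradient v (x + t • h)‖ₑ ^ p := by
    have ct : Continuous fun t : ℝ => inner ℝ (gradient v (x + t • h)) h :=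
      (cg.comp (by fun_prop)).inner continuous_const
    have e1 : v (x + h) - v x = ∫ t in (0 : ℝ)..1, inner ℝ (gradient v (x + t • h)) h := by
      have hd (t : ℝ) : HasDerivAt (fun t : ℝ => v (x + t • h))
          (inner ℝ (gradient v (x + t • h)) h) t := by
        have a1 : HasDerivAt (fun t : ℝ => x + t • h) h t := by
          simpa using ((hasDerivAt_id t).smul_const h).const_add x
        have := (hv.differentiable (x + t • h)).hasFDerivAt.comp_hasDerivAt t a1
        rwa [inner_gradient_left]
      rw [intervalIntegral.integral_eq_sub_of_hasDerivAt (fun t _ => hd t)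
        (ct.intervalIntegrable _ _)]
      simp
    have e2 : ‖v (x + h) - v x‖ₑ ≤
        ∫⁻ t in Set.Ioc (0 : ℝ) 1, ‖inner ℝ (gradient v (x + t • h)) h‖ₑ := by
      rw [e1, intervalIntegral.integral_of_le zero_le_one]
      exact enorm_integral_le_lintegral_enorm _
    have : IsProbabilityMeasure (volume.restrict (Set.Ioc (0 : ℝ) 1)) :=
      ⟨by simp⟩
    have e3 : (∫⁻ t in Set.Ioc (0 : ℝ) 1, ‖inner ℝ (gradient v (x + t • h)) h‖ₑ) ^ p ≤
        ∫⁻ t in Set.Ioc (0 : ℝ) 1, ‖inner ℝ (gradient v (x + t • h)) h‖ₑ ^ p := by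
      have := eLpNorm_le_eLpNorm_of_exponent_le (μ := volume.restrict (Set.Ioc (0 : ℝ) 1))
        (p := 1) (q := p) (by exact_mod_cast hp) ct.aestronglyMeasurable
      rw [eLpNorm_one_eq_lintegral_enorm] at this
      refine (pow_le_pow_left' this p).trans (le_of_eq ?_)
      have h3 := eLpNorm_nnreal_pow_eq_lintegral (p := (p : NNReal))
        (f := fun t : ℝ => inner ℝ (gradient v (x + t • h)) h)
        (μ := volume.restrict (Set.Ioc (0 : ℝ) 1)) (by positivity)
      simpa using h3
    refine (pow_le_pow_left' e2 p).trans (e3.trans (lintegral_mono fun t => ?_))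
    rw [← mul_pow, mul_comm]
    refine pow_le_pow_left' ?_ p
    simpa [enorm_eq_nnnorm, ← ENNReal.coe_mul] using
      (ENNReal.coe_le_coe.2 (nnnorm_inner_le_nnnorm (𝕜 := ℝ) (gradient v (x + t • h)) h))
  refine (lintegral_mono pt).trans (le_of_eq ?_)
  rw [lintegral_lintegral_swap]
  · have (t : ℝ) : ∫⁻ x, ‖h‖ₑ ^ p * ‖gradient v (x + t • h)‖ₑ ^ p =
        ‖h‖ₑ ^ p * ∫⁻ x, ‖gradient v x‖ₑ ^ p := by
      rw [lintegral_const_mul' _ _ (by simp)]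
      rw [lintegral_add_right_eq_self (fun x => ‖gradient v x‖ₑ ^ p)]
    simp [this]
  · refine Continuous.aemeasurable ?_
    refine ENNReal.continuous_const_mul (by simp) |>.comp ?_
    refine (ENNReal.continuous_pow p).comp (continuous_enorm.comp (cg.comp ?_))
    fun_prop

theorem IsTestFunction.lintegral_translate_sub_le' (hv : IsTestFunction Ω v) {p : ℕ}
    (hp : 1 ≤ p) (h : Eucl n) :
    ∫⁻ x, ‖v (x + h) - v x‖ₑ ^ p ≤ 2 ^ p * ∫⁻ x, ‖v x‖ₑ ^ p := by
  have e (f : Eucl n → ℝ) : ∫⁻ x, ‖f x‖ₑ ^ p = eLpNorm f p volume ^ p := by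
    have := eLpNorm_nnreal_pow_eq_lintegral (p := (p : NNReal)) (f := f) (μ := volume)
      (by positivity)
    simpa using this.symm
  rw [e, e, ← mul_pow]
  refine pow_le_pow_left' ?_ p
  have c1 : Continuous fun x => v (x + h) := hv.1.continuous.comp (by fun_prop)
  refine (eLpNorm_sub_le c1.aestronglyMeasurable (hv.memLp 1).1 (by exact_mod_cast hp)).trans ?_
  have : eLpNorm (fun x => v (x + h)) p volume = eLpNorm v p volume :=
    eLpNorm_comp_measurePreserving (hv.memLp 1).1 (measurePreserving_add_right volume h)
  rw [this, two_mul]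

/-- A weighted integral of the increments of a Sobolev function is controlled by its norm in
`W^{1,p}`, if the weight is integrable against `min(1, |h|)^p`. -/
theorem MemSobolevZero.lintegral_increment_le {p : ℕ} (hp : 1 ≤ p)
    (hu : MemSobolevZero p Ω u G) {k : Eucl n → ℝ≥0∞} (hk : Measurable k)
    (hK : ∫⁻ h, ENNReal.ofReal (min 1 ‖h‖) ^ p * k h ≠ ⊤) :
    ∫⁻ q : Eucl n × Eucl n, ‖u q.1 - u q.2‖ₑ ^ p * k (q.1 - q.2) ≤
      (∫⁻ h, ENNReal.ofReal (min 1 ‖h‖) ^ p * k h) *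
        (2 ^ p * eLpNorm u p volume ^ p + eLpNorm G p volume ^ p) := by
  have ee {E : Type} [NormedAddCommGroup E] (f : Eucl n → E) :
      ∫⁻ x, ‖f x‖ₑ ^ p = eLpNorm f p volume ^ p := by
    have := eLpNorm_nnreal_pow_eq_lintegral (p := (p : NNReal)) (f := f) (μ := volume)
      (by positivity)
    simpa using this.symm
  have test {φ : Eucl n → ℝ} (hφ : IsTestFunction Ω φ) :
      ∫⁻ q : Eucl n × Eucl n, ‖φ q.1 - φ q.2‖ₑ ^ p * k (q.1 - q.2) ≤
      (∫⁻ h, ENNReal.ofReal (min 1 ‖h‖) ^ p * k h) *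
        (2 ^ p * eLpNorm φ p volume ^ p + eLpNorm (gradient φ) p volume ^ p) := by
    have cφ := hφ.1.continuous
    have m1 : Measurable fun q : Eucl n × Eucl n => ‖φ q.1 - φ q.2‖ₑ ^ p * k (q.1 - q.2) :=
      (((cφ.comp continuous_fst).sub (cφ.comp continuous_snd)).enorm.measurable.pow_const
        p).mul (hk.comp (measurable_fst.sub measurable_snd))
    have m2 : Measurable fun q : Eucl n × Eucl n => ‖φ (q.2 + q.1) - φ q.2‖ₑ ^ p * k q.1 :=
      (((cφ.comp (continuous_snd.add continuous_fst)).sub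
        (cφ.comp continuous_snd)).enorm.measurable.pow_const p).mul (hk.comp measurable_fst)
    rw [Measure.volume_eq_prod, lintegral_prod_symm _ m1.aemeasurable]
    have s1 (y : Eucl n) : ∫⁻ x, ‖φ x - φ y‖ₑ ^ p * k (x - y) =
        ∫⁻ h, ‖φ (y + h) - φ y‖ₑ ^ p * k h := by
      rw [← lintegral_add_left_eq_self _ y]
      simp
    simp only [s1]
    rw [lintegral_lintegral_swap (f := fun y h => ‖φ (y + h) - φ y‖ₑ ^ p * k h)
      (m2.comp measurable_swap).aemeasurable,
      ← lintegral_mul_const]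
    swap
    · exact ((by fun_prop : Measurable fun h : Eucl n =>
        ENNReal.ofReal (min 1 ‖h‖) ^ p)).mul hk
    refine lintegral_mono fun h => ?_
    have m3 : Measurable fun y => ‖φ (y + h) - φ y‖ₑ ^ p :=
      ((cφ.comp (continuous_id.add continuous_const)).sub cφ).enorm.measurable.pow_const p
    simp only
    rw [lintegral_mul_const _ m3, mul_right_comm]
    gcongr
    rcases le_total ‖h‖ 1 with h1 | h1
    · rw [min_eq_right h1, ofReal_norm]
      refine (hφ.lintegral_translate_sub_le hp h).trans ?_
      rw [ee]
      gcongr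
      exact le_add_self
    · rw [min_eq_left h1, ENNReal.ofReal_one, one_pow, one_mul]
      refine (hφ.lintegral_translate_sub_le' hp h).trans ?_
      rw [ee]
      exact le_self_add
  have hp' : (1 : ℝ≥0∞) ≤ p := by exact_mod_cast hp
  obtain ⟨a, b, -, φ, hφ, h1, h2⟩ := hu
  obtain ⟨σ, hσ, hσu⟩ :=
    exists_subseq_tendsto_ae (by positivity) (fun j => ((hφ j).memLp p).1) a.1 h1
  have fatou : ∫⁻ q : Eucl n × Eucl n, ‖u q.1 - u q.2‖ₑ ^ p * k (q.1 - q.2) ≤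
      liminf (fun j => ∫⁻ q : Eucl n × Eucl n,
        ‖φ (σ j) q.1 - φ (σ j) q.2‖ₑ ^ p * k (q.1 - q.2)) atTop := by
    refine le_trans (lintegral_mono_ae ?_) (lintegral_liminf_le fun j => ?_)
    · have a1 : ∀ᵐ q : Eucl n × Eucl n, Tendsto (fun j => φ (σ j) q.1) atTop (𝓝 (u q.1)) :=
        Measure.quasiMeasurePreserving_fst.ae hσu
      have a2 : ∀ᵐ q : Eucl n × Eucl n, Tendsto (fun j => φ (σ j) q.2) atTop (𝓝 (u q.2)) :=
        Measure.quasiMeasurePreserving_snd.ae hσu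
      filter_upwards [a1, a2] with q q1 q2
      have t1 := ((continuous_enorm.tendsto _).comp (q1.sub q2))
      have t2 := ((ENNReal.continuous_pow p).tendsto _).comp t1
      by_cases h0 : ‖u q.1 - u q.2‖ₑ ^ p = 0
      · rw [h0, zero_mul]; exact zero_le
      · exact (ENNReal.Tendsto.mul_const t2 (Or.inl h0)).liminf_eq.ge
    · have cφ := (hφ (σ j)).1.continuous
      exact (((cφ.comp continuous_fst).sub (cφ.comp continuous_snd)).enorm.measurable.pow_const
        p).mul (hk.comp (measurable_fst.sub measurable_snd))
  refine fatou.trans ((liminf_le_liminf (Eventually.of_forall fun j => test (hφ (σ j)))).trans ?_)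
  have l1 := (tendsto_eLpNorm_of_tendsto_sub hp' (fun j => (hφ j).memLp p) a h1).comp
    hσ.tendsto_atTop
  have l2 := (tendsto_eLpNorm_of_tendsto_sub hp' (fun j => (hφ j).memLp_gradient p) b h2).comp
    hσ.tendsto_atTop
  have l1' := ENNReal.Tendsto.const_mul (a := 2 ^ p)
    (((ENNReal.continuous_pow p).tendsto _).comp l1) (Or.inr (by simp))
  have l2' := ((ENNReal.continuous_pow p).tendsto _).comp l2
  have l3 := l1'.add l2'
  exact (ENNReal.Tendsto.const_mul l3 (Or.inr hK)).liminf_eq.le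


/-- The total mass of `min(1, |h|)² / |h|^{n+2s}`, the constant in the bounds for the nonlocal
energy. -/
noncomputable def kernelMass (n : ℕ) (s : ℝ) : ℝ≥0∞ :=
  ∫⁻ h : Eucl n, ENNReal.ofReal (min 1 ‖h‖ ^ 2 / ‖h‖ ^ ((n : ℝ) + 2 * s))

theorem kernelMass_ne_top (hn : 1 ≤ n) (hs0 : 0 < s) (hs1 : s < 1) : kernelMass n s ≠ ⊤ :=
  (integrable_min_one_norm_sq_div_rpow hn hs0 hs1).lintegral_lt_top.ne

theorem measurable_norm_rpow (r : ℝ) : Measurable fun h : Eucl n => ‖h‖ ^ r :=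
  measurable_norm.pow_const r

/-- The Gagliardo energy is controlled by the norm of `W^{1,2}`. -/
theorem MemSobolevZero.lintegral_gagliardo_le (hn : 1 ≤ n) (hs0 : 0 < s) (hs1 : s < 1)
    (hu : MemSobolevZero 2 Ω u G) :
    ∫⁻ q : Eucl n × Eucl n,
      ENNReal.ofReal ((u q.1 - u q.2) ^ 2 / ‖q.1 - q.2‖ ^ ((n : ℝ) + 2 * s)) ≤
      kernelMass n s * (4 * eLpNorm u 2 volume ^ 2 + eLpNorm G 2 volume ^ 2) := by
  let k : Eucl n → ℝ≥0∞ := fun h => ENNReal.ofReal (1 / ‖h‖ ^ ((n : ℝ) + 2 * s))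
  have hk : Measurable k := (measurable_const.div (measurable_norm_rpow _)).ennreal_ofReal
  have hK : ∫⁻ h, ENNReal.ofReal (min 1 ‖h‖) ^ 2 * k h = kernelMass n s := by
    refine lintegral_congr fun h => ?_
    have : 0 ≤ min 1 ‖h‖ := le_min zero_le_one (norm_nonneg h)
    rw [← ENNReal.ofReal_pow this, ← ENNReal.ofReal_mul (by positivity), mul_one_div]
  have := MemSobolevZero.lintegral_increment_le (p := 2) (by norm_num) (by exact_mod_cast hu) hk
    (hK ▸ kernelMass_ne_top hn hs0 hs1)
  rw [hK] at this
  norm_num at this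
  refine le_trans (le_of_eq (lintegral_congr fun q => ?_)) this
  simp only [k]
  rw [← ofReal_norm, ← ENNReal.ofReal_pow (norm_nonneg _), Real.norm_eq_abs, sq_abs,
    ← ENNReal.ofReal_mul (by positivity), mul_one_div]

/-- The nonlocal form is bounded on `W^{1,1} × C₀^∞`. -/
theorem exists_nonlocalKernel_bound (hn : 1 ≤ n) (hs0 : 0 < s) (hs1 : s < 1)
    (hv : IsTestFunction Ω v) : ∃ C : ℝ≥0∞, C ≠ ⊤ ∧
      ∀ (Ω' : Set (Eucl n)) (u : Eucl n → ℝ) (G : Eucl n → Eucl n), MemSobolevZero 1 Ω' u G →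
        ∫⁻ q, ‖nonlocalKernel s u v q‖ₑ ≤
          C * (2 * eLpNorm u 1 volume + eLpNorm G 1 volume) := by
  obtain ⟨L, hL⟩ : ∃ L : ℝ, 0 ≤ L ∧ ∀ x y, |v x - v y| ≤ L * min 1 ‖x - y‖ := by
    obtain ⟨B, hB⟩ := hv.2.1.exists_bound_of_continuous hv.1.continuous
    obtain ⟨A, hA⟩ := ContDiff.lipschitzWith_of_hasCompactSupport hv.2.1 hv.1 (by simp)
    have hB0 : 0 ≤ B := (norm_nonneg _).trans (hB 0)
    refine ⟨A + 2 * B, by positivity, fun x y => ?_⟩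
    have h1 : |v x - v y| ≤ A * ‖x - y‖ := by
      have := hA.dist_le_mul x y
      rwa [Real.dist_eq, dist_eq_norm] at this
    have h2 : |v x - v y| ≤ 2 * B := by
      have := norm_sub_le (v x) (v y)
      rw [Real.norm_eq_abs (v x - v y)] at this
      linarith [hB x, hB y]
    rcases le_total 1 ‖x - y‖ with h | h
    · rw [min_eq_left h]
      linarith [A.2, (A.coe_nonneg)]
    · rw [min_eq_right h]
      nlinarith [norm_nonneg (x - y), A.coe_nonneg]
  let k : Eucl n → ℝ≥0∞ := fun h => ENNReal.ofReal (min 1 ‖h‖ / ‖h‖ ^ ((n : ℝ) + 2 * s))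
  have hk : Measurable k :=
    ((measurable_const.min measurable_norm).div (measurable_norm_rpow _)).ennreal_ofReal
  have hK : ∫⁻ h, ENNReal.ofReal (min 1 ‖h‖) ^ 1 * k h = kernelMass n s := by
    refine lintegral_congr fun h => ?_
    have : 0 ≤ min 1 ‖h‖ := le_min zero_le_one (norm_nonneg h)
    simp only [k]
    rw [pow_one, ← ENNReal.ofReal_mul this, mul_div_assoc', sq]
  refine ⟨ENNReal.ofReal L * kernelMass n s,
    ENNReal.mul_ne_top ENNReal.ofReal_ne_top (kernelMass_ne_top hn hs0 hs1),
    fun Ω' u G hu => ?_⟩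
  have := MemSobolevZero.lintegral_increment_le (p := 1) le_rfl (by exact_mod_cast hu) hk
    (hK ▸ kernelMass_ne_top hn hs0 hs1)
  rw [hK] at this
  norm_num at this
  rw [mul_assoc]
  refine le_trans ?_ (mul_le_mul_right this _)
  rw [← lintegral_const_mul' _ _ ENNReal.ofReal_ne_top]
  refine lintegral_mono fun q => ?_
  rw [← ofReal_norm, ← ofReal_norm]
  simp only [k]
  rw [← ENNReal.ofReal_mul (norm_nonneg _), ← ENNReal.ofReal_mul hL.1]
  refine ENNReal.ofReal_le_ofReal ?_
  have h1 := hL.2 q.1 q.2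
  have h2 : 0 ≤ ‖q.1 - q.2‖ ^ ((n : ℝ) + 2 * s) := by positivity
  rw [nonlocalKernel, norm_div, norm_mul, Real.norm_of_nonneg h2, mul_div_assoc',
    mul_div_assoc']
  refine div_le_div_of_nonneg_right ?_ h2
  have := mul_le_mul_of_nonneg_left h1 (norm_nonneg (u q.1 - u q.2))
  rw [Real.norm_eq_abs (v q.1 - v q.2)]
  linarith

/-- The difference quotient `(u(x) - u(y)) / |x-y|^{n/2+s}`, whose square is the Gagliardo
energy density. -/
noncomputable def diffQuot (s : ℝ) (u : Eucl n → ℝ) (q : Eucl n × Eucl n) : ℝ :=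
  (u q.1 - u q.2) / ‖q.1 - q.2‖ ^ (((n : ℝ) + 2 * s) / 2)

theorem nonlocalKernel_eq_diffQuot_mul (hs0 : 0 < s) (u v : Eucl n → ℝ)
    (q : Eucl n × Eucl n) : nonlocalKernel s u v q = diffQuot s u q * diffQuot s v q := by
  have : ‖q.1 - q.2‖ ^ ((n : ℝ) + 2 * s) =
      ‖q.1 - q.2‖ ^ (((n : ℝ) + 2 * s) / 2) * ‖q.1 - q.2‖ ^ (((n : ℝ) + 2 * s) / 2) := by
    rw [← Real.rpow_add_of_nonneg (norm_nonneg _) (by positivity) (by positivity), add_halves]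
  rw [nonlocalKernel, diffQuot, diffQuot, this, div_mul_div_comm]

theorem aestronglyMeasurable_diffQuot (hu : AEStronglyMeasurable u) :
    AEStronglyMeasurable (diffQuot s u) := by
  have h1 : AEStronglyMeasurable (fun q : Eucl n × Eucl n => u q.1 - u q.2) :=
    hu.comp_fst.sub hu.comp_snd
  have h2 : Measurable fun q : Eucl n × Eucl n => ‖q.1 - q.2‖ ^ (((n : ℝ) + 2 * s) / 2) :=
    (measurable_norm_rpow _).comp (measurable_fst.sub measurable_snd)
  exact (h1.aemeasurable.div h2.aemeasurable).aestronglyMeasurable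

theorem eLpNorm_diffQuot_sq (hs0 : 0 < s) (u : Eucl n → ℝ) :
    eLpNorm (diffQuot s u) 2 volume ^ 2 = ∫⁻ q : Eucl n × Eucl n,
      ENNReal.ofReal ((u q.1 - u q.2) ^ 2 / ‖q.1 - q.2‖ ^ ((n : ℝ) + 2 * s)) := by
  rw [← lintegral_enorm_sq_eq]
  refine lintegral_congr fun q => ?_
  have := nonlocalKernel_eq_diffQuot_mul hs0 u u q
  rw [nonlocalKernel, ← sq, ← sq] at this
  rw [this, ← ofReal_norm, ← ENNReal.ofReal_pow (norm_nonneg _), Real.norm_eq_abs, sq_abs]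

theorem MemSobolevZero.eLpNorm_diffQuot_sq_le (hn : 1 ≤ n) (hs0 : 0 < s) (hs1 : s < 1)
    (hu : MemSobolevZero 2 Ω u G) :
    eLpNorm (diffQuot s u) 2 volume ^ 2 ≤
      kernelMass n s * (4 * eLpNorm u 2 volume ^ 2 + eLpNorm G 2 volume ^ 2) :=
  (eLpNorm_diffQuot_sq hs0 u).trans_le (hu.lintegral_gagliardo_le hn hs0 hs1)

theorem MemSobolevZero.memLp_diffQuot (hn : 1 ≤ n) (hs0 : 0 < s) (hs1 : s < 1)
    (hu : MemSobolevZero 2 Ω u G) : MemLp (diffQuot s u) 2 := by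
  refine ⟨aestronglyMeasurable_diffQuot hu.1.1, ?_⟩
  have h := hu.eLpNorm_diffQuot_sq_le hn hs0 hs1
  have h2 : kernelMass n s * (4 * eLpNorm u 2 volume ^ 2 + eLpNorm G 2 volume ^ 2) ≠ ⊤ :=
    ENNReal.mul_ne_top (kernelMass_ne_top hn hs0 hs1) (ENNReal.add_ne_top.2
      ⟨ENNReal.mul_ne_top (by simp) (ENNReal.pow_ne_top hu.1.2.ne),
        ENNReal.pow_ne_top hu.2.1.2.ne⟩)
  have h3 := ne_top_of_le_ne_top h2 h
  by_contra h4
  rw [not_lt_top_iff] at h4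
  simp [h4] at h3

/-- For `0 < s < 1`, the space `𝒳^{1,2}(Ω)` is `W₀^{1,2}(Ω)`. -/
theorem memX12_iff (hn : 1 ≤ n) (hs0 : 0 < s) (hs1 : s < 1) :
    MemX12 s Ω u G ↔ MemSobolevZero 2 Ω u G := by
  constructor
  · rintro ⟨a, b, c, φ, hφ, h1, h2⟩
    refine ⟨a, b, c, φ, hφ, h1, ?_⟩
    have h3 : Tendsto (fun j => eLpNorm (fun x => gradient (φ j) x - G x) 2 volume ^ 2) atTop
        (𝓝 0) := by
      refine tendsto_of_tendsto_of_tendsto_of_le_of_le tendsto_const_nhds h2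
        (fun _ => zero_le) fun j => ?_
      simp only
      rw [← lintegral_enorm_sq_eq]
      exact le_self_add
    have h4 := ((ENNReal.continuous_rpow_const (y := 1 / 2)).tendsto _).comp h3
    refine (h4.congr fun j => ?_).trans (by simp)
    simp only [Function.comp_apply]
    rw [← ENNReal.rpow_natCast, ← ENNReal.rpow_mul]
    simp
  · intro h
    obtain ⟨a, b, c, φ, hφ, h1, h2⟩ := h
    refine ⟨a, b, c, φ, hφ, h1, ?_⟩
    have hd (j) : MemSobolevZero 2 Ω (fun x => φ j x - u x) (fun x => gradient (φ j) x - G x) :=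
      ((hφ j).memSobolevZero (by simp)).sub (by simp) ⟨a, b, c, φ, hφ, h1, h2⟩
    have p1 := ((ENNReal.continuous_pow 2).tendsto _).comp h1
    have p2 := ((ENNReal.continuous_pow 2).tendsto _).comp h2
    have p3 := ENNReal.Tendsto.const_mul (a := kernelMass n s)
      ((ENNReal.Tendsto.const_mul (a := 4) p1 (Or.inr (by simp))).add p2)
      (Or.inr (kernelMass_ne_top hn hs0 hs1))
    have p4 := p2.add (ENNReal.Tendsto.const_mul (a := ENNReal.ofReal (fracConst n s / 2)) p3
      (Or.inr ENNReal.ofReal_ne_top))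
    refine tendsto_of_tendsto_of_tendsto_of_le_of_le tendsto_const_nhds
      (p4.trans (by simp)) (fun _ => zero_le) fun j => ?_
    simp only [Function.comp_apply]
    rw [mixedEnergy, ← lintegral_enorm_sq_eq (fun x => gradient (φ j) x - G x)]
    gcongr
    have := (hd j).lintegral_gagliardo_le hn hs0 hs1
    rwa [← lintegral_enorm_sq_eq (fun x => gradient (φ j) x - G x)] at this

theorem MemSobolevZero.integrable_nonlocalKernel (hn : 1 ≤ n) (hs0 : 0 < s) (hs1 : s < 1)
    (hu : MemSobolevZero 2 Ω u G) (hv : MemSobolevZero 2 Ω v V) :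
    Integrable (nonlocalKernel s u v) :=
  ((hu.memLp_diffQuot hn hs0 hs1).integrable_mul (hv.memLp_diffQuot hn hs0 hs1)).congr
    (Eventually.of_forall fun q => (nonlocalKernel_eq_diffQuot_mul hs0 u v q).symm)

theorem integrable_inner_of_memLp_two (hG : MemLp G 2) (hV : MemLp V 2) :
    Integrable (fun x => inner ℝ (G x) (V x)) :=
  memLp_one_iff_integrable.1 ((innerSL ℝ).memLp_of_bilin 1 hG hV)

theorem fracConst_pos (hn : 1 ≤ n) (hs0 : 0 < s) (hs1 : s < 1) : 0 < fracConst n s := by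
  have h1 : 0 < Real.Gamma (((n : ℝ) + 2 * s) / 2) := Real.Gamma_pos_of_pos (by positivity)
  have h2 : Real.Gamma (-s) ≠ 0 := by
    refine Real.Gamma_ne_zero fun m h => ?_
    have hm : s = m := by linarith
    rcases m with _ | m
    · simp at hm; linarith
    · push_cast at hm; linarith [(Nat.cast_nonneg m : (0 : ℝ) ≤ m)]
  have h3 := abs_pos.2 h2
  have := Real.pi_pos
  unfold fracConst
  positivity

theorem mixedForm_sub_left (hn : 1 ≤ n) (hs0 : 0 < s) (hs1 : s < 1) {w : Eucl n → ℝ}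
    {W : Eucl n → Eucl n} (hu : MemSobolevZero 2 Ω u G) (hw : MemSobolevZero 2 Ω w W)
    (hv : MemSobolevZero 2 Ω v V) :
    mixedForm s (fun x => u x - w x) (fun x => G x - W x) v V =
      mixedForm s u G v V - mixedForm s w W v V := by
  have e (q) : nonlocalKernel s (fun x => u x - w x) v q =
      nonlocalKernel s u v q - nonlocalKernel s w v q := by
    simp only [nonlocalKernel]; ring
  simp only [mixedForm, inner_sub_left, e]
  rw [integral_sub (integrable_inner_of_memLp_two hu.2.1 hv.2.1)
    (integrable_inner_of_memLp_two hw.2.1 hv.2.1),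
    integral_sub (hu.integrable_nonlocalKernel hn hs0 hs1 hv)
    (hw.integrable_nonlocalKernel hn hs0 hs1 hv)]
  ring

end Nonlocal

/-! ### Existence for the linear problem -/

section LaxMilgram

variable {n : ℕ} {Ω : Set (Eucl n)} {s : ℝ}

/-- The Hilbert space `L² × L² × L²` of triples, into which `W₀^{1,2}(Ω)` is embedded by sending a
function to itself, its gradient, and its difference quotient. -/
abbrev TripleSpace (n : ℕ) : Type :=
  WithLp 2 (Lp ℝ 2 (volume : Measure (Eucl n)) ×
    WithLp 2 (Lp (Eucl n) 2 (volume : Measure (Eucl n)) ×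
      Lp ℝ 2 (volume : Measure (Eucl n × Eucl n))))

theorem diffQuot_congr {u v : Eucl n → ℝ} (h : u =ᵐ[volume] v) :
    diffQuot s u =ᵐ[volume] diffQuot s v := by
  have h1 : ∀ᵐ q : Eucl n × Eucl n, u q.1 = v q.1 := Measure.quasiMeasurePreserving_fst.ae h
  have h2 : ∀ᵐ q : Eucl n × Eucl n, u q.2 = v q.2 := Measure.quasiMeasurePreserving_snd.ae h
  filter_upwards [h1, h2] with q q1 q2
  simp only [diffQuot, q1, q2]

/-- The image of `W₀^{1,2}(Ω)` in `TripleSpace n`. -/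
def sobolevTriples (s : ℝ) (Ω : Set (Eucl n)) : Submodule ℝ (TripleSpace n) where
  carrier := {z | MemSobolevZero 2 Ω z.fst z.snd.fst ∧ z.snd.snd =ᵐ[volume] diffQuot s z.fst}
  add_mem' := by
    rintro z w ⟨z1, z2⟩ ⟨w1, w2⟩
    have e := Lp.coeFn_add z.fst w.fst
    refine ⟨(z1.add (by simp) w1).congr (by simp) e.symm
      (Lp.coeFn_add z.snd.fst w.snd.fst).symm, ?_⟩
    have e3 := Lp.coeFn_add z.snd.snd w.snd.snd
    refine e3.trans (EventuallyEq.trans ?_ (diffQuot_congr e).symm)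
    filter_upwards [z2, w2] with q q1 q2
    simp only [Pi.add_apply, q1, q2, diffQuot]; ring
  zero_mem' := by
    have e := Lp.coeFn_zero ℝ 2 (volume : Measure (Eucl n))
    refine ⟨(MemSobolevZero.zero (by simp)).congr (by simp) e.symm
      (Lp.coeFn_zero (Eucl n) 2 (volume : Measure (Eucl n))).symm, ?_⟩
    have e3 := Lp.coeFn_zero ℝ 2 (volume : Measure (Eucl n × Eucl n))
    refine e3.trans (EventuallyEq.trans ?_ (diffQuot_congr e).symm)
    exact Eventually.of_forall fun q => by simp [diffQuot]
  smul_mem' := by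
    rintro c z ⟨z1, z2⟩
    have e := Lp.coeFn_smul c z.fst
    refine ⟨(z1.const_mul (by simp) c).congr (by simp) e.symm
      (Lp.coeFn_smul c z.snd.fst).symm, ?_⟩
    have e3 := Lp.coeFn_smul c z.snd.snd
    refine e3.trans (EventuallyEq.trans ?_ (diffQuot_congr e).symm)
    filter_upwards [z2] with q q1
    simp only [Pi.smul_apply, q1, diffQuot, smul_eq_mul]; ring

theorem isClosed_sobolevTriples (hn : 1 ≤ n) (hs0 : 0 < s) (hs1 : s < 1) :
    IsClosed (sobolevTriples s Ω : Set (TripleSpace n)) := by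
  refine IsSeqClosed.isClosed fun z w hz hw => ?_
  have c1 : Tendsto (fun j => (z j).fst) atTop (𝓝 w.fst) :=
    ((WithLp.fstL 2 ℝ _ _).continuous.tendsto w).comp hw
  have c2 : Tendsto (fun j => (z j).snd) atTop (𝓝 w.snd) :=
    ((WithLp.sndL 2 ℝ _ _).continuous.tendsto w).comp hw
  have c3 : Tendsto (fun j => (z j).snd.fst) atTop (𝓝 w.snd.fst) :=
    ((WithLp.fstL 2 ℝ _ _).continuous.tendsto w.snd).comp c2
  have c4 : Tendsto (fun j => (z j).snd.snd) atTop (𝓝 w.snd.snd) :=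
    ((WithLp.sndL 2 ℝ _ _).continuous.tendsto w.snd).comp c2
  rw [Lp.tendsto_Lp_iff_tendsto_eLpNorm'] at c1 c3 c4
  have hw1 : MemSobolevZero 2 Ω w.fst w.snd.fst :=
    MemSobolevZero.of_tendsto (by simp) (fun j => (hz j).1) (Lp.memLp _) (Lp.memLp _) c1 c3
  refine ⟨hw1, ?_⟩
  have d (j) : eLpNorm (diffQuot s (z j).fst - diffQuot s w.fst) 2 volume ^ 2 ≤
      kernelMass n s * (4 * eLpNorm ((z j).fst - w.fst : Eucl n → ℝ) 2 volume ^ 2 +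
        eLpNorm ((z j).snd.fst - w.snd.fst : Eucl n → Eucl n) 2 volume ^ 2) := by
    have := ((hz j).1.sub (by simp) hw1).eLpNorm_diffQuot_sq_le hn hs0 hs1
    refine le_trans (le_of_eq ?_) this
    congr 2
    ext q
    simp only [Pi.sub_apply, diffQuot]; ring
  have p1 := ((ENNReal.continuous_pow 2).tendsto _).comp c1
  have p2 := ((ENNReal.continuous_pow 2).tendsto _).comp c3
  have p3 := ENNReal.Tendsto.const_mul (a := kernelMass n s)
    ((ENNReal.Tendsto.const_mul (a := 4) p1 (Or.inr (by simp))).add p2)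
    (Or.inr (kernelMass_ne_top hn hs0 hs1))
  have p4 := tendsto_of_tendsto_of_tendsto_of_le_of_le tendsto_const_nhds
      (p3.trans (by simp)) (fun _ => zero_le) d
  have mw := hw1.memLp_diffQuot hn hs0 hs1
  have p5 : Tendsto (fun j => eLpNorm (((z j).snd.snd : Eucl n × Eucl n → ℝ) - diffQuot s w.fst) 2 volume) atTop
      (𝓝 0) := by
    have p6 := ((ENNReal.continuous_rpow_const (y := 1 / 2)).tendsto _).comp p4
    refine (p6.congr fun j => ?_).trans (by simp)
    simp only [Function.comp_apply]
    rw [← ENNReal.rpow_natCast, ← ENNReal.rpow_mul]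
    simp only [Nat.cast_ofNat, one_div, ne_eq, OfNat.ofNat_ne_zero, not_false_eq_true,
      mul_inv_cancel₀, ENNReal.rpow_one]
    refine eLpNorm_congr_ae ?_
    filter_upwards [(hz j).2] with q hq
    simp only [Pi.sub_apply, hq]
  have p7 := Lp.tendsto_Lp_iff_tendsto_eLpNorm'' (fun j => ((z j).snd.snd : _ → ℝ))
    (fun j => Lp.memLp (z j).snd.snd) (diffQuot s w.fst) mw
    |>.2 p5
  simp only [Lp.toLp_coeFn] at p7
  have c4' : Tendsto (fun j => (z j).snd.snd) atTop (𝓝 w.snd.snd) := by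
    rwa [Lp.tendsto_Lp_iff_tendsto_eLpNorm']
  have := tendsto_nhds_unique c4' p7
  rw [this]
  exact mw.coeFn_toLp

theorem norm_fst_le_of_mem_sobolevTriples {C : ℝ≥0∞} (hC : C ≠ ⊤)
    (poinc : ∀ (u : Eucl n → ℝ) (G : Eucl n → Eucl n), MemSobolevZero 2 Ω u G →
      eLpNorm u 2 volume ≤ C * eLpNorm G 2 volume) {z : TripleSpace n}
    (hz : z ∈ sobolevTriples s Ω) : ‖z.fst‖ ≤ C.toReal * ‖z.snd.fst‖ := by
  have h := ENNReal.toReal_mono (ENNReal.mul_ne_top hC (Lp.eLpNorm_ne_top _)) (poinc _ _ hz.1)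
  rw [ENNReal.toReal_mul] at h
  rwa [Lp.norm_def, Lp.norm_def]

theorem norm_snd_snd_sq_le_of_mem_sobolevTriples (hn : 1 ≤ n) (hs0 : 0 < s) (hs1 : s < 1)
    {z : TripleSpace n} (hz : z ∈ sobolevTriples s Ω) :
    ‖z.snd.snd‖ ^ 2 ≤ (kernelMass n s).toReal * (4 * ‖z.fst‖ ^ 2 + ‖z.snd.fst‖ ^ 2) := by
  have hM := kernelMass_ne_top (s := s) hn hs0 hs1
  have h := hz.1.eLpNorm_diffQuot_sq_le hn hs0 hs1
  rw [← eLpNorm_congr_ae hz.2] at h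
  have f1 : 4 * eLpNorm z.fst 2 volume ^ 2 ≠ ⊤ :=
    ENNReal.mul_ne_top (by simp) (ENNReal.pow_ne_top (Lp.eLpNorm_ne_top _))
  have f2 : eLpNorm z.snd.fst 2 volume ^ 2 ≠ ⊤ := ENNReal.pow_ne_top (Lp.eLpNorm_ne_top _)
  have h := ENNReal.toReal_mono (ENNReal.mul_ne_top hM (ENNReal.add_ne_top.2 ⟨f1, f2⟩)) h
  rw [ENNReal.toReal_mul, ENNReal.toReal_add f1 f2, ENNReal.toReal_mul, ENNReal.toReal_pow,
    ENNReal.toReal_pow, ENNReal.toReal_pow] at h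
  rw [Lp.norm_def, Lp.norm_def, Lp.norm_def]
  exact h

theorem inv_mul_sum_sq_le {a b d c M k : ℝ} (hM : 0 ≤ M) (hk : 0 ≤ k) (ha0 : 0 ≤ a)
    (ha : a ≤ c * b) (hd : d ^ 2 ≤ M * (4 * a ^ 2 + b ^ 2)) :
    (1 + c ^ 2 + M * (4 * c ^ 2 + 1))⁻¹ * (a ^ 2 + (b ^ 2 + d ^ 2)) ≤ b ^ 2 + k * d ^ 2 := by
  have hD : 0 < 1 + c ^ 2 + M * (4 * c ^ 2 + 1) := by positivity
  rw [inv_mul_le_iff₀ hD]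
  have a2 : a ^ 2 ≤ c ^ 2 * b ^ 2 := by
    rw [← mul_pow]; exact pow_le_pow_left₀ ha0 ha 2
  have t2 := mul_le_mul_of_nonneg_left a2 (mul_nonneg hM (by norm_num : (0 : ℝ) ≤ 4))
  have t3 := mul_nonneg hD.le (mul_nonneg hk (sq_nonneg d))
  nlinarith

theorem IsCoercive.exists_forall_eq {W : Type*} [NormedAddCommGroup W] [InnerProductSpace ℝ W]
    [CompleteSpace W] {B : W →L[ℝ] W →L[ℝ] ℝ} (hB : IsCoercive B) (ℓ : W →L[ℝ] ℝ) :
    ∃ z, ∀ w, B z w = ℓ w := by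
  refine ⟨hB.continuousLinearEquivOfBilin.symm ((InnerProductSpace.toDual ℝ W).symm ℓ),
    fun w => ?_⟩
  rw [← hB.continuousLinearEquivOfBilin_apply, ContinuousLinearEquiv.apply_symm_apply,
      InnerProductSpace.toDual_symm_apply]

/-- The Lax–Milgram theorem on a closed space `K` of triples, for the form that pairs the second
and the third components, if these control the first. The triples form an abstract Hilbert space
`H` with component maps `P₁`, `P₂`, `P₃`. -/
theorem exists_triple_solution {H E₁ E₂ E₃ : Type*} [NormedAddCommGroup H]
    [InnerProductSpace ℝ H] [CompleteSpace H] [NormedAddCommGroup E₁]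
    [InnerProductSpace ℝ E₁] [NormedAddCommGroup E₂] [InnerProductSpace ℝ E₂]
    [NormedAddCommGroup E₃] [InnerProductSpace ℝ E₃]
    (P₁ : H →L[ℝ] E₁) (P₂ : H →L[ℝ] E₂) (P₃ : H →L[ℝ] E₃)
    (hP : ∀ z, ‖z‖ ^ 2 = ‖P₁ z‖ ^ 2 + (‖P₂ z‖ ^ 2 + ‖P₃ z‖ ^ 2))
    (K : Submodule ℝ H) (hK : IsClosed (K : Set H))
    {c M k : ℝ} (hM : 0 ≤ M) (hk : 0 ≤ k) (h1 : ∀ z ∈ K, ‖P₁ z‖ ≤ c * ‖P₂ z‖)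
    (h2 : ∀ z ∈ K, ‖P₃ z‖ ^ 2 ≤ M * (4 * ‖P₁ z‖ ^ 2 + ‖P₂ z‖ ^ 2)) (f : E₁) :
    ∃ z ∈ K, ∀ w ∈ K, inner ℝ (P₂ z) (P₂ w) + k * inner ℝ (P₃ z) (P₃ w) =
      inner ℝ f (P₁ w) := by
  have : CompleteSpace K := hK.completeSpace_coe
  let Q₂ : K →L[ℝ] E₂ := P₂.comp K.subtypeL
  let Q₃ : K →L[ℝ] E₃ := P₃.comp K.subtypeL
  let B : K →L[ℝ] K →L[ℝ] ℝ := (innerSL ℝ).bilinearComp Q₂ Q₂ +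
    k • (innerSL ℝ).bilinearComp Q₃ Q₃
  have hB (z w : K) : B z w = inner ℝ (P₂ z) (P₂ w) + k * inner ℝ (P₃ z) (P₃ w) := rfl
  have coer : IsCoercive B := by
    refine ⟨(1 + c ^ 2 + M * (4 * c ^ 2 + 1))⁻¹, by positivity, fun z => ?_⟩
    rw [hB, real_inner_self_eq_norm_sq, real_inner_self_eq_norm_sq, mul_assoc, ← sq,
      Submodule.coe_norm, hP]
    exact inv_mul_sum_sq_le hM hk (norm_nonneg _) (h1 z z.2) (h2 z z.2)
  obtain ⟨z, hz⟩ := coer.exists_forall_eq ((innerSL ℝ f).comp (P₁.comp K.subtypeL))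
  exact ⟨z, z.2, fun w hw => hz ⟨w, hw⟩⟩

theorem norm_sq_triple (z : TripleSpace n) :
    ‖z‖ ^ 2 = ‖z.fst‖ ^ 2 + (‖z.snd.fst‖ ^ 2 + ‖z.snd.snd‖ ^ 2) := by
  rw [WithLp.prod_norm_sq_eq_of_L2, WithLp.prod_norm_sq_eq_of_L2]

/-- Existence of weak solutions of `-Δu + (-Δ)^s u = F` with a right-hand side in `L²(Ω)`. -/
theorem exists_weak_solution (hn : 3 ≤ n) (hs0 : 0 < s) (hs1 : s < 1) (hΩ : IsOpen Ω)
    (hΩb : Bornology.IsBounded Ω) {F : Eucl n → ℝ} (hF : MemLp F 2 (volume.restrict Ω)) :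
    ∃ (u : Eucl n → ℝ) (G : Eucl n → Eucl n), MemSobolevZero 2 Ω u G ∧
      ∀ (v : Eucl n → ℝ) (V : Eucl n → Eucl n), MemSobolevZero 2 Ω v V →
        mixedForm s u G v V = ∫ x in Ω, F x * v x := by
  have hn1 : 1 ≤ n := by omega
  have hFi : MemLp (Ω.indicator F) 2 volume :=
    (memLp_indicator_iff_restrict hΩ.measurableSet).2 hF
  have hc := fracConst_pos (s := s) hn1 hs0 hs1
  obtain ⟨C, hC, poinc⟩ := exists_poincare hΩb (p := 2) (by norm_num)
    (by exact_mod_cast (by omega : 2 < n))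
  obtain ⟨z, hzm, hz⟩ := exists_triple_solution (WithLp.fstL 2 ℝ _ _)
    ((WithLp.fstL 2 ℝ _ _).comp (WithLp.sndL 2 ℝ _ _))
    ((WithLp.sndL 2 ℝ _ _).comp (WithLp.sndL 2 ℝ _ _))
    (norm_sq_triple (n := n)) (sobolevTriples (n := n) s Ω)
    (isClosed_sobolevTriples hn1 hs0 hs1) ENNReal.toReal_nonneg (half_pos hc).le
    (fun z hz => norm_fst_le_of_mem_sobolevTriples hC (by simpa using poinc) hz)
    (fun z hz => norm_snd_snd_sq_le_of_mem_sobolevTriples hn1 hs0 hs1 hz) (hFi.toLp _)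
  refine ⟨z.fst, z.snd.fst, hzm.1, fun v V hv => ?_⟩
  have mv := hv.memLp_diffQuot hn1 hs0 hs1
  have ev := hv.1.coeFn_toLp
  have eV := hv.2.1.coeFn_toLp
  have h := hz (WithLp.toLp 2 (hv.1.toLp v, WithLp.toLp 2 (hv.2.1.toLp V, mv.toLp _)))
    ⟨hv.congr (by simp) ev.symm eV.symm, mv.coeFn_toLp.trans (diffQuot_congr ev).symm⟩
  have e1 : inner ℝ z.snd.fst (hv.2.1.toLp V) = ∫ x, inner ℝ (z.snd.fst x) (V x) := by
    rw [L2.inner_def]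
    refine integral_congr_ae ?_
    filter_upwards [eV] with x hx
    rw [hx]
  have e2 : inner ℝ z.snd.snd (mv.toLp _) = ∫ q, nonlocalKernel s z.fst v q := by
    rw [L2.inner_def]
    refine integral_congr_ae ?_
    filter_upwards [mv.coeFn_toLp, hzm.2] with q h1 h2
    rw [h1, h2, nonlocalKernel_eq_diffQuot_mul hs0]
    simp [mul_comm]
  have e3 : inner ℝ (hFi.toLp _) (hv.1.toLp v) = ∫ x in Ω, F x * v x := by
    rw [L2.inner_def, ← integral_indicator hΩ.measurableSet]
    refine integral_congr_ae ?_
    filter_upwards [ev, hFi.coeFn_toLp] with x h1 h2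
    rw [h1, h2]
    by_cases hx : x ∈ Ω <;> simp [hx, mul_comm]
  change inner ℝ z.snd.fst (hv.2.1.toLp V) +
    fracConst n s / 2 * inner ℝ z.snd.snd (mv.toLp _) = inner ℝ (hFi.toLp _) (hv.1.toLp v) at h
  rw [e1, e2, e3] at h
  exact h

end LaxMilgram

/-! ### Comparison and strong maximum principles -/

section Maximum

variable {n : ℕ} {Ω : Set (Eucl n)} {s : ℝ} {u : Eucl n → ℝ} {G : Eucl n → Eucl n}

theorem exists_deriv_smoothTransition_bound :
    ∃ L : ℝ, ∀ t, |deriv Real.smoothTransition t| ≤ L := by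
  have hc : Continuous (deriv Real.smoothTransition) :=
    (Real.smoothTransition.contDiff (n := 1)).continuous_deriv (by simp)
  obtain ⟨L, hL⟩ := isCompact_Icc.exists_bound_of_continuousOn
    (s := Set.Icc (0 : ℝ) 1) hc.continuousOn
  have hL0 : 0 ≤ L := (norm_nonneg _).trans (hL 0 (by simp))
  refine ⟨L, fun t => ?_⟩
  rcases lt_or_ge t 0 with h | h
  · have : Real.smoothTransition =ᶠ[𝓝 t] fun _ => 0 := by
      filter_upwards [Iio_mem_nhds h] with y hy using Real.smoothTransition.zero_of_nonpos hy.le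
    rw [this.deriv_eq]; simpa using hL0
  rcases lt_or_ge 1 t with h' | h'
  · have : Real.smoothTransition =ᶠ[𝓝 t] fun _ => 1 := by
      filter_upwards [Ioi_mem_nhds h'] with y hy using Real.smoothTransition.one_of_one_le hy.le
    rw [this.deriv_eq]; simpa using hL0
  exact hL t ⟨h, h'⟩

theorem deriv_smoothTransition_of_neg {t : ℝ} (h : t < 0) :
    deriv Real.smoothTransition t = 0 := by
  have : Real.smoothTransition =ᶠ[𝓝 t] fun _ => 0 := by
    filter_upwards [Iio_mem_nhds h] with y hy using Real.smoothTransition.zero_of_nonpos hy.le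
  rw [this.deriv_eq]; simp

/-- Weak comparison principle: a weak supersolution of `-Δu + (-Δ)^s u = 0` in `W₀^{1,2}(Ω)` is
nonnegative. The test function is a smooth substitute for the negative part of `u`. -/
theorem MemSobolevZero.nonneg_of_supersolution (hn : 3 ≤ n) (hs0 : 0 < s) (hs1 : s < 1)
    (hΩb : Bornology.IsBounded Ω) (hu : MemSobolevZero 2 Ω u G)
    (h : ∀ v V, MemSobolevZero 2 Ω v V → (∀ x, 0 ≤ v x) → 0 ≤ mixedForm s u G v V) :
    ∀ᵐ x, 0 ≤ u x := by
  have hn1 : 1 ≤ n := by omega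
  obtain ⟨L, hL⟩ := exists_deriv_smoothTransition_bound
  let Φ : ℝ → ℝ := fun t => Real.smoothTransition (-t)
  have hΦ : ContDiff ℝ ∞ Φ := Real.smoothTransition.contDiff.comp contDiff_neg
  have dΦ (t) : deriv Φ t = - deriv Real.smoothTransition (-t) := deriv_comp_neg _ _
  have anti : Antitone Φ := fun a b hab => Real.smoothTransition.monotone (neg_le_neg hab)
  have hv := hu.comp (by simp) (by simp) hΦ (by simp [Φ]) (L := L)
    (fun t => by rw [dΦ, abs_neg]; exact hL _)
  have h1 := h _ _ hv (fun x => Real.smoothTransition.nonneg _)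
  have nl : ∫ q, nonlocalKernel s u (fun x => Φ (u x)) q ≤ 0 := by
    refine integral_nonpos fun q => ?_
    refine div_nonpos_of_nonpos_of_nonneg ?_ (by positivity)
    rcases le_total (u q.1) (u q.2) with hq | hq
    · exact mul_nonpos_of_nonpos_of_nonneg (sub_nonpos.2 hq) (sub_nonneg.2 (anti hq))
    · exact mul_nonpos_of_nonneg_of_nonpos (sub_nonneg.2 hq) (sub_nonpos.2 (anti hq))
  have int := integrable_inner_of_memLp_two hu.2.1 hv.2.1
  have np (x) : inner ℝ (G x) (deriv Φ (u x) • G x) ≤ 0 := by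
    rw [inner_smul_right, real_inner_self_eq_norm_sq]
    exact mul_nonpos_of_nonpos_of_nonneg anti.deriv_nonpos (by positivity)
  have i0 : 0 ≤ ∫ x, inner ℝ (G x) (deriv Φ (u x) • G x) := by
    rw [mixedForm] at h1
    have := mul_nonpos_of_nonneg_of_nonpos (half_pos (fracConst_pos (s := s) hn1 hs0 hs1)).le nl
    linarith
  have i1 : ∫ x, - inner ℝ (G x) (deriv Φ (u x) • G x) = 0 := by
    refine le_antisymm ?_ (integral_nonneg fun x => neg_nonneg.2 (np x))
    rw [integral_neg]; linarith
  rw [integral_eq_zero_iff_of_nonneg (fun x => neg_nonneg.2 (np x)) int.neg] at i1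
  have g0 : (fun x => deriv Φ (u x) • G x) =ᵐ[volume] 0 := by
    filter_upwards [i1] with x hx
    simp only [Pi.zero_apply, neg_eq_zero, inner_smul_right, mul_eq_zero, inner_self_eq_zero,
      smul_eq_zero] at hx ⊢
    exact hx
  obtain ⟨C, hC, poinc⟩ := exists_poincare hΩb (p := 2) (by norm_num)
    (by exact_mod_cast (by omega : 2 < n))
  have := poinc _ _ (by simpa using hv)
  rw [eLpNorm_congr_ae g0, eLpNorm_zero, mul_zero, nonpos_iff_eq_zero, ENNReal.ofReal_ofNat,
    eLpNorm_eq_zero_iff hv.1.1 (by simp)] at this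
  filter_upwards [this] with x hx
  have hx' := Real.smoothTransition.zero_iff_nonpos.1 hx
  linarith

/-- If `u ≥ 0` is a supersolution and `ψ` a nonnegative test function, then `u` has no zeros in
`{ψ > 0}`, unless it vanishes identically. The test functions `v_j = H(ψ - j u)` concentrate on the
zero set of `u` as `j → ∞`; there the local part of `ℬ(u, v_j)` disappears, since `∇u = 0`, whereas
the nonlocal part has a strictly negative limit. -/
theorem MemSobolevZero.ne_zero_on_support (hn : 1 ≤ n) (hs0 : 0 < s) (hs1 : s < 1)
    (hu : MemSobolevZero 2 Ω u G) (hu0 : ∀ᵐ x, 0 ≤ u x) (hune : ¬ u =ᵐ[volume] 0)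
    (h : ∀ v V, MemSobolevZero 2 Ω v V → (∀ x, 0 ≤ v x) → 0 ≤ mixedForm s u G v V)
    {ψ : Eucl n → ℝ} (hψ : IsTestFunction Ω ψ) :
    ∀ᵐ x, 0 < ψ x → u x ≠ 0 := by
  obtain ⟨L, hL⟩ := exists_deriv_smoothTransition_bound
  have hL0 : 0 ≤ L := (abs_nonneg _).trans (hL 0)
  set H := Real.smoothTransition
  have hH : ContDiff ℝ ∞ H := Real.smoothTransition.contDiff
  have mono : Monotone H := Real.smoothTransition.monotone
  have lip (a b : ℝ) : |H a - H b| ≤ L * |a - b| := by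
    have := convex_univ.norm_image_sub_le_of_norm_deriv_le (f := H) (C := L) (x := b) (y := a)
      (fun x _ => hH.differentiable (by simp) x) (fun x _ => hL x) trivial trivial
    simpa using this
  have hψ2 := hψ.memSobolevZero (p := 2) (by simp)
  let w : ℕ → Eucl n → ℝ := fun j x => ψ x - j * u x
  have hw (j : ℕ) : MemSobolevZero 2 Ω (w j) (fun x => gradient ψ x - (j : ℝ) • G x) :=
    hψ2.sub (by simp) (hu.const_mul (by simp) j)
  have hv (j : ℕ) := (hw j).comp (by simp) (by simp) hH Real.smoothTransition.zero hL
  have c0 := fracConst_pos (s := s) hn hs0 hs1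
  -- The local part of `ℬ(u, v_j)` is at most `a j → 0`: `deriv H (w j x)` vanishes eventually
  -- where `u x > 0`, and `∇u = 0` where `u = 0`.
  let a : ℕ → ℝ := fun j => ∫ x, deriv H (w j x) * inner ℝ (G x) (gradient ψ x)
  have intψ := integrable_inner_of_memLp_two hu.2.1 hψ2.2.1
  have ma (j) : AEStronglyMeasurable
      (fun x => deriv H (w j x) * inner ℝ (G x) (gradient ψ x)) volume :=
    ((hH.continuous_deriv (by simp)).comp_aestronglyMeasurable (hw j).1.1).mul intψ.1
  have ba (j x) : ‖deriv H (w j x) * inner ℝ (G x) (gradient ψ x)‖ ≤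
      L * ‖inner ℝ (G x) (gradient ψ x)‖ := by
    rw [norm_mul]; exact mul_le_mul_of_nonneg_right (hL _) (norm_nonneg _)
  have alim : Tendsto a atTop (𝓝 0) := by
    have := tendsto_integral_of_dominated_convergence (μ := volume)
      (F := fun j x => deriv H (w j x) * inner ℝ (G x) (gradient ψ x)) (f := fun _ => (0 : ℝ))
      (fun x => L * ‖inner ℝ (G x) (gradient ψ x)‖) ma (intψ.norm.const_mul L)
      (fun j => Eventually.of_forall (ba j)) ?_
    · simpa only [integral_zero] using this
    filter_upwards [hu0, hu.gradient_eq_zero_of_eq_zero (by simp) (by simp)] with x h0 hx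
    rcases h0.eq_or_lt with h1 | h1
    · simp [hx h1.symm]
    · refine tendsto_const_nhds.congr' ?_
      obtain ⟨N, hN⟩ := exists_nat_gt (ψ x / u x)
      filter_upwards [eventually_ge_atTop N] with j hj
      have h2 : ψ x < j * u x := by
        rw [div_lt_iff₀ h1] at hN
        exact hN.trans_le (mul_le_mul_of_nonneg_right (by exact_mod_cast hj) h1.le)
      rw [deriv_smoothTransition_of_neg (by simp only [w]; linarith), zero_mul]
  have hlocal (j) : ∫ x, inner ℝ (G x) (deriv H (w j x) • (gradient ψ x - (j : ℝ) • G x))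
      ≤ a j := by
    refine integral_mono (integrable_inner_of_memLp_two hu.2.1 (hv j).2.1)
      ((intψ.norm.const_mul L).mono' (ma j) (Eventually.of_forall (ba j))) fun x => ?_
    simp only
    rw [inner_smul_right, inner_sub_right, inner_smul_right, real_inner_self_eq_norm_sq]
    have h1 : 0 ≤ deriv H (w j x) := mono.deriv_nonneg
    have h2 : 0 ≤ (j : ℝ) * ‖G x‖ ^ 2 := by positivity
    nlinarith [mul_nonneg h1 h2]
  -- The kernels `K j` are bounded above by the integrable `g`, so reverse Fatou applies.
  let K : ℕ → Eucl n × Eucl n → ℝ := fun j => nonlocalKernel s u (fun x => H (w j x))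
  have intK (j) : Integrable (K j) := hu.integrable_nonlocalKernel hn hs0 hs1 (hv j)
  have hK (j) : - (2 / fracConst n s * a j) ≤ ∫ q, K j q := by
    have h1 := h _ _ (hv j) (fun x => Real.smoothTransition.nonneg _)
    rw [mixedForm] at h1
    have h2 := hlocal j
    have h3 : 0 ≤ a j + fracConst n s / 2 * ∫ q, K j q := by linarith
    have h4 : 2 / fracConst n s * (a j + fracConst n s / 2 * ∫ q, K j q) =
      2 / fracConst n s * a j + ∫ q, K j q := by field_simp
    have := mul_nonneg (div_pos two_pos c0).le h3
    linarith
  let g : Eucl n × Eucl n → ℝ := fun q => L * ‖nonlocalKernel s u ψ q‖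
  have intg : Integrable g := (hu.integrable_nonlocalKernel hn hs0 hs1 hψ2).norm.const_mul L
  have hg0 (q) : 0 ≤ g q := by positivity
  have hKg (j q) : K j q ≤ g q := by
    have hd : 0 ≤ ‖q.1 - q.2‖ ^ ((n : ℝ) + 2 * s) := by positivity
    simp only [K, g, nonlocalKernel]
    rw [norm_div, Real.norm_of_nonneg hd, mul_div_assoc']
    refine div_le_div_of_nonneg_right ?_ hd
    rw [norm_mul, Real.norm_eq_abs, Real.norm_eq_abs]
    -- by symmetry, let `u x ≥ u y`; then replace `u x` by `u y` in the first value of `H`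
    have key (x y : Eucl n) (hxy : u y ≤ u x) : (u x - u y) * (H (w j x) - H (w j y)) ≤
        L * (|u x - u y| * |ψ x - ψ y|) := by
      have h1 : H (w j x) ≤ H (ψ x - j * u y) := by
        refine mono (sub_le_sub_left ?_ _)
        exact mul_le_mul_of_nonneg_left hxy (Nat.cast_nonneg j)
      have h2 := (le_abs_self _).trans (lip (ψ x - j * u y) (w j y))
      have h3 : ψ x - j * u y - w j y = ψ x - ψ y := by simp only [w]; ring
      rw [h3] at h2
      rw [abs_of_nonneg (sub_nonneg.2 hxy)]
      nlinarith [sub_nonneg.2 hxy]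
    rcases le_total (u q.2) (u q.1) with hq | hq
    · exact key _ _ hq
    · have := key _ _ hq
      rw [abs_sub_comm, abs_sub_comm (ψ q.2)] at this
      linarith
  let vlim : Eucl n → ℝ := fun x => if u x = 0 then H (ψ x) else 0
  have vl : ∀ᵐ x, Tendsto (fun j => H (w j x)) atTop (𝓝 (vlim x)) := by
    filter_upwards [hu0] with x h0
    rcases h0.eq_or_lt with h1 | h1
    · simp [vlim, w, ← h1]
    · simp only [vlim, if_neg h1.ne']
      refine tendsto_const_nhds.congr' ?_
      obtain ⟨N, hN⟩ := exists_nat_gt (ψ x / u x)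
      filter_upwards [eventually_ge_atTop N] with j hj
      have h2 : ψ x < j * u x := by
        rw [div_lt_iff₀ h1] at hN
        exact hN.trans_le (mul_le_mul_of_nonneg_right (by exact_mod_cast hj) h1.le)
      exact (Real.smoothTransition.zero_of_nonpos (by simp only [w]; linarith)).symm
  have fst' {p : Eucl n → Prop} (hp : ∀ᵐ x, p x) : ∀ᵐ q : Eucl n × Eucl n, p q.1 :=
    Measure.quasiMeasurePreserving_fst.ae hp
  have snd' {p : Eucl n → Prop} (hp : ∀ᵐ x, p x) : ∀ᵐ q : Eucl n × Eucl n, p q.2 :=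
    Measure.quasiMeasurePreserving_snd.ae hp
  have Klim : ∀ᵐ q, Tendsto (fun j => K j q) atTop (𝓝 (nonlocalKernel s u vlim q)) := by
    filter_upwards [fst' vl, snd' vl] with q h1 h2
    exact ((h1.sub h2).const_mul _).div_const _
  have vnn (x) : 0 ≤ vlim x := by
    simp only [vlim]; split_ifs
    · exact Real.smoothTransition.nonneg _
    · exact le_rfl
  have Knp : ∀ᵐ q, nonlocalKernel s u vlim q ≤ 0 := by
    filter_upwards [fst' hu0, snd' hu0] with q h1 h2
    refine div_nonpos_of_nonpos_of_nonneg ?_ (by positivity)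
    by_cases z1 : u q.1 = 0
    · by_cases z2 : u q.2 = 0
      · simp [z1, z2]
      · have : vlim q.2 = 0 := if_neg z2
        rw [z1, this]
        nlinarith [vnn q.1]
    · have : vlim q.1 = 0 := if_neg z1
      rw [this]
      by_cases z2 : u q.2 = 0
      · rw [z2]; nlinarith [vnn q.2]
      · have : vlim q.2 = 0 := if_neg z2
        simp [this]
  have fatou : ∫⁻ q, ENNReal.ofReal (g q - nonlocalKernel s u vlim q) ≤
      ∫⁻ q, ENNReal.ofReal (g q) := by
    calc ∫⁻ q, ENNReal.ofReal (g q - nonlocalKernel s u vlim q)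
        ≤ ∫⁻ q, liminf (fun j => ENNReal.ofReal (g q - K j q)) atTop := by
          refine lintegral_mono_ae ?_
          filter_upwards [Klim] with q hq
          exact ((ENNReal.continuous_ofReal.tendsto _).comp (hq.const_sub _)).liminf_eq.ge
      _ ≤ liminf (fun j => ∫⁻ q, ENNReal.ofReal (g q - K j q)) atTop :=
          lintegral_liminf_le' fun j => (intg.sub (intK j)).1.aemeasurable.ennreal_ofReal
      _ ≤ liminf (fun j => ENNReal.ofReal ((∫ q, g q) + 2 / fracConst n s * a j)) atTop := by
          refine liminf_le_liminf (Eventually.of_forall fun j => ?_)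
          have e := ofReal_integral_eq_lintegral_ofReal (intg.sub (intK j))
            (Eventually.of_forall fun q => sub_nonneg.2 (hKg j q))
          simp only [Pi.sub_apply] at e
          rw [← e, integral_sub intg (intK j)]
          exact ENNReal.ofReal_le_ofReal (by linarith [hK j])
      _ = ENNReal.ofReal (∫ q, g q) := by
          refine Tendsto.liminf_eq ((ENNReal.continuous_ofReal.tendsto _).comp ?_)
          simpa using (alim.const_mul (2 / fracConst n s)).const_add (∫ q, g q)
      _ = ∫⁻ q, ENNReal.ofReal (g q) :=
          ofReal_integral_eq_lintegral_ofReal intg (Eventually.of_forall hg0)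
  have mKlim : AEStronglyMeasurable (nonlocalKernel s u vlim) volume :=
    aestronglyMeasurable_of_tendsto_ae atTop (fun j => (intK j).1) Klim
  have Kzero : ∀ᵐ q, nonlocalKernel s u vlim q = 0 := by
    have e : ∫⁻ q, ENNReal.ofReal (g q - nonlocalKernel s u vlim q) =
        (∫⁻ q, ENNReal.ofReal (g q)) + ∫⁻ q, ENNReal.ofReal (- nonlocalKernel s u vlim q) := by
      rw [← lintegral_add_left' intg.1.aemeasurable.ennreal_ofReal]
      refine lintegral_congr_ae ?_
      filter_upwards [Knp] with q hq
      rw [sub_eq_add_neg, ENNReal.ofReal_add (hg0 q) (neg_nonneg.2 hq)]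
    rw [e] at fatou
    have fin : ∫⁻ q, ENNReal.ofReal (g q) ≠ ⊤ := intg.lintegral_lt_top.ne
    have z : ∫⁻ q, ENNReal.ofReal (- nonlocalKernel s u vlim q) = 0 := by
      by_contra hz
      exact absurd fatou (not_le.2 (ENNReal.lt_add_right fin hz))
    have z := (lintegral_eq_zero_iff' mKlim.aemeasurable.neg.ennreal_ofReal).1 z
    filter_upwards [z, Knp] with q hq hq'
    simp only [Pi.zero_apply, Pi.neg_apply, ENNReal.ofReal_eq_zero] at hq
    linarith
  -- the zero set of `u` in `{ψ > 0}` times `{u > 0}` is a null set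
  have prod : volume ({x | u x = 0 ∧ 0 < ψ x} ×ˢ {y | 0 < u y}) = 0 := by
    refine measure_mono_null (fun q hq => ?_) (ae_iff.1 Kzero)
    obtain ⟨⟨q1, q2⟩, q3⟩ := hq
    simp only [Set.mem_ofPred_eq] at q1 q2 q3 ⊢
    have hne : q.1 - q.2 ≠ 0 := fun h0 => by
      rw [sub_eq_zero.1 h0] at q1; linarith
    have hd : 0 < ‖q.1 - q.2‖ ^ ((n : ℝ) + 2 * s) :=
      Real.rpow_pos_of_pos (norm_pos_iff.2 hne) _
    have v1 : vlim q.1 = H (ψ q.1) := if_pos q1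
    have v2 : vlim q.2 = 0 := if_neg q3.ne'
    have hp : 0 < H (ψ q.1) := Real.smoothTransition.pos_of_pos q2
    rw [nonlocalKernel, q1, v1, v2]
    refine div_ne_zero (mul_ne_zero ?_ ?_) hd.ne' <;> simp [hp.ne', q3.ne']
  rw [Measure.volume_eq_prod, Measure.prod_prod, mul_eq_zero] at prod
  rcases prod with h1 | h1
  · have : ∀ᵐ x, ¬ (u x = 0 ∧ 0 < ψ x) := by rw [ae_iff]; simpa using h1
    filter_upwards [this] with x hx h2 h3 using hx ⟨h3, h2⟩
  · refine absurd ?_ hune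
    have : ∀ᵐ x, ¬ 0 < u x := by rw [ae_iff]; simpa using h1
    filter_upwards [this, hu0] with x h2 h3
    exact le_antisymm (not_lt.1 h2) h3

/-- Strong maximum principle: a nonnegative supersolution that does not vanish identically is
positive almost everywhere in `Ω`, which need not be connected. -/
theorem MemSobolevZero.pos_of_supersolution (hn : 1 ≤ n) (hs0 : 0 < s) (hs1 : s < 1)
    (hΩ : IsOpen Ω) (hu : MemSobolevZero 2 Ω u G) (hu0 : ∀ᵐ x, 0 ≤ u x)
    (hune : ¬ u =ᵐ[volume] 0)
    (h : ∀ v V, MemSobolevZero 2 Ω v V → (∀ x, 0 ≤ v x) → 0 ≤ mixedForm s u G v V) :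
    ∀ᵐ x, x ∈ Ω → 0 < u x := by
  have null : volume {x | x ∈ Ω ∧ u x = 0} = 0 := by
    refine measure_null_of_locally_null _ fun x hx => ?_
    obtain ⟨r, hr, hrΩ⟩ := Metric.isOpen_iff.1 hΩ x hx.1
    let b : ContDiffBump x := ⟨r / 4, r / 2, by positivity, by linarith⟩
    have hb : IsTestFunction Ω b := by
      refine ⟨b.contDiff, b.hasCompactSupport, ?_⟩
      rw [b.tsupport_eq]
      exact (Metric.closedBall_subset_ball (by simp only [b]; linarith)).trans hrΩ
    have := hu.ne_zero_on_support hn hs0 hs1 hu0 hune h hb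
    refine ⟨{y | ¬ (0 < b y → u y ≠ 0)}, ?_, ae_iff.1 this⟩
    have hball : Metric.ball x (r / 2) ∈ 𝓝 x := Metric.ball_mem_nhds _ (by positivity)
    filter_upwards [mem_nhdsWithin_of_mem_nhds hball, self_mem_nhdsWithin] with y hy hy2
    simp only [Classical.not_imp, not_not]
    exact ⟨b.pos_of_mem_ball hy, hy2.2⟩
  have : ∀ᵐ x, ¬ (x ∈ Ω ∧ u x = 0) := by rw [ae_iff]; simpa using null
  filter_upwards [this, hu0] with x h1 h2 h3
  exact lt_of_le_of_ne h2 fun h4 => h1 ⟨h3, h4.symm⟩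

end Maximum

/-! ### The measure `|x|⁻² dx` -/

section HardyMeasure

variable {n : ℕ} {Ω : Set (Eucl n)} {u : Eucl n → ℝ} {G : Eucl n → Eucl n}

/-- The measure `|x|⁻² dx` on `Ω`. -/
noncomputable def hardyMeasure (Ω : Set (Eucl n)) : Measure (Eucl n) :=
  (volume.restrict Ω).withDensity fun x => ENNReal.ofReal (1 / ‖x‖ ^ 2)

theorem lintegral_hardyMeasure (Ω : Set (Eucl n)) (f : Eucl n → ℝ≥0∞) :
    ∫⁻ x, f x ∂(hardyMeasure Ω) = ∫⁻ x in Ω, ENNReal.ofReal (1 / ‖x‖ ^ 2) * f x :=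
  lintegral_withDensity_eq_lintegral_mul_non_measurable _
    (measurable_const.div (measurable_norm.pow_const 2)).ennreal_ofReal
    (Eventually.of_forall fun _ => ENNReal.ofReal_lt_top) f

theorem ae_ne_zero_eucl (hn : 1 ≤ n) : ∀ᵐ x : Eucl n, x ≠ 0 := by
  have : Nontrivial (Eucl n) := by
    have : Nonempty (Fin n) := ⟨⟨0, by omega⟩⟩
    infer_instance
  simp [ae_iff]

theorem hardyMeasure_absolutelyContinuous (Ω : Set (Eucl n)) :
    hardyMeasure Ω ≪ volume.restrict Ω :=
  withDensity_absolutelyContinuous _ _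

theorem absolutelyContinuous_hardyMeasure (hn : 1 ≤ n) (Ω : Set (Eucl n)) :
    volume.restrict Ω ≪ hardyMeasure Ω := by
  refine withDensity_absolutelyContinuous'
    (measurable_const.div (measurable_norm.pow_const 2)).ennreal_ofReal.aemeasurable ?_
  filter_upwards [ae_restrict_of_ae (ae_ne_zero_eucl hn)] with x hx
  simpa using hx

theorem MemSobolevZero.lintegral_hardyMeasure_le (hn : 3 ≤ n) (Ω' : Set (Eucl n))
    (h : MemSobolevZero 2 Ω u G) :
    ∫⁻ x, ‖u x‖ₑ ^ 2 ∂(hardyMeasure Ω') ≤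
      ENNReal.ofReal (4 / ((n : ℝ) - 2) ^ 2) * ∫⁻ x, ‖G x‖ₑ ^ 2 := by
  refine le_trans ?_ (h.hardy hn)
  rw [lintegral_hardyMeasure]
  refine (setLIntegral_le_lintegral _ _).trans (lintegral_mono fun x => ?_)
  rw [← ofReal_norm, ← ENNReal.ofReal_pow (norm_nonneg _), Real.norm_eq_abs, sq_abs,
    ← ENNReal.ofReal_mul (by positivity), one_div_mul_eq_div]

theorem isFiniteMeasure_hardyMeasure (hn : 3 ≤ n) (hΩ : IsOpen Ω)
    (hΩb : Bornology.IsBounded Ω) : IsFiniteMeasure (hardyMeasure Ω) := by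
  obtain ⟨R, hR0, hR⟩ := hΩb.subset_closedBall_lt 0 (0 : Eucl n)
  let b : ContDiffBump (0 : Eucl n) := ⟨R, R + 1, hR0, by linarith⟩
  have hb : IsTestFunction Set.univ b := ⟨b.contDiff, b.hasCompactSupport, Set.subset_univ _⟩
  have h2 := hb.memSobolevZero (p := 2) (by simp)
  refine ⟨?_⟩
  calc hardyMeasure Ω Set.univ = ∫⁻ x in Ω, ENNReal.ofReal (1 / ‖x‖ ^ 2) * 1 := by
        rw [← lintegral_hardyMeasure]; simp
    _ ≤ ∫⁻ x in Ω, ENNReal.ofReal (1 / ‖x‖ ^ 2) * ‖b x‖ₑ ^ 2 := by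
        refine setLIntegral_mono' hΩ.measurableSet fun x hx => ?_
        rw [show b x = 1 from b.one_of_mem_closedBall (hR hx)]
        simp
    _ = ∫⁻ x, ‖b x‖ₑ ^ 2 ∂(hardyMeasure Ω) := (lintegral_hardyMeasure _ _).symm
    _ ≤ ENNReal.ofReal (4 / ((n : ℝ) - 2) ^ 2) * ∫⁻ x, ‖gradient b x‖ₑ ^ 2 :=
        h2.lintegral_hardyMeasure_le hn Ω
    _ < ⊤ := by
        rw [lintegral_enorm_sq_eq]
        exact ENNReal.mul_lt_top ENNReal.ofReal_lt_top (ENNReal.pow_lt_top h2.2.1.2)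

end HardyMeasure

/-! ### Regularized powers -/

section Powers

variable {α ε : ℝ}

/-- A smooth regularization of the odd power `|t|^{α-1} t`. -/
noncomputable def oddPower (α ε t : ℝ) : ℝ := t * (t ^ 2 + ε) ^ ((α - 1) / 2)

/-- A smooth regularization of `|t|^{(α+1)/2}`. -/
noncomputable def halfPower (α ε t : ℝ) : ℝ :=
  (t ^ 2 + ε) ^ ((α + 1) / 4) - ε ^ ((α + 1) / 4)

theorem contDiff_sq_add_rpow (hε : 0 < ε) (r : ℝ) :
    ContDiff ℝ ∞ fun t : ℝ => (t ^ 2 + ε) ^ r :=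
  ((contDiff_id.pow 2).add contDiff_const).rpow_const_of_ne fun t => by
    have := sq_nonneg t; simp only [id]; positivity

theorem hasDerivAt_sq_add_rpow (hε : 0 < ε) (r t : ℝ) :
    HasDerivAt (fun t : ℝ => (t ^ 2 + ε) ^ r) (2 * r * t * (t ^ 2 + ε) ^ (r - 1)) t := by
  have h0 : t ^ 2 + ε ≠ 0 := by positivity
  have h1 : HasDerivAt (fun t : ℝ => t ^ 2 + ε) (2 * t) t := by
    simpa using (hasDerivAt_pow 2 t).add_const ε
  refine (h1.rpow_const (p := r) (Or.inl h0)).congr_deriv ?_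
  ring

theorem contDiff_oddPower (hε : 0 < ε) : ContDiff ℝ ∞ (oddPower α ε) :=
  contDiff_id.mul (contDiff_sq_add_rpow hε _)

theorem contDiff_halfPower (hε : 0 < ε) : ContDiff ℝ ∞ (halfPower α ε) :=
  (contDiff_sq_add_rpow hε _).sub contDiff_const

theorem deriv_oddPower (hε : 0 < ε) (t : ℝ) : deriv (oddPower α ε) t =
    (t ^ 2 + ε) ^ ((α - 1) / 2) * ((α * t ^ 2 + ε) / (t ^ 2 + ε)) := by
  have h0 : 0 < t ^ 2 + ε := by positivity
  have h1 := (hasDerivAt_id t).mul (hasDerivAt_sq_add_rpow hε ((α - 1) / 2) t)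
  have h2 : deriv (oddPower α ε) t = _ := h1.deriv
  rw [h2, Real.rpow_sub_one h0.ne']
  simp only [id]
  field_simp
  ring

theorem deriv_halfPower (hε : 0 < ε) (t : ℝ) : deriv (halfPower α ε) t =
    (α + 1) / 2 * t * (t ^ 2 + ε) ^ ((α + 1) / 4 - 1) := by
  have h1 := (hasDerivAt_sq_add_rpow hε ((α + 1) / 4) t).sub_const (ε ^ ((α + 1) / 4))
  have h2 : deriv (halfPower α ε) t = _ := h1.deriv
  rw [h2]
  ring

theorem le_deriv_oddPower (hα1 : α ≤ 1) (hε : 0 < ε) (t : ℝ) :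
    α * (t ^ 2 + ε) ^ ((α - 1) / 2) ≤ deriv (oddPower α ε) t := by
  have h0 : 0 < t ^ 2 + ε := by positivity
  rw [deriv_oddPower hε, mul_comm]
  refine mul_le_mul_of_nonneg_left ?_ (by positivity)
  rw [le_div_iff₀ h0]
  nlinarith

theorem deriv_oddPower_nonneg (hα0 : 0 ≤ α) (hε : 0 < ε) (t : ℝ) :
    0 ≤ deriv (oddPower α ε) t := by
  rw [deriv_oddPower hε]; positivity

theorem monotone_oddPower (hα0 : 0 ≤ α) (hε : 0 < ε) : Monotone (oddPower α ε) :=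
  monotone_of_deriv_nonneg ((contDiff_oddPower hε).differentiable (by simp))
    (deriv_oddPower_nonneg hα0 hε)

theorem abs_deriv_oddPower_le (hα0 : 0 ≤ α) (hα1 : α ≤ 1) (hε : 0 < ε) (t : ℝ) :
    |deriv (oddPower α ε) t| ≤ ε ^ ((α - 1) / 2) := by
  have h0 : 0 < t ^ 2 + ε := by positivity
  rw [abs_of_nonneg (deriv_oddPower_nonneg hα0 hε t), deriv_oddPower hε]
  have h1 : (t ^ 2 + ε) ^ ((α - 1) / 2) ≤ ε ^ ((α - 1) / 2) :=
    Real.rpow_le_rpow_of_nonpos hε (by nlinarith) (by linarith)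
  have h2 : (α * t ^ 2 + ε) / (t ^ 2 + ε) ≤ 1 := by
    rw [div_le_one h0]; nlinarith [sq_nonneg t]
  exact (mul_le_of_le_one_right (by positivity) h2).trans h1

theorem abs_oddPower_le (hα0 : 0 < α) (hα1 : α ≤ 1) (hε : 0 < ε) (t : ℝ) :
    |oddPower α ε t| ≤ |t| ^ α := by
  rcases eq_or_ne t 0 with rfl | ht
  · simp [oddPower, hα0.ne']
  have ht' : 0 < |t| := abs_pos.2 ht
  rw [oddPower, abs_mul, abs_of_nonneg (a := _ ^ _) (by positivity)]
  have h1 : (t ^ 2 + ε) ^ ((α - 1) / 2) ≤ (|t| ^ 2) ^ ((α - 1) / 2) :=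
    Real.rpow_le_rpow_of_nonpos (by positivity) (by rw [sq_abs]; linarith) (by linarith)
  have h2 : (|t| ^ 2) ^ ((α - 1) / 2) = |t| ^ (α - 1) := by
    rw [← Real.rpow_natCast, ← Real.rpow_mul ht'.le]
    congr 1; push_cast; ring
  refine (mul_le_mul_of_nonneg_left (h1.trans_eq h2) ht'.le).trans (le_of_eq ?_)
  rw [mul_comm, ← Real.rpow_add_one ht'.ne']
  congr 1; ring

theorem deriv_halfPower_sq_le (hε : 0 < ε) (t : ℝ) :
    deriv (halfPower α ε) t ^ 2 ≤ (α + 1) ^ 2 / 4 * (t ^ 2 + ε) ^ ((α - 1) / 2) := by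
  have h0 : 0 < t ^ 2 + ε := by positivity
  rw [deriv_halfPower hε]
  have h1 : ((t ^ 2 + ε) ^ ((α + 1) / 4 - 1)) ^ 2 =
      (t ^ 2 + ε) ^ ((α - 1) / 2) / (t ^ 2 + ε) := by
    rw [← Real.rpow_sub_one h0.ne', ← Real.rpow_natCast, ← Real.rpow_mul h0.le]
    congr 1; push_cast; ring
  rw [mul_pow, mul_pow, h1, div_pow]
  have h2 : t ^ 2 / (t ^ 2 + ε) ≤ 1 := by rw [div_le_one h0]; linarith
  calc (α + 1) ^ 2 / 2 ^ 2 * t ^ 2 * ((t ^ 2 + ε) ^ ((α - 1) / 2) / (t ^ 2 + ε))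
      = ((α + 1) ^ 2 / 4 * (t ^ 2 + ε) ^ ((α - 1) / 2)) * (t ^ 2 / (t ^ 2 + ε)) := by ring
    _ ≤ _ := mul_le_of_le_one_right (by positivity) h2

theorem abs_deriv_halfPower_le (hα0 : 0 ≤ α) (hα1 : α ≤ 1) (hε : 0 < ε) (t : ℝ) :
    |deriv (halfPower α ε) t| ≤ (α + 1) / 2 * ε ^ ((α - 1) / 4) := by
  refine abs_le_of_sq_le_sq ?_ (by positivity)
  refine (deriv_halfPower_sq_le hε t).trans ?_
  have h1 : (t ^ 2 + ε) ^ ((α - 1) / 2) ≤ ε ^ ((α - 1) / 2) :=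
    Real.rpow_le_rpow_of_nonpos hε (by nlinarith) (by linarith)
  have h2 : (ε ^ ((α - 1) / 4)) ^ 2 = ε ^ ((α - 1) / 2) := by
    rw [← Real.rpow_natCast, ← Real.rpow_mul hε.le]
    congr 1; push_cast; ring
  rw [mul_pow, h2]
  calc _ ≤ (α + 1) ^ 2 / 4 * ε ^ ((α - 1) / 2) := by gcongr
    _ = _ := by ring

theorem tendsto_halfPower (hα0 : 0 ≤ α) {ε : ℕ → ℝ} (hε : Tendsto ε atTop (𝓝 0))
    (t : ℝ) : Tendsto (fun j => halfPower α (ε j) t) atTop (𝓝 (|t| ^ ((α + 1) / 2))) := by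
  have hc : Continuous fun y : ℝ => y ^ ((α + 1) / 4) := Real.continuous_rpow_const (by positivity)
  have h1 := (hc.tendsto _).comp (hε.const_add (t ^ 2))
  have h2 := (hc.tendsto _).comp hε
  have h3 := h1.sub h2
  have e : (t ^ 2 + 0) ^ ((α + 1) / 4) - (0 : ℝ) ^ ((α + 1) / 4) = |t| ^ ((α + 1) / 2) := by
    rw [add_zero, Real.zero_rpow (by positivity), sub_zero, ← sq_abs, ← Real.rpow_natCast,
      ← Real.rpow_mul (abs_nonneg t)]
    congr 1; push_cast; ring
  rw [e] at h3
  exact h3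

end Powers

/-! ### The a priori estimate -/

section APriori

theorem ENNReal.holderTriple_ofReal {a b c : ℝ} (ha : 0 < a) (hb : 0 < b) (hc : 0 < c)
    (h : a⁻¹ + b⁻¹ = c⁻¹) :
    (ENNReal.ofReal a).HolderTriple (ENNReal.ofReal b) (ENNReal.ofReal c) :=
  ⟨by rw [← ENNReal.ofReal_inv_of_pos ha, ← ENNReal.ofReal_inv_of_pos hb,
    ← ENNReal.ofReal_inv_of_pos hc, ← ENNReal.ofReal_add (by positivity) (by positivity), h]⟩

/-- Hölder's inequality for a product `|F| |d|^α`. -/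
theorem lintegral_enorm_mul_rpow_le {X : Type*} [MeasurableSpace X] {μ : Measure X}
    {F d : X → ℝ} {a b α : ℝ} (ha : 0 < a) (hb : 0 < b) (hα : 0 < α)
    (hab : a⁻¹ + α / b = 1) (hF : AEStronglyMeasurable F μ) (hd : AEStronglyMeasurable d μ) :
    ∫⁻ x, ‖F x‖ₑ * ‖d x‖ₑ ^ α ∂μ ≤
      eLpNorm F (ENNReal.ofReal a) μ * eLpNorm d (ENNReal.ofReal b) μ ^ α := by
  have hc : a.HolderConjugate (b / α) := by
    constructor
    · rw [inv_div, hab, inv_one]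
    · exact ha
    · positivity
  have := ENNReal.lintegral_mul_le_Lp_mul_Lq μ hc hF.enorm (hd.enorm.pow_const α)
  refine this.trans (le_of_eq ?_)
  rw [eLpNorm_eq_lintegral_rpow_enorm_toReal (by simpa using ha) (by simp),
    eLpNorm_eq_lintegral_rpow_enorm_toReal (by simpa using hb) (by simp),
    ENNReal.toReal_ofReal ha.le, ENNReal.toReal_ofReal hb.le, ← ENNReal.rpow_mul]
  simp_rw [← ENNReal.rpow_mul]
  congr 3
  · ext x; congr 1; field_simp
  · field_simp

/-- If `A` and `M` are controlled by a power of `R`, and `R` by `A` and `M` and the data `f` and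
`η` with an exponent smaller by one, then `R` is controlled by the data. -/
theorem rpow_inv_le_of_le_of_le {α : ℝ} (hα : 0 < α) {A M f η κ σ R : ℝ≥0∞} (hR : R ≠ ⊤)
    (h1 : A ^ (α + 1) ≤ κ * R) (h2 : M ^ (α + 1) ≤ σ * R) (h3 : R ≤ f * A ^ α + η * M ^ α) :
    R ^ (1 / (α + 1)) ≤ f * κ ^ (α / (α + 1)) + η * σ ^ (α / (α + 1)) := by
  set X := R ^ (1 / (α + 1)) with hX
  have hα1 : 0 < α + 1 := by linarith
  have root {B τ : ℝ≥0∞} (hB : B ^ (α + 1) ≤ τ * R) : B ^ α ≤ τ ^ (α / (α + 1)) * X ^ α := by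
    have := ENNReal.rpow_le_rpow hB (z := α / (α + 1)) (by positivity)
    rw [← ENNReal.rpow_mul, ENNReal.mul_rpow_of_nonneg _ _ (by positivity)] at this
    rw [hX, ← ENNReal.rpow_mul]
    convert this using 2
    · field_simp
    · congr 1; field_simp
  rcases eq_or_ne X 0 with h0 | h0
  · rw [h0]; exact zero_le
  have hXt : X ≠ ⊤ := ENNReal.rpow_ne_top_of_nonneg (by positivity) hR
  have e : R = X * X ^ α := by
    rw [hX, ← ENNReal.rpow_mul, ← ENNReal.rpow_add_of_nonneg _ _ (by positivity) (by positivity)]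
    rw [show 1 / (α + 1) + 1 / (α + 1) * α = 1 by field_simp; ring, ENNReal.rpow_one]
  have k : X * X ^ α ≤ (f * κ ^ (α / (α + 1)) + η * σ ^ (α / (α + 1))) * X ^ α := by
    rw [← e, add_mul, mul_assoc, mul_assoc]
    exact h3.trans (add_le_add (mul_le_mul_right (root h1) _) (mul_le_mul_right (root h2) _))
  exact (ENNReal.mul_le_mul_iff_left (by simp [h0, hXt])
    (ENNReal.rpow_ne_top_of_nonneg hα.le hXt)).1 k

variable {n : ℕ} {Ω : Set (Eucl n)} {s α ε : ℝ} {d : Eucl n → ℝ} {D : Eucl n → Eucl n}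
  {R : ℝ≥0∞}

/-- The energy estimate obtained by testing the equation with `oddPower α ε d`; the nonlocal term
has a sign, because `oddPower α ε` is monotone. -/
theorem MemSobolevZero.lintegral_power_energy_le (hn : 1 ≤ n) (hs0 : 0 < s) (hs1 : s < 1)
    (hα0 : 0 < α) (hα1 : α < 1) (hd : MemSobolevZero 2 Ω d D)
    (hR : ∀ v V, MemSobolevZero 2 Ω v V → (∀ x, |v x| ≤ |d x| ^ α) →
      ENNReal.ofReal (mixedForm s d D v V) ≤ R) (hε : 0 < ε) :
    ∫⁻ x, ENNReal.ofReal ((d x ^ 2 + ε) ^ ((α - 1) / 2)) * ‖D x‖ₑ ^ 2 ≤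
      ENNReal.ofReal (1 / α) * R := by
  have hv := hd.comp (by simp) (by simp) (contDiff_oddPower (α := α) hε) (by simp [oddPower])
    (abs_deriv_oddPower_le hα0.le hα1.le hε)
  have h1 := hR _ _ hv (fun x => abs_oddPower_le hα0 hα1.le hε (d x))
  have int := integrable_inner_of_memLp_two hd.2.1 hv.2.1
  have pt (x) : inner ℝ (D x) (deriv (oddPower α ε) (d x) • D x) =
      deriv (oddPower α ε) (d x) * ‖D x‖ ^ 2 := by
    rw [inner_smul_right, real_inner_self_eq_norm_sq]
  have nl : 0 ≤ ∫ q, nonlocalKernel s d (fun x => oddPower α ε (d x)) q := by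
    refine integral_nonneg fun q => ?_
    refine div_nonneg ?_ (by positivity)
    have mono := monotone_oddPower hα0.le hε
    rcases le_total (d q.1) (d q.2) with hq | hq
    · exact mul_nonneg_of_nonpos_of_nonpos (sub_nonpos.2 hq) (sub_nonpos.2 (mono hq))
    · exact mul_nonneg (sub_nonneg.2 hq) (sub_nonneg.2 (mono hq))
  have h2 : ENNReal.ofReal (∫ x, inner ℝ (D x) (deriv (oddPower α ε) (d x) • D x)) ≤ R := by
    refine le_trans (ENNReal.ofReal_le_ofReal ?_) h1
    have := mul_nonneg (half_pos (fracConst_pos (s := s) hn hs0 hs1)).le nl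
    rw [mixedForm]; linarith
  rw [ofReal_integral_eq_lintegral_ofReal int (Eventually.of_forall fun x => by
    simp only [Pi.zero_apply, pt]; exact mul_nonneg (deriv_oddPower_nonneg hα0.le hε _) (by positivity))] at h2
  have h3 : ENNReal.ofReal α *
      ∫⁻ x, ENNReal.ofReal ((d x ^ 2 + ε) ^ ((α - 1) / 2)) * ‖D x‖ₑ ^ 2 ≤ R := by
    rw [← lintegral_const_mul' _ _ ENNReal.ofReal_ne_top]
    refine le_trans (lintegral_mono fun x => ?_) h2
    rw [pt, ← mul_assoc, ← ENNReal.ofReal_mul hα0.le, ← ofReal_norm,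
      ← ENNReal.ofReal_pow (norm_nonneg _), ← ENNReal.ofReal_mul (by positivity)]
    exact ENNReal.ofReal_le_ofReal (mul_le_mul_of_nonneg_right
      (le_deriv_oddPower hα1.le hε (d x)) (by positivity))
  calc _ = ENNReal.ofReal (1 / α) * (ENNReal.ofReal α *
      ∫⁻ x, ENNReal.ofReal ((d x ^ 2 + ε) ^ ((α - 1) / 2)) * ‖D x‖ₑ ^ 2) := by
        rw [← mul_assoc, ← ENNReal.ofReal_mul (by positivity), one_div_mul_cancel hα0.ne',
          ENNReal.ofReal_one, one_mul]
    _ ≤ _ := mul_le_mul_right h3 _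

theorem MemSobolevZero.halfPower (hα0 : 0 < α) (hα1 : α < 1) (hd : MemSobolevZero 2 Ω d D)
    (hε : 0 < ε) :
    MemSobolevZero 2 Ω (fun x => halfPower α ε (d x))
      (fun x => deriv (_root_.halfPower α ε) (d x) • D x) :=
  hd.comp (by simp) (by simp) (contDiff_halfPower (α := α) hε) (by simp [_root_.halfPower])
    (abs_deriv_halfPower_le hα0.le hα1.le hε)

theorem lintegral_gradient_halfPower_le (hε : 0 < ε) {W : ℝ≥0∞}
    (hW : ∫⁻ x, ENNReal.ofReal ((d x ^ 2 + ε) ^ ((α - 1) / 2)) * ‖D x‖ₑ ^ 2 ≤ W) :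
    ∫⁻ x, ‖deriv (halfPower α ε) (d x) • D x‖ₑ ^ 2 ≤ ENNReal.ofReal ((α + 1) ^ 2 / 4) * W := by
  refine le_trans ?_ (mul_le_mul_right hW _)
  rw [← lintegral_const_mul' _ _ ENNReal.ofReal_ne_top]
  refine lintegral_mono fun x => ?_
  rw [← mul_assoc, ← ENNReal.ofReal_mul (by positivity), enorm_smul, mul_pow]
  gcongr
  rw [← ofReal_norm, ← ENNReal.ofReal_pow (norm_nonneg _), Real.norm_eq_abs, sq_abs]
  exact ENNReal.ofReal_le_ofReal (deriv_halfPower_sq_le hε (d x))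

theorem enorm_abs_rpow (t : ℝ) {r : ℝ} (hr : 0 ≤ r) : ‖|t| ^ r‖ₑ = ‖t‖ₑ ^ r := by
  rw [← ofReal_norm, ← ofReal_norm, Real.norm_of_nonneg (by positivity), Real.norm_eq_abs,
    ENNReal.ofReal_rpow_of_nonneg (abs_nonneg t) hr]

/-- Hardy's inequality for `|d|^{(α+1)/2}`. -/
theorem MemSobolevZero.lintegral_rpow_hardyMeasure_le (hn : 3 ≤ n) (hα0 : 0 < α) (hα1 : α < 1)
    (hd : MemSobolevZero 2 Ω d D) {W : ℝ≥0∞}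
    (hW : ∀ ε : ℝ, 0 < ε →
      ∫⁻ x, ENNReal.ofReal ((d x ^ 2 + ε) ^ ((α - 1) / 2)) * ‖D x‖ₑ ^ 2 ≤ W) :
    ∫⁻ x, ‖d x‖ₑ ^ (α + 1) ∂(hardyMeasure Ω) ≤
      ENNReal.ofReal ((α + 1) ^ 2 / ((n : ℝ) - 2) ^ 2) * W := by
  let ε : ℕ → ℝ := fun j => 1 / ((j : ℝ) + 1)
  have ε0 (j) : 0 < ε j := Nat.one_div_pos_of_nat
  have εlim : Tendsto ε atTop (𝓝 0) := tendsto_one_div_add_atTop_nhds_zero_nat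
  have b (j) : ∫⁻ x, ‖_root_.halfPower α (ε j) (d x)‖ₑ ^ 2 ∂(hardyMeasure Ω) ≤
      ENNReal.ofReal ((α + 1) ^ 2 / ((n : ℝ) - 2) ^ 2) * W := by
    refine ((hd.halfPower hα0 hα1 (ε0 j)).lintegral_hardyMeasure_le hn Ω).trans ?_
    refine (mul_le_mul_right (lintegral_gradient_halfPower_le (ε0 j) (hW _ (ε0 j))) _).trans ?_
    rw [← mul_assoc, ← ENNReal.ofReal_mul (by positivity)]
    refine le_of_eq ?_
    congr 2; ring
  have ac := (hardyMeasure_absolutelyContinuous Ω).trans Measure.restrict_le_self.absolutelyContinuous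
  have fatou : ∫⁻ x, ‖d x‖ₑ ^ (α + 1) ∂(hardyMeasure Ω) ≤
      liminf (fun j => ∫⁻ x, ‖_root_.halfPower α (ε j) (d x)‖ₑ ^ 2 ∂(hardyMeasure Ω)) atTop := by
    refine le_trans (lintegral_mono fun x => ?_) (lintegral_liminf_le' fun j => ?_)
    · have t1 := (continuous_enorm.tendsto _).comp (tendsto_halfPower hα0.le εlim (d x))
      have t2 := ((ENNReal.continuous_pow 2).tendsto _).comp t1
      refine le_of_eq (Eq.trans ?_ t2.liminf_eq.symm)
      rw [enorm_abs_rpow _ (by positivity), ← ENNReal.rpow_natCast, ← ENNReal.rpow_mul]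
      congr 1; push_cast; ring
    · exact (((contDiff_halfPower (ε0 j)).continuous.comp_aestronglyMeasurable
        (hd.1.1.mono_ac ac)).enorm).pow_const 2
  exact fatou.trans ((liminf_le_liminf (Eventually.of_forall b)).trans (by simp))

/-- Sobolev's inequality for `|d|^{(α+1)/2}`; the exponent of `d` is `(α+1)/2` times the Sobolev
exponent. -/
theorem MemSobolevZero.eLpNorm_rpow_le (hn : 3 ≤ n) (hα0 : 0 < α) (hα1 : α < 1)
    (hd : MemSobolevZero 2 Ω d D) {W S : ℝ≥0∞}
    (hW : ∀ ε : ℝ, 0 < ε →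
      ∫⁻ x, ENNReal.ofReal ((d x ^ 2 + ε) ^ ((α - 1) / 2)) * ‖D x‖ₑ ^ 2 ≤ W)
    (hS : ∀ (u : Eucl n → ℝ) (G : Eucl n → Eucl n), MemSobolevZero 2 Ω u G →
      eLpNorm u (ENNReal.ofReal (2 * n / ((n : ℝ) - 2))) volume ≤ S * eLpNorm G 2 volume) :
    eLpNorm d (ENNReal.ofReal (n * (α + 1) / ((n : ℝ) - 2))) volume ^ (α + 1) ≤
      S ^ 2 * ENNReal.ofReal ((α + 1) ^ 2 / 4) * W := by
  have hn' : (3 : ℝ) ≤ n := by exact_mod_cast hn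
  let ε : ℕ → ℝ := fun j => 1 / ((j : ℝ) + 1)
  have ε0 (j) : 0 < ε j := Nat.one_div_pos_of_nat
  have εlim : Tendsto ε atTop (𝓝 0) := tendsto_one_div_add_atTop_nhds_zero_nat
  set p := ENNReal.ofReal (2 * n / ((n : ℝ) - 2)) with hp
  have b (j) : eLpNorm (fun x => _root_.halfPower α (ε j) (d x)) p volume ≤
      S * (ENNReal.ofReal ((α + 1) ^ 2 / 4) * W) ^ (1 / 2 : ℝ) := by
    refine (hS _ _ (hd.halfPower hα0 hα1 (ε0 j))).trans (mul_le_mul_right ?_ _)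
    have := lintegral_gradient_halfPower_le (ε0 j) (hW _ (ε0 j))
    rw [lintegral_enorm_sq_eq] at this
    have := ENNReal.rpow_le_rpow this (z := 1 / 2) (by norm_num)
    rwa [← ENNReal.rpow_natCast, ← ENNReal.rpow_mul, Nat.cast_ofNat, mul_one_div_cancel (by simp),
      ENNReal.rpow_one] at this
  have fatou : eLpNorm (fun x => |d x| ^ ((α + 1) / 2)) p volume ≤
      S * (ENNReal.ofReal ((α + 1) ^ 2 / 4) * W) ^ (1 / 2 : ℝ) := by
    refine (Lp.eLpNorm_lim_le_liminf_eLpNorm (fun j => (hd.halfPower hα0 hα1 (ε0 j)).1.1) _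
      (Eventually.of_forall fun x => tendsto_halfPower hα0.le εlim (d x))).trans ?_
    exact (liminf_le_liminf (Eventually.of_forall b)).trans (by simp)
  have e : eLpNorm (fun x => |d x| ^ ((α + 1) / 2)) p volume =
      eLpNorm d (ENNReal.ofReal (n * (α + 1) / ((n : ℝ) - 2))) volume ^ ((α + 1) / 2) := by
    have := eLpNorm_norm_rpow (μ := volume) (p := p) d (q := (α + 1) / 2) (by positivity)
    simp only [Real.norm_eq_abs] at this
    rw [this, hp, ← ENNReal.ofReal_mul (by apply div_nonneg <;> linarith)]
    congr 3
    ring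
  rw [e] at fatou
  have := pow_le_pow_left' fatou 2
  rw [mul_pow, ← ENNReal.rpow_natCast, ← ENNReal.rpow_mul, ← ENNReal.rpow_natCast (_ ^ (1 / 2 : ℝ)),
    ← ENNReal.rpow_mul, Nat.cast_ofNat, one_div_mul_cancel (by simp), ENNReal.rpow_one,
    div_mul_cancel₀ _ (by simp), ← mul_assoc] at this
  exact this

/-- The gradient bound: Hölder's inequality for the product of `|d|^{(1-α)/2}` and
`|d|^{(α-1)/2} ∇d`. -/
theorem MemSobolevZero.eLpNorm_gradient_le (hα1 : α < 1)
    (hd : MemSobolevZero 2 Ω d D) {W : ℝ≥0∞}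
    (hW : ∀ ε : ℝ, 0 < ε →
      ∫⁻ x, ENNReal.ofReal ((d x ^ 2 + ε) ^ ((α - 1) / 2)) * ‖D x‖ₑ ^ 2 ≤ W)
    {P r : ℝ} (hP : 0 < P) (hr : 0 < r) (hrP : r⁻¹ = (1 - α) / (2 * P) + 1 / 2) :
    eLpNorm D (ENNReal.ofReal r) volume ≤
      eLpNorm d (ENNReal.ofReal P) volume ^ ((1 - α) / 2) * W ^ (1 / 2 : ℝ) := by
  let ε : ℕ → ℝ := fun j => 1 / ((j : ℝ) + 1)
  have ε0 (j) : 0 < ε j := Nat.one_div_pos_of_nat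
  have εlim : Tendsto ε atTop (𝓝 0) := tendsto_one_div_add_atTop_nhds_zero_nat
  let E : Eucl n → Eucl n := fun x => |d x| ^ ((α - 1) / 2) • D x
  have md := hd.1.1.aemeasurable
  have mE : AEStronglyMeasurable E volume := by
    have : AEMeasurable (fun x => |d x| ^ ((α - 1) / 2)) volume := md.norm.pow_const _
    exact this.aestronglyMeasurable.smul hd.2.1.1
  have hE : ∫⁻ x, ‖E x‖ₑ ^ 2 ≤ W := by
    refine le_trans (le_trans (lintegral_mono fun x => ?_) (lintegral_liminf_le'
      (f := fun j x => ENNReal.ofReal ((d x ^ 2 + ε j) ^ ((α - 1) / 2)) * ‖D x‖ₑ ^ 2)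
      fun j => ?_)) ((liminf_le_liminf (Eventually.of_forall fun j => hW _ (ε0 j))).trans (liminf_const (f := (atTop : Filter ℕ)) W).le)
    · rcases eq_or_ne (d x) 0 with h0 | h0
      · have : E x = 0 := by
          simp only [E, h0, abs_zero]
          rw [Real.zero_rpow (by linarith), zero_smul]
        simp [this]
      · have t1 : Tendsto (fun j => (d x ^ 2 + ε j) ^ ((α - 1) / 2)) atTop
            (𝓝 ((d x ^ 2 + 0) ^ ((α - 1) / 2))) :=
          (εlim.const_add (d x ^ 2)).rpow_const (Or.inl (by simpa using h0))
        have t2 := (ENNReal.continuous_ofReal.tendsto _).comp t1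
        have t3 := ENNReal.Tendsto.mul_const (b := ‖D x‖ₑ ^ 2) t2 (Or.inr (by simp))
        refine le_of_eq (Eq.trans ?_ t3.liminf_eq.symm)
        rw [add_zero, enorm_smul, mul_pow]
        congr 1
        rw [← ofReal_norm, ← ENNReal.ofReal_pow (norm_nonneg _), Real.norm_of_nonneg (by positivity),
          ← sq_abs (d x), ← Real.rpow_natCast, ← Real.rpow_natCast, ← Real.rpow_mul (abs_nonneg _),
          ← Real.rpow_mul (abs_nonneg _)]
        congr 2; push_cast; ring
    · exact (((md.pow_const 2).add_const _).pow_const _).ennreal_ofReal.mul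
        (hd.2.1.1.enorm.pow_const 2)
  have hE' : eLpNorm E 2 volume ≤ W ^ (1 / 2 : ℝ) := by
    rw [lintegral_enorm_sq_eq] at hE
    have := ENNReal.rpow_le_rpow hE (z := 1 / 2) (by norm_num)
    rwa [← ENNReal.rpow_natCast, ← ENNReal.rpow_mul, Nat.cast_ofNat, mul_one_div_cancel (by simp),
      ENNReal.rpow_one] at this
  have hDE : D =ᵐ[volume] fun x => |d x| ^ ((1 - α) / 2) • E x := by
    filter_upwards [hd.gradient_eq_zero_of_eq_zero (by simp) (by simp)] with x hx
    rcases eq_or_ne (d x) 0 with h0 | h0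
    · simp [E, hx h0]
    · have : 0 < |d x| := abs_pos.2 h0
      simp only [E]
      rw [smul_smul, ← Real.rpow_add this]
      rw [show (1 - α) / 2 + (α - 1) / 2 = 0 by ring, Real.rpow_zero, one_smul]
  have hol : (ENNReal.ofReal (2 * P / (1 - α))).HolderTriple 2 (ENNReal.ofReal r) := by
    have h1 : 0 < 1 - α := by linarith
    have := ENNReal.holderTriple_ofReal (a := 2 * P / (1 - α)) (b := 2) (c := r)
      (by positivity) two_pos hr (by rw [hrP, inv_div]; norm_num)
    simpa using this
  have mp : AEStronglyMeasurable (fun x => |d x| ^ ((1 - α) / 2)) volume :=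
    (md.norm.pow_const _ : AEMeasurable (fun x => |d x| ^ ((1 - α) / 2)) volume).aestronglyMeasurable
  rw [eLpNorm_congr_ae hDE]
  refine (eLpNorm_smul_le_mul_eLpNorm (p := ENNReal.ofReal (2 * P / (1 - α))) (q := 2) mE mp).trans ?_
  refine mul_le_mul' (le_of_eq ?_) hE'
  have := eLpNorm_norm_rpow (μ := volume) (p := ENNReal.ofReal (2 * P / (1 - α))) d
    (q := (1 - α) / 2) (by linarith)
  simp only [Real.norm_eq_abs] at this
  have h1 : 0 < 1 - α := by linarith
  rw [this, ← ENNReal.ofReal_mul (by positivity)]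
  congr 3
  field_simp

theorem MemSobolevZero.memLp_hardyMeasure (hn : 3 ≤ n) (hΩ : IsOpen Ω)
    (hΩb : Bornology.IsBounded Ω) (hd : MemSobolevZero 2 Ω d D) {p : ℝ≥0∞} (hp : p ≤ 2) :
    MemLp d p (hardyMeasure Ω) := by
  have := isFiniteMeasure_hardyMeasure hn hΩ hΩb
  have ac := (hardyMeasure_absolutelyContinuous Ω).trans Measure.restrict_le_self.absolutelyContinuous
  have h2 : MemLp d 2 (hardyMeasure Ω) := by
    refine ⟨hd.1.1.mono_ac ac, ?_⟩
    have h := hd.lintegral_hardyMeasure_le hn Ω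
    rw [lintegral_enorm_sq_eq, lintegral_enorm_sq_eq] at h
    have h2 := h.trans_lt (ENNReal.mul_lt_top ENNReal.ofReal_lt_top (ENNReal.pow_lt_top hd.2.1.2))
    by_contra h4
    rw [not_lt_top_iff] at h4
    simp [h4] at h2
  exact h2.mono_exponent hp

/-- The a priori estimate for `-Δd + (-Δ)^s d = F / |x|² + h`: in the norm of
`L^{α+1}(|x|⁻² dx)`, the solution operator has norm at most `(α+1)² / (α (n-2)²)` with respect to
`F`; the constants with respect to `h`, and those in the gradient bound, do not matter. -/
theorem exists_a_priori_estimate (hn : 3 ≤ n) (hs0 : 0 < s) (hs1 : s < 1) (hΩ : IsOpen Ω)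
    (hΩb : Bornology.IsBounded Ω) (hα0 : 0 < α) (hα1 : α < 1) {m r : ℝ} (hm : 0 < m) (hr : 0 < r)
    (hmα : m⁻¹ + α / (n * (α + 1) / ((n : ℝ) - 2)) = 1)
    (hrα : r⁻¹ = (1 - α) / (2 * (n * (α + 1) / ((n : ℝ) - 2))) + 1 / 2) :
    ∃ C : ℝ≥0∞, C ≠ ⊤ ∧ ∀ (d : Eucl n → ℝ) (D : Eucl n → Eucl n) (F h : Eucl n → ℝ),
      MemSobolevZero 2 Ω d D → MemLp F (ENNReal.ofReal (α + 1)) (hardyMeasure Ω) →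
      MemLp h (ENNReal.ofReal m) (volume.restrict Ω) →
      (∀ v V, MemSobolevZero 2 Ω v V → ENNReal.ofReal (mixedForm s d D v V) ≤
        ∫⁻ x, ‖F x‖ₑ * ‖v x‖ₑ ∂(hardyMeasure Ω) + ∫⁻ x in Ω, ‖h x‖ₑ * ‖v x‖ₑ) →
      eLpNorm d (ENNReal.ofReal (α + 1)) (hardyMeasure Ω) ≤
        ENNReal.ofReal ((α + 1) ^ 2 / (α * ((n : ℝ) - 2) ^ 2)) *
          eLpNorm F (ENNReal.ofReal (α + 1)) (hardyMeasure Ω) +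
        C * eLpNorm h (ENNReal.ofReal m) (volume.restrict Ω) ∧
      eLpNorm D (ENNReal.ofReal r) volume ≤
        C * (eLpNorm F (ENNReal.ofReal (α + 1)) (hardyMeasure Ω) +
          eLpNorm h (ENNReal.ofReal m) (volume.restrict Ω)) := by
  have hn' : (3 : ℝ) ≤ n := by exact_mod_cast hn
  have hn2 : 0 < (n : ℝ) - 2 := by linarith
  obtain ⟨S, hS, sob⟩ := exists_sobolev hn Ω
  set P := n * (α + 1) / ((n : ℝ) - 2) with hPdef
  have hP : 0 < P := by positivity
  set κ := ENNReal.ofReal ((α + 1) ^ 2 / (α * ((n : ℝ) - 2) ^ 2)) with hκ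
  set σ := S ^ 2 * ENNReal.ofReal ((α + 1) ^ 2 / 4) * ENNReal.ofReal (1 / α) with hσ
  set τ := ENNReal.ofReal (1 / α) with hτ
  have κt : κ ≠ ⊤ := ENNReal.ofReal_ne_top
  have τt : τ ≠ ⊤ := ENNReal.ofReal_ne_top
  have σt : σ ≠ ⊤ := ENNReal.mul_ne_top (ENNReal.mul_ne_top (ENNReal.pow_ne_top hS)
    ENNReal.ofReal_ne_top) ENNReal.ofReal_ne_top
  set q := α + 1 with hq
  have hq0 : 0 < q := by positivity
  set C₁ := κ ^ (1 / q) * σ ^ (α / q)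
  set C₂ := (σ ^ (1 / q)) ^ ((1 - α) / 2) * τ ^ (1 / 2 : ℝ)
  have r1 : 0 ≤ 1 / q := by positivity
  have r2 : 0 ≤ α / q := by positivity
  have r3 : 0 ≤ (1 - α) / 2 := by linarith
  have C₁t : C₁ ≠ ⊤ := ENNReal.mul_ne_top (ENNReal.rpow_ne_top_of_nonneg r1 κt)
    (ENNReal.rpow_ne_top_of_nonneg r2 σt)
  have C₂t : C₂ ≠ ⊤ := ENNReal.mul_ne_top (ENNReal.rpow_ne_top_of_nonneg r3
    (ENNReal.rpow_ne_top_of_nonneg r1 σt)) (ENNReal.rpow_ne_top_of_nonneg (by norm_num) τt)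
  refine ⟨C₁ + C₂ * (κ ^ (α / q) + σ ^ (α / q)), ENNReal.add_ne_top.2 ⟨C₁t,
    ENNReal.mul_ne_top C₂t (ENNReal.add_ne_top.2 ⟨ENNReal.rpow_ne_top_of_nonneg r2 κt,
      ENNReal.rpow_ne_top_of_nonneg r2 σt⟩)⟩, fun d D F h hd hF hh hB => ?_⟩
  have ac := (hardyMeasure_absolutelyContinuous Ω).trans
    Measure.restrict_le_self.absolutelyContinuous
  set R := ∫⁻ x, ‖F x‖ₑ * ‖d x‖ₑ ^ α ∂(hardyMeasure Ω) + ∫⁻ x in Ω, ‖h x‖ₑ * ‖d x‖ₑ ^ α with hR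
  have hW (ε : ℝ) (hε : 0 < ε) := hd.lintegral_power_energy_le (R := R) (by omega) hs0 hs1 hα0 hα1
    (fun v V hv hvd => (hB v V hv).trans (by
      have e (x) : ‖v x‖ₑ ≤ ‖d x‖ₑ ^ α := by
        rw [← enorm_abs_rpow _ hα0.le]
        exact enorm_le_iff_norm_le.2 ((hvd x).trans (le_abs_self _))
      exact add_le_add (lintegral_mono fun x => mul_le_mul_right (e x) _)
        (lintegral_mono fun x => mul_le_mul_right (e x) _))) hε
  set A := eLpNorm d (ENNReal.ofReal q) (hardyMeasure Ω) with hA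
  set M := eLpNorm d (ENNReal.ofReal P) volume with hM
  set f := eLpNorm F (ENNReal.ofReal q) (hardyMeasure Ω)
  set η := eLpNorm h (ENNReal.ofReal m) (volume.restrict Ω)
  have hAR : A ^ q ≤ κ * R := by
    have h1 := hd.lintegral_rpow_hardyMeasure_le hn hα0 hα1 hW
    have h2 : A ^ q = ∫⁻ x, ‖d x‖ₑ ^ q ∂(hardyMeasure Ω) := by
      rw [hA, eLpNorm_eq_lintegral_rpow_enorm_toReal (by simpa using hq0) (by simp),
        ENNReal.toReal_ofReal hq0.le, ← ENNReal.rpow_mul, one_div_mul_cancel hq0.ne',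
        ENNReal.rpow_one]
    rw [h2]
    refine h1.trans (le_of_eq ?_)
    rw [← mul_assoc, ← ENNReal.ofReal_mul (by positivity), hκ, hq]
    congr 2
    field_simp
  have hMR : M ^ q ≤ σ * R := by
    have h1 := hd.eLpNorm_rpow_le hn hα0 hα1 hW sob
    rw [← mul_assoc] at h1
    exact h1
  have hol1 : q⁻¹ + α / q = 1 := by rw [hq]; field_simp; ring
  have hRf : R ≤ f * A ^ α + η * M ^ α := by
    refine add_le_add (lintegral_enorm_mul_rpow_le hq0 hq0 hα0 hol1 hF.1 (hd.1.1.mono_ac ac)) ?_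
    refine (lintegral_enorm_mul_rpow_le hm hP hα0 hmα hh.1 hd.1.1.restrict).trans ?_
    refine mul_le_mul_right (ENNReal.rpow_le_rpow ?_ hα0.le) _
    exact eLpNorm_mono_measure _ Measure.restrict_le_self
  have At : A ≠ ⊤ := (hd.memLp_hardyMeasure hn hΩ hΩb (p := ENNReal.ofReal q) (by
    rw [← ENNReal.ofReal_ofNat]; exact ENNReal.ofReal_le_ofReal (by linarith))).2.ne
  have Mt : M ≠ ⊤ := by
    have h1 : MemLp d (ENNReal.ofReal (2 * n / ((n : ℝ) - 2))) volume :=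
      ⟨hd.1.1, (sob d D hd).trans_lt (ENNReal.mul_lt_top hS.lt_top hd.2.1.2)⟩
    refine (memLp_of_ae_eq_zero hΩ hΩb ?_ ?_ h1 (hd.ae_eq_zero hΩ (by simp))).2.ne
    · rw [ENNReal.one_le_ofReal, hPdef, le_div_iff₀ hn2]
      nlinarith
    · refine ENNReal.ofReal_le_ofReal ?_
      rw [hPdef]
      refine div_le_div_of_nonneg_right ?_ hn2.le
      nlinarith
  have Rt : R ≠ ⊤ := ne_top_of_le_ne_top (ENNReal.add_ne_top.2
    ⟨ENNReal.mul_ne_top hF.2.ne (ENNReal.rpow_ne_top_of_nonneg hα0.le At),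
      ENNReal.mul_ne_top hh.2.ne (ENNReal.rpow_ne_top_of_nonneg hα0.le Mt)⟩) hRf
  have hX := rpow_inv_le_of_le_of_le hα0 Rt hAR hMR hRf
  set X := R ^ (1 / q) with hXdef
  have root {B ρ : ℝ≥0∞} (hB : B ^ q ≤ ρ * R) : B ≤ ρ ^ (1 / q) * X := by
    have := ENNReal.rpow_le_rpow hB r1
    rwa [← ENNReal.rpow_mul, mul_one_div_cancel hq0.ne', ENNReal.rpow_one,
      ENNReal.mul_rpow_of_nonneg _ _ r1] at this
  constructor
  · calc A ≤ κ ^ (1 / q) * (f * κ ^ (α / q) + η * σ ^ (α / q)) :=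
          (root hAR).trans (mul_le_mul_right hX _)
      _ = κ ^ (1 / q) * κ ^ (α / q) * f + C₁ * η := by ring
      _ = κ * f + C₁ * η := by
          rw [← ENNReal.rpow_add_of_nonneg _ _ r1 r2, one_div, hol1, ENNReal.rpow_one]
      _ ≤ _ := by gcongr; exact le_self_add
  · have h1 := hd.eLpNorm_gradient_le hα1 hW hP hr hrα
    have h2 : X ^ ((1 - α) / 2) * R ^ (1 / 2 : ℝ) = X := by
      have : R ^ (1 / 2 : ℝ) = X ^ (q / 2) := by
        rw [hXdef, ← ENNReal.rpow_mul]; congr 1; field_simp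
      rw [this, ← ENNReal.rpow_add_of_nonneg _ _ r3 (by positivity),
        show (1 - α) / 2 + q / 2 = 1 by rw [hq]; ring, ENNReal.rpow_one]
    calc eLpNorm D (ENNReal.ofReal r) volume
        ≤ M ^ ((1 - α) / 2) * (τ * R) ^ (1 / 2 : ℝ) := h1
      _ ≤ (σ ^ (1 / q) * X) ^ ((1 - α) / 2) * (τ * R) ^ (1 / 2 : ℝ) := by
          gcongr
          exact root hMR
      _ = C₂ * (X ^ ((1 - α) / 2) * R ^ (1 / 2 : ℝ)) := by
          rw [ENNReal.mul_rpow_of_nonneg (σ ^ (1 / q)) X r3,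
            ENNReal.mul_rpow_of_nonneg τ R (by norm_num : (0 : ℝ) ≤ 1 / 2)]
          simp only [C₂]
          ring
      _ = C₂ * X := by rw [h2]
      _ ≤ C₂ * (f * κ ^ (α / q) + η * σ ^ (α / q)) := mul_le_mul_right hX _
      _ ≤ C₂ * ((κ ^ (α / q) + σ ^ (α / q)) * (f + η)) := by
          refine mul_le_mul_right ?_ _
          rw [add_mul, mul_add, mul_add]
          refine add_le_add ?_ ?_
          · rw [mul_comm]; exact le_self_add
          · rw [mul_comm]; exact le_add_self
      _ = C₂ * (κ ^ (α / q) + σ ^ (α / q)) * (f + η) := by ring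
      _ ≤ _ := by gcongr; exact le_add_self

end APriori

/-! ### Approximating sequences -/

section Approximating

variable {n : ℕ} {Ω : Set (Eucl n)} {s γ m : ℝ}

theorem two_mul_lt_of_lt (hn : 3 ≤ n) (hm2 : m < 2 * (n : ℝ) / ((n : ℝ) + 2)) :
    2 * m < n ∧ m < 2 ∧ m * (n + 2) < 2 * n := by
  have hn' : (3 : ℝ) ≤ n := by exact_mod_cast hn
  rw [lt_div_iff₀ (by linarith)] at hm2
  refine ⟨?_, ?_, hm2⟩ <;> nlinarith

/-- The regularized potential `1 / (|x|² + 1/(k+1))`, multiplied by `|x|²`. -/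
noncomputable def hardyCutoff (k : ℕ) (x : Eucl n) : ℝ := ‖x‖ ^ 2 / (‖x‖ ^ 2 + 1 / ((k : ℝ) + 1))

theorem hardyCutoff_nonneg (k : ℕ) (x : Eucl n) : 0 ≤ hardyCutoff k x := by
  unfold hardyCutoff; positivity

theorem hardyCutoff_le_one (k : ℕ) (x : Eucl n) : hardyCutoff k x ≤ 1 := by
  unfold hardyCutoff
  rw [div_le_one (by positivity)]
  have : 0 < 1 / ((k : ℝ) + 1) := by positivity
  linarith

theorem continuous_hardyCutoff (k : ℕ) : Continuous (hardyCutoff (n := n) k) := by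
  unfold hardyCutoff
  exact (continuous_norm.pow 2).div ((continuous_norm.pow 2).add continuous_const)
    fun x => by positivity

theorem tendsto_hardyCutoff {x : Eucl n} (hx : x ≠ 0) :
    Tendsto (fun k => hardyCutoff k x) atTop (𝓝 1) := by
  have hx' : ‖x‖ ^ 2 ≠ 0 := by simpa using hx
  have h1 := (tendsto_one_div_add_atTop_nhds_zero_nat (𝕜 := ℝ)).const_add (‖x‖ ^ 2)
  rw [add_zero] at h1
  have h2 := (tendsto_const_nhds (x := ‖x‖ ^ 2)).div h1 hx'
  rwa [div_self hx'] at h2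

theorem integrableOn_mul_div_add {w v : Eucl n → ℝ} (hw : MemLp w 2) (hv : MemLp v 2) (k : ℕ) :
    IntegrableOn (fun x => w x * v x / (‖x‖ ^ 2 + 1 / ((k : ℝ) + 1))) Ω := by
  have h1 : Integrable (fun x => w x * v x) := hw.integrable_mul hv
  refine Integrable.integrableOn ?_
  have hc : Continuous fun x : Eucl n => 1 / (‖x‖ ^ 2 + 1 / ((k : ℝ) + 1)) :=
    continuous_const.div ((continuous_norm.pow 2).add continuous_const) fun x => by positivity
  have := h1.mul_bdd (c := (k : ℝ) + 1) hc.aestronglyMeasurable (Eventually.of_forall fun x => ?_)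
  · simpa only [mul_one_div] using this
  · have h0 : 0 < 1 / ((k : ℝ) + 1) := by positivity
    rw [Real.norm_of_nonneg (by positivity), one_div_le (by positivity) (by positivity)]
    have := sq_nonneg ‖x‖
    linarith

theorem MemSobolevZero.integrableOn_mul (hn : 3 ≤ n) {v : Eucl n → ℝ} {V : Eucl n → Eucl n}
    (hv : MemSobolevZero 2 Ω v V) {g : Eucl n → ℝ}
    (hg : MemLp g (ENNReal.ofReal (2 * (n : ℝ) / ((n : ℝ) + 2))) (volume.restrict Ω)) :
    IntegrableOn (fun x => g x * v x) Ω := by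
  have hn' : (3 : ℝ) ≤ n := by exact_mod_cast hn
  have hn2 : 0 < (n : ℝ) - 2 := by linarith
  obtain ⟨S, hS, sob⟩ := exists_sobolev hn Ω
  have h1 : MemLp v (ENNReal.ofReal (2 * n / ((n : ℝ) - 2))) volume :=
    ⟨hv.1.1, (sob v V hv).trans_lt (ENNReal.mul_lt_top hS.lt_top hv.2.1.2)⟩
  have := ENNReal.holderTriple_ofReal (a := 2 * (n : ℝ) / ((n : ℝ) + 2))
    (b := 2 * n / ((n : ℝ) - 2)) (c := 1) (by positivity) (by positivity) one_pos
    (by field_simp; ring)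
  rw [ENNReal.ofReal_one] at this
  exact hg.integrable_mul (h1.restrict Ω)

/-- The equation for the difference of two members of approximating sequences. -/
theorem IsApproximatingSequence.mixedForm_sub (hn : 3 ≤ n) (hs0 : 0 < s) (hs1 : s < 1)
    {g g' : ℕ → Eucl n → ℝ} {w w' : ℕ → Eucl n → ℝ} {W W' : ℕ → Eucl n → Eucl n}
    (hg : ∀ k, MemLp (g k) (ENNReal.ofReal (2 * (n : ℝ) / ((n : ℝ) + 2))) (volume.restrict Ω))
    (hg' : ∀ k, MemLp (g' k) (ENNReal.ofReal (2 * (n : ℝ) / ((n : ℝ) + 2))) (volume.restrict Ω))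
    (h : IsApproximatingSequence s γ Ω g w W) (h' : IsApproximatingSequence s γ Ω g' w' W')
    (k j : ℕ) {v : Eucl n → ℝ} {V : Eucl n → Eucl n} (hv : MemSobolevZero 2 Ω v V) :
    mixedForm s (fun x => w (k + 1) x - w' (j + 1) x) (fun x => W (k + 1) x - W' (j + 1) x) v V =
      (∫ x in Ω, γ * (w k x / (‖x‖ ^ 2 + 1 / ((k : ℝ) + 1)) -
        w' j x / (‖x‖ ^ 2 + 1 / ((j : ℝ) + 1))) * v x) +
      ∫ x in Ω, (g (k + 1) x - g' (j + 1) x) * v x := by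
  have hn1 : 1 ≤ n := by omega
  have hv' := (memX12_iff hn1 hs0 hs1).2 hv
  have hw (k) := (memX12_iff hn1 hs0 hs1).1 (h.2.1 k)
  have hw' (k) := (memX12_iff hn1 hs0 hs1).1 (h'.2.1 k)
  rw [mixedForm_sub_left hn1 hs0 hs1 (hw _) (hw' _) hv, h.2.2 k v V hv', h'.2.2 j v V hv']
  have e1 : ∫ x in Ω, γ * (w k x / (‖x‖ ^ 2 + 1 / ((k : ℝ) + 1)) -
        w' j x / (‖x‖ ^ 2 + 1 / ((j : ℝ) + 1))) * v x =
      γ * ((∫ x in Ω, w k x * v x / (‖x‖ ^ 2 + 1 / ((k : ℝ) + 1))) -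
        ∫ x in Ω, w' j x * v x / (‖x‖ ^ 2 + 1 / ((j : ℝ) + 1))) := by
    rw [← integral_sub (integrableOn_mul_div_add (hw k).1 hv.1 k)
      (integrableOn_mul_div_add (hw' j).1 hv.1 j), ← integral_const_mul]
    congr 1; ext x; ring
  have e2 : ∫ x in Ω, (g (k + 1) x - g' (j + 1) x) * v x =
      (∫ x in Ω, g (k + 1) x * v x) - ∫ x in Ω, g' (j + 1) x * v x := by
    rw [← integral_sub (hv.integrableOn_mul hn (hg _)) (hv.integrableOn_mul hn (hg' _))]
    congr 1; ext x; ring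
  rw [e1, e2]; ring

/-- Existence of approximating sequences with data in `L²(Ω)`. -/
theorem exists_isApproximatingSequence (hn : 3 ≤ n) (hs0 : 0 < s) (hs1 : s < 1) (hΩ : IsOpen Ω)
    (hΩb : Bornology.IsBounded Ω) (γ : ℝ) {g : ℕ → Eucl n → ℝ}
    (hg : ∀ k, MemLp (g k) 2 (volume.restrict Ω)) :
    ∃ w W, IsApproximatingSequence s γ Ω g w W := by
  have hn1 : 1 ≤ n := by omega
  have step (k : ℕ) (p : {p : (Eucl n → ℝ) × (Eucl n → Eucl n) // MemSobolevZero 2 Ω p.1 p.2}) :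
      ∃ p' : {p : (Eucl n → ℝ) × (Eucl n → Eucl n) // MemSobolevZero 2 Ω p.1 p.2},
        ∀ v V, MemSobolevZero 2 Ω v V → mixedForm s p'.1.1 p'.1.2 v V =
          γ * (∫ x in Ω, p.1.1 x * v x / (‖x‖ ^ 2 + 1 / ((k : ℝ) + 1))) +
            ∫ x in Ω, g (k + 1) x * v x := by
    have hc : Continuous fun x : Eucl n => 1 / (‖x‖ ^ 2 + 1 / ((k : ℝ) + 1)) :=
      continuous_const.div ((continuous_norm.pow 2).add continuous_const) fun x => by positivity
    have hF : MemLp (fun x => p.1.1 x * (1 / (‖x‖ ^ 2 + 1 / ((k : ℝ) + 1)))) 2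
        (volume.restrict Ω) := by
      refine MemLp.of_le_mul (c := (k : ℝ) + 1) (p.2.1.restrict Ω)
        ((p.2.1.restrict Ω).1.mul hc.aestronglyMeasurable) (Eventually.of_forall fun x => ?_)
      have h0 : 0 < 1 / ((k : ℝ) + 1) := by positivity
      rw [norm_mul, mul_comm]
      refine mul_le_mul_of_nonneg_right ?_ (norm_nonneg _)
      rw [Real.norm_of_nonneg (by positivity), one_div_le (by positivity) (by positivity)]
      have := sq_nonneg ‖x‖
      linarith
    obtain ⟨u, G, hu, h⟩ := exists_weak_solution hn hs0 hs1 hΩ hΩb ((hF.const_mul γ).add (hg (k + 1)))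
    refine ⟨⟨(u, G), hu⟩, fun v V hv => ?_⟩
    have hi : Integrable (fun x => g (k + 1) x * v x) (volume.restrict Ω) :=
      (hg (k + 1)).integrable_mul (hv.1.restrict Ω)
    rw [h v V hv, ← integral_const_mul, ← integral_add
      ((integrableOn_mul_div_add p.2.1 hv.1 k).const_mul γ) hi]
    congr 1; ext x; simp only [Pi.add_apply]; ring
  choose next hnext using step
  let z : {p : (Eucl n → ℝ) × (Eucl n → Eucl n) // MemSobolevZero 2 Ω p.1 p.2} :=
    ⟨(fun _ => 0, fun _ => 0), MemSobolevZero.zero (by simp)⟩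
  let S (k : ℕ) : {p : (Eucl n → ℝ) × (Eucl n → Eucl n) // MemSobolevZero 2 Ω p.1 p.2} :=
    Nat.rec z next k
  refine ⟨fun k => (S k).1.1, fun k => (S k).1.2, Eventually.of_forall fun x => rfl,
    fun k => (memX12_iff hn1 hs0 hs1).2 (S k).2, fun k v V hv => ?_⟩
  exact hnext k (S k) v V ((memX12_iff hn1 hs0 hs1).1 hv)

/-- A member of an approximating sequence is a supersolution if the data and the preceding member
are nonnegative. -/
theorem IsApproximatingSequence.mixedForm_nonneg (hγ0 : 0 < γ) (hn : 3 ≤ n)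
    (hs0 : 0 < s) (hs1 : s < 1) {g : ℕ → Eucl n → ℝ} {w : ℕ → Eucl n → ℝ}
    {W : ℕ → Eucl n → Eucl n} (h : IsApproximatingSequence s γ Ω g w W) {k : ℕ}
    (hg0 : ∀ᵐ x ∂(volume.restrict Ω), 0 ≤ g (k + 1) x) (hw0 : ∀ᵐ x, 0 ≤ w k x)
    (v : Eucl n → ℝ) (V : Eucl n → Eucl n) (hv : MemSobolevZero 2 Ω v V) (hv0 : ∀ x, 0 ≤ v x) :
    0 ≤ mixedForm s (w (k + 1)) (W (k + 1)) v V := by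
  rw [h.2.2 k v V ((memX12_iff (by omega) hs0 hs1).2 hv)]
  refine add_nonneg (mul_nonneg hγ0.le (integral_nonneg_of_ae ?_)) (integral_nonneg_of_ae ?_)
  · filter_upwards [ae_restrict_of_ae hw0] with x hx
    have := hv0 x
    simp only [Pi.zero_apply]; positivity
  · filter_upwards [hg0] with x hx
    exact mul_nonneg hx (hv0 x)

theorem IsApproximatingSequence.nonneg (hn : 3 ≤ n) (hs0 : 0 < s) (hs1 : s < 1)
    (hΩb : Bornology.IsBounded Ω) (hγ0 : 0 < γ) {g : ℕ → Eucl n → ℝ} {w : ℕ → Eucl n → ℝ}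
    {W : ℕ → Eucl n → Eucl n} (h : IsApproximatingSequence s γ Ω g w W)
    (hg0 : ∀ k, ∀ᵐ x ∂(volume.restrict Ω), 0 ≤ g k x) (k : ℕ) : ∀ᵐ x, 0 ≤ w k x := by
  induction k with
  | zero => filter_upwards [h.1] with x hx using hx.ge
  | succ k ih =>
    exact ((memX12_iff (by omega) hs0 hs1).1 (h.2.1 (k + 1))).nonneg_of_supersolution hn hs0 hs1 hΩb
      (h.mixedForm_nonneg hγ0 hn hs0 hs1 (hg0 _) ih)

theorem IsApproximatingSequence.le_succ (hn : 3 ≤ n) (hs0 : 0 < s) (hs1 : s < 1)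
    (hΩb : Bornology.IsBounded Ω) (hγ0 : 0 < γ) {g : ℕ → Eucl n → ℝ} {w : ℕ → Eucl n → ℝ}
    {W : ℕ → Eucl n → Eucl n}
    (hg : ∀ k, MemLp (g k) (ENNReal.ofReal (2 * (n : ℝ) / ((n : ℝ) + 2))) (volume.restrict Ω))
    (h : IsApproximatingSequence s γ Ω g w W)
    (hg0 : ∀ k, ∀ᵐ x ∂(volume.restrict Ω), 0 ≤ g k x)
    (hgm : ∀ k, ∀ᵐ x ∂(volume.restrict Ω), g k x ≤ g (k + 1) x) (k : ℕ) :
    ∀ᵐ x, w k x ≤ w (k + 1) x := by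
  have pos := h.nonneg hn hs0 hs1 hΩb hγ0 hg0
  have hw (k) := (memX12_iff (by omega) hs0 hs1).1 (h.2.1 k)
  induction k with
  | zero =>
    filter_upwards [h.1, pos 1] with x hx hx1
    rw [hx]; exact hx1
  | succ k ih =>
    have := ((hw (k + 1 + 1)).sub (by simp) (hw (k + 1))).nonneg_of_supersolution hn hs0 hs1 hΩb
      (fun v V hv hv0 => by
        rw [h.mixedForm_sub hn hs0 hs1 hg hg h (k + 1) k hv]
        refine add_nonneg (integral_nonneg_of_ae ?_) (integral_nonneg_of_ae ?_)
        · filter_upwards [ae_restrict_of_ae ih, ae_restrict_of_ae (pos k)] with x hx hx0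
          refine mul_nonneg (mul_nonneg hγ0.le (sub_nonneg.2 ?_)) (hv0 x)
          refine div_le_div₀ (hx0.trans hx) hx (by positivity) ?_
          have : 1 / (((k + 1 : ℕ) : ℝ) + 1) ≤ 1 / ((k : ℝ) + 1) :=
            one_div_le_one_div_of_le (by positivity) (by push_cast; linarith)
          linarith
        · filter_upwards [hgm (k + 1)] with x hx
          exact mul_nonneg (sub_nonneg.2 hx) (hv0 x))
    filter_upwards [this] with x hx using sub_nonneg.1 hx

/-- The a priori estimate for the difference of two members of approximating sequences. The
number `θ` stands for `γ/γ(m)`. -/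
theorem exists_approximation_estimate (hn : 3 ≤ n) (hs0 : 0 < s) (hs1 : s < 1) (hΩ : IsOpen Ω)
    (hΩb : Bornology.IsBounded Ω) (hm1 : 1 < m) (hm2 : m < 2 * (n : ℝ) / ((n : ℝ) + 2))
    (hγ0 : 0 < γ) (hγ : γ < (n : ℝ) * (m - 1) * ((n : ℝ) - 2 * m) / m ^ 2) :
    ∃ q : ℝ≥0∞, 1 ≤ q ∧ q ≤ 2 ∧ ∃ θ C : ℝ≥0∞, θ < 1 ∧ C ≠ ⊤ ∧
      ∀ (g g' : ℕ → Eucl n → ℝ) (w w' : ℕ → Eucl n → ℝ) (W W' : ℕ → Eucl n → Eucl n),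
      (∀ k, MemLp (g k) (ENNReal.ofReal (2 * (n : ℝ) / ((n : ℝ) + 2))) (volume.restrict Ω)) →
      (∀ k, MemLp (g' k) (ENNReal.ofReal (2 * (n : ℝ) / ((n : ℝ) + 2))) (volume.restrict Ω)) →
      IsApproximatingSequence s γ Ω g w W → IsApproximatingSequence s γ Ω g' w' W' → ∀ k j,
      eLpNorm (fun x => w (k + 1) x - w' (j + 1) x) q (hardyMeasure Ω) ≤
        θ * eLpNorm (fun x => hardyCutoff k x * w k x - hardyCutoff j x * w' j x) q
          (hardyMeasure Ω) +
        C * eLpNorm (fun x => g (k + 1) x - g' (j + 1) x) (ENNReal.ofReal m)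
          (volume.restrict Ω) ∧
      eLpNorm (fun x => W (k + 1) x - W' (j + 1) x)
          (ENNReal.ofReal ((n : ℝ) * m / ((n : ℝ) - m))) volume ≤
        C * (eLpNorm (fun x => hardyCutoff k x * w k x - hardyCutoff j x * w' j x) q
            (hardyMeasure Ω) +
          eLpNorm (fun x => g (k + 1) x - g' (j + 1) x) (ENNReal.ofReal m)
            (volume.restrict Ω)) := by
  have hn' : (3 : ℝ) ≤ n := by exact_mod_cast hn
  obtain ⟨hm3, hm4, hm5⟩ := two_mul_lt_of_lt hn hm2
  have p1 : 0 < (n : ℝ) - 2 * m := by linarith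
  have p2 : 0 < m - 1 := by linarith
  have p3 : 0 < (n : ℝ) - 2 := by linarith
  have p4 : 0 < (n : ℝ) - m := by linarith
  have p5 : 0 < m := by linarith
  have p6 := p1.ne'
  have p7 := p4.ne'
  -- The power `α` for which `α + 1 = m (n-2) / (n-2m)`; then `γ(m) = α (n-2)² / (α+1)²`.
  obtain ⟨α, hα⟩ : ∃ α : ℝ, α = (n : ℝ) * (m - 1) / ((n : ℝ) - 2 * m) := ⟨_, rfl⟩
  have hα0 : 0 < α := by rw [hα]; positivity
  have hα1 : α < 1 := by rw [hα, div_lt_one p1]; linarith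
  have hα2 : α * ((n : ℝ) - 2 * m) = n * (m - 1) := by rw [hα, div_mul_cancel₀ _ p6]
  have e : α + 1 = m * ((n : ℝ) - 2) / ((n : ℝ) - 2 * m) := by
    rw [eq_div_iff p6, add_mul, hα2]; ring
  have eP : n * (α + 1) / ((n : ℝ) - 2) = n * m / ((n : ℝ) - 2 * m) := by rw [e]; field_simp
  obtain ⟨C, hC, est⟩ := exists_a_priori_estimate (s := s) (r := (n : ℝ) * m / ((n : ℝ) - m))
    hn hs0 hs1 hΩ hΩb hα0 hα1 p5 (by positivity)
    (by rw [eP, div_div_eq_mul_div, hα2]; field_simp; ring)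
    (by
      have : (1 - α) * ((n : ℝ) - 2 * m) = 2 * n - 2 * m - n * m := by rw [sub_mul, hα2]; ring
      rw [eP, mul_div_assoc', div_div_eq_mul_div, this, inv_div]; field_simp; ring)
  have eθ : (α + 1) ^ 2 / (α * ((n : ℝ) - 2) ^ 2) * γ =
      γ / ((n : ℝ) * (m - 1) * ((n : ℝ) - 2 * m) / m ^ 2) := by
    rw [e, hα]; field_simp
  refine ⟨ENNReal.ofReal (α + 1), by rw [ENNReal.one_le_ofReal]; linarith, by
    rw [← ENNReal.ofReal_ofNat]; exact ENNReal.ofReal_le_ofReal (by linarith),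
    ENNReal.ofReal (γ / ((n : ℝ) * (m - 1) * ((n : ℝ) - 2 * m) / m ^ 2)),
    C * (ENNReal.ofReal γ + 1), ?_, ENNReal.mul_ne_top hC (by simp), ?_⟩
  · rw [ENNReal.ofReal_lt_one, div_lt_one (by positivity)]
    exact hγ
  intro g g' w w' W W' hg hg' h h' k j
  have hw (k) := (memX12_iff (by omega) hs0 hs1).1 (h.2.1 k)
  have hw' (k) := (memX12_iff (by omega) hs0 hs1).1 (h'.2.1 k)
  have q2 : ENNReal.ofReal (α + 1) ≤ 2 := by
    rw [← ENNReal.ofReal_ofNat]; exact ENNReal.ofReal_le_ofReal (by linarith)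
  have cut {w : Eucl n → ℝ} {W : Eucl n → Eucl n} (hw : MemSobolevZero 2 Ω w W) (k : ℕ) :
      MemLp (fun x => hardyCutoff k x * w x) (ENNReal.ofReal (α + 1)) (hardyMeasure Ω) := by
    have hL := hw.memLp_hardyMeasure hn hΩ hΩb q2
    refine hL.of_le ((continuous_hardyCutoff k).aestronglyMeasurable.mul hL.1)
      (Eventually.of_forall fun x => ?_)
    rw [norm_mul, Real.norm_of_nonneg (hardyCutoff_nonneg k x)]
    exact mul_le_of_le_one_left (norm_nonneg _) (hardyCutoff_le_one k x)
  have hF := (cut (hw k) k).sub (cut (hw' j) j)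
  have fin : IsFiniteMeasure (volume.restrict Ω) := ⟨by
    rw [Measure.restrict_apply_univ]; exact hΩb.measure_lt_top⟩
  have hh : MemLp (fun x => g (k + 1) x - g' (j + 1) x) (ENNReal.ofReal m)
      (volume.restrict Ω) :=
    ((hg _).sub (hg' _)).mono_exponent (ENNReal.ofReal_le_ofReal hm2.le)
  have key := est _ _ (fun x => γ * (hardyCutoff k x * w k x - hardyCutoff j x * w' j x))
    (fun x => g (k + 1) x - g' (j + 1) x) ((hw (k + 1)).sub (by simp) (hw' (j + 1)))
    (hF.const_mul γ) hh (fun v V hv => by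
      rw [h.mixedForm_sub hn hs0 hs1 hg hg' h' k j hv]
      refine (ENNReal.ofReal_add_le).trans (add_le_add ?_ ?_)
      · refine (Real.ofReal_le_enorm _).trans ((enorm_integral_le_lintegral_enorm _).trans
          (le_of_eq ?_))
        rw [lintegral_hardyMeasure]
        refine lintegral_congr_ae ?_
        filter_upwards [ae_restrict_of_ae (ae_ne_zero_eucl (n := n) (by omega))] with x hx
        have hx' : 0 < ‖x‖ := norm_pos_iff.2 hx
        rw [← enorm_mul, ← Real.enorm_of_nonneg (by positivity), ← enorm_mul]
        congr 1
        unfold hardyCutoff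
        field_simp
      · refine (Real.ofReal_le_enorm _).trans ((enorm_integral_le_lintegral_enorm _).trans
          (le_of_eq ?_))
        simp_rw [enorm_mul])
  have eF : eLpNorm (fun x => γ * (hardyCutoff k x * w k x - hardyCutoff j x * w' j x))
      (ENNReal.ofReal (α + 1)) (hardyMeasure Ω) = ENNReal.ofReal γ *
      eLpNorm (fun x => hardyCutoff k x * w k x - hardyCutoff j x * w' j x)
        (ENNReal.ofReal (α + 1)) (hardyMeasure Ω) := by
    have := eLpNorm_const_smul (μ := hardyMeasure Ω) (p := ENNReal.ofReal (α + 1)) γ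
      (fun x => hardyCutoff k x * w k x - hardyCutoff j x * w' j x)
    rwa [Real.enorm_of_nonneg hγ0.le] at this
  rw [eF] at key
  refine ⟨key.1.trans ?_, key.2.trans ?_⟩
  · rw [← mul_assoc, ← ENNReal.ofReal_mul (by positivity), eθ, mul_add, mul_one]
    gcongr
    exact le_add_self
  · rw [mul_assoc]
    refine mul_le_mul_right ?_ _
    rw [add_mul, one_mul, mul_add]
    exact add_le_add le_self_add le_add_self

end Approximating

/-! ### Convergence of sequences of functions and of numbers -/

section Convergence

variable {X : Type*} [MeasurableSpace X] {μ : Measure X}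

theorem exists_limit_of_eLpNorm_sub_le {E : Type*} [NormedAddCommGroup E] [CompleteSpace E]
    {p : ℝ≥0∞} (hp : 1 ≤ p) {f : ℕ → X → E} (hf : ∀ k, MemLp (f k) p μ) {c : ℕ → ℝ≥0∞}
    (hc : Tendsto c atTop (𝓝 0))
    (h : ∀ k j, eLpNorm (fun x => f k x - f j x) p μ ≤ c k + c j) :
    ∃ F : X → E, MemLp F p μ ∧
      Tendsto (fun k => eLpNorm (fun x => f k x - F x) p μ) atTop (𝓝 0) := by
  have : Fact (1 ≤ p) := ⟨hp⟩
  have cs : CauchySeq fun k => (hf k).toLp (f k) := by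
    rw [Lp.cauchySeq_Lp_iff_cauchySeq_eLpNorm]
    have h1 : Tendsto (fun q : ℕ × ℕ => c q.1 + c q.2) atTop (𝓝 0) := by
      rw [← prod_atTop_atTop_eq]
      simpa using (hc.comp tendsto_fst).add (hc.comp tendsto_snd)
    refine tendsto_of_tendsto_of_tendsto_of_le_of_le tendsto_const_nhds h1 (fun _ => zero_le)
      fun q => ?_
    refine le_trans (le_of_eq (eLpNorm_congr_ae ?_)) (h q.1 q.2)
    filter_upwards [(hf q.1).coeFn_toLp, (hf q.2).coeFn_toLp] with x h1 h2
    simp [h1, h2]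
  obtain ⟨F, hF⟩ := cauchySeq_tendsto_of_complete cs
  refine ⟨F, Lp.memLp F, ?_⟩
  rw [Lp.tendsto_Lp_iff_tendsto_eLpNorm'] at hF
  refine hF.congr fun k => eLpNorm_congr_ae ?_
  filter_upwards [(hf k).coeFn_toLp] with x h1
  simp [h1]

/-- A nondecreasing sequence of nonnegative functions that is bounded in `L^p` converges almost
everywhere, to a function in `L^p`. -/
theorem exists_memLp_limit_of_monotone {p : ℝ≥0∞} (hp : p ≠ 0) {φ : ℕ → X → ℝ} {M : ℝ≥0∞}
    (hM : M ≠ ⊤) (hφ : ∀ k, AEStronglyMeasurable (φ k) μ) (hb : ∀ k, eLpNorm (φ k) p μ ≤ M)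
    (h : ∀ᵐ x ∂μ, ∀ k, 0 ≤ φ k x ∧ φ k x ≤ φ (k + 1) x) :
    ∃ u : X → ℝ, MemLp u p μ ∧ ∀ᵐ x ∂μ, Tendsto (fun k => φ k x) atTop (𝓝 (u x)) := by
  lift M to NNReal using hM
  have bdd := ae_bdd_liminf_atTop_of_eLpNorm_bdd (R := M) hp
    (fun k => (hφ k).stronglyMeasurable_mk.measurable)
    (fun k => (eLpNorm_congr_ae (hφ k).ae_eq_mk).symm.trans_le (hb k))
  have lim : ∀ᵐ x ∂μ, Tendsto (fun k => φ k x) atTop (𝓝 (⨆ k, φ k x)) := by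
    filter_upwards [bdd, h, ae_all_iff.2 fun k => (hφ k).ae_eq_mk] with x h1 h2 h3
    simp_rw [← h3] at h1
    have mono : Monotone fun k => φ k x := monotone_nat_of_le_succ fun k => (h2 k).2
    have mono' : Monotone fun k => ‖φ k x‖ₑ := fun i j hij => by
      simp only [Real.enorm_of_nonneg (h2 _).1]
      exact ENNReal.ofReal_le_ofReal (mono hij)
    rw [(tendsto_atTop_iSup mono').liminf_eq] at h1
    refine tendsto_atTop_ciSup mono ⟨(⨆ k, ‖φ k x‖ₑ).toReal, ?_⟩
    rintro _ ⟨k, rfl⟩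
    have := ENNReal.toReal_mono h1.ne (le_iSup (fun k => ‖φ k x‖ₑ) k)
    simp only [toReal_enorm] at this
    exact (le_abs_self _).trans this
  refine ⟨fun x => ⨆ k, φ k x, ⟨aestronglyMeasurable_of_tendsto_ae atTop hφ lim, ?_⟩, lim⟩
  refine (Lp.eLpNorm_lim_le_liminf_eLpNorm hφ _ lim).trans_lt ?_
  refine ((liminf_le_liminf (Eventually.of_forall hb)).trans
    (liminf_const (f := (atTop : Filter ℕ)) (M : ℝ≥0∞)).le).trans_lt ENNReal.coe_lt_top

theorem bounded_of_le_mul_add {a : ℕ → ℝ≥0∞} {θ B : ℝ≥0∞} (hθ : θ < 1) (h0 : a 0 = 0)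
    (h : ∀ k, a (k + 1) ≤ θ * a k + B) (k : ℕ) : a k ≤ B / (1 - θ) := by
  have h1 : 1 - θ ≠ 0 := (tsub_pos_of_lt hθ).ne'
  have h2 : 1 - θ ≠ ⊤ := ne_top_of_le_ne_top ENNReal.one_ne_top tsub_le_self
  induction k with
  | zero => rw [h0]; exact zero_le
  | succ k ih =>
    calc a (k + 1) ≤ θ * (B / (1 - θ)) + (1 - θ) * (B / (1 - θ)) := by
          rw [ENNReal.mul_div_cancel h1 h2]
          exact (h k).trans (by gcongr)
      _ = B / (1 - θ) := by rw [← add_mul, add_tsub_cancel_of_le hθ.le, one_mul]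

theorem tendsto_zero_of_le_mul_add {a b : ℕ → ℝ≥0∞} {θ : ℝ≥0∞} (hθ : θ < 1) (ha : ∀ k, a k ≠ ⊤)
    (hb : Tendsto b atTop (𝓝 0)) (h : ∀ k, a (k + 1) ≤ θ * a k + b k) :
    Tendsto a atTop (𝓝 0) := by
  have h1 : 1 - θ ≠ 0 := (tsub_pos_of_lt hθ).ne'
  have h2 : 1 - θ ≠ ⊤ := ne_top_of_le_ne_top ENNReal.one_ne_top tsub_le_self
  rw [ENNReal.tendsto_atTop_zero]
  intro ε hε
  have hε2 : 0 < ε / 2 := ENNReal.half_pos hε.ne'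
  obtain ⟨N, hN⟩ := ENNReal.tendsto_atTop_zero.1 hb ((1 - θ) * (ε / 2))
    (pos_iff_ne_zero.2 (mul_ne_zero h1 hε2.ne'))
  have it (i : ℕ) : a (N + i) ≤ θ ^ i * a N + ε / 2 := by
    induction i with
    | zero => simp
    | succ i ih =>
      calc a (N + i + 1) ≤ θ * (θ ^ i * a N + ε / 2) + (1 - θ) * (ε / 2) :=
            (h _).trans (add_le_add (mul_le_mul_right ih _) (hN _ (Nat.le_add_right _ _)))
        _ = θ ^ (i + 1) * a N + (θ + (1 - θ)) * (ε / 2) := by ring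
        _ = θ ^ (i + 1) * a N + ε / 2 := by rw [add_tsub_cancel_of_le hθ.le, one_mul]
  have lim : Tendsto (fun i => θ ^ i * a N) atTop (𝓝 0) := by
    simpa using ENNReal.Tendsto.mul_const (ENNReal.tendsto_pow_atTop_nhds_zero_of_lt_one hθ)
      (Or.inr (ha N))
  obtain ⟨I, hI⟩ := ENNReal.tendsto_atTop_zero.1 lim (ε / 2) hε2
  refine ⟨N + I, fun k hk => ?_⟩
  obtain ⟨i, rfl⟩ := Nat.exists_eq_add_of_le (le_trans (Nat.le_add_right N I) hk)
  exact (it i).trans ((add_le_add_left (hI i (by omega)) _).trans (ENNReal.add_halves ε).le)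

/-- Truncations of a nonnegative function are bounded, hence integrable to every power. -/
theorem memLp_min_natCast [IsFiniteMeasure μ] {f : X → ℝ} (hf : AEStronglyMeasurable f μ)
    (hf0 : ∀ᵐ x ∂μ, 0 ≤ f x) (p : ℝ≥0∞) (k : ℕ) : MemLp (fun x => min (f x) (k : ℝ)) p μ := by
  refine MemLp.of_bound (hf.inf aestronglyMeasurable_const) k ?_
  filter_upwards [hf0] with x hx
  rw [Real.norm_of_nonneg (le_min hx (Nat.cast_nonneg k))]
  exact min_le_right _ _

theorem tendsto_min_natCast (t : ℝ) : Tendsto (fun k : ℕ => min t (k : ℝ)) atTop (𝓝 t) := by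
  obtain ⟨N, hN⟩ := exists_nat_ge t
  refine tendsto_const_nhds.congr' ?_
  filter_upwards [eventually_ge_atTop N] with k hk
  exact (min_eq_left (hN.trans (by exact_mod_cast hk))).symm

theorem tendsto_eLpNorm_min_natCast_sub {p : ℝ≥0∞} (hp0 : p ≠ 0) (hp : p ≠ ⊤) {f : X → ℝ}
    (hf : MemLp f p μ) (hf0 : ∀ᵐ x ∂μ, 0 ≤ f x) :
    Tendsto (fun k : ℕ => eLpNorm (fun x => min (f x) (k : ℝ) - f x) p μ) atTop (𝓝 0) := by
  refine tendsto_eLpNorm_zero_of_dominated hp0 hp hf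
    (fun k => (hf.1.inf aestronglyMeasurable_const).sub hf.1) (fun k => ?_)
    (Eventually.of_forall fun x => ?_)
  · filter_upwards [hf0] with x hx
    have h1 : 0 ≤ min (f x) (k : ℝ) := le_min hx (Nat.cast_nonneg k)
    have h2 := min_le_left (f x) (k : ℝ)
    rw [Real.norm_eq_abs, abs_le]
    constructor <;> linarith
  · simpa using (tendsto_min_natCast (f x)).sub_const (f x)

end Convergence

/-! ### Passage to the limit in the equation -/

section Limit

variable {n : ℕ} {Ω : Set (Eucl n)} {s γ : ℝ} {f u : Eucl n → ℝ} {G : Eucl n → Eucl n}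
  {φ : ℕ → Eucl n → ℝ} {Φ : ℕ → Eucl n → Eucl n}

theorem integrableOn_div_norm_sq (hu : AEStronglyMeasurable u)
    (h : MemLp u 1 (hardyMeasure Ω)) : IntegrableOn (fun x => u x / ‖x‖ ^ 2) Ω := by
  refine ⟨(hu.aemeasurable.div
    (measurable_norm.pow_const 2).aemeasurable).aestronglyMeasurable.restrict, ?_⟩
  have h1 := h.2
  rw [eLpNorm_one_eq_lintegral_enorm, lintegral_hardyMeasure] at h1
  refine lt_of_le_of_lt (lintegral_mono fun x => ?_) h1
  change ‖u x / ‖x‖ ^ 2‖ₑ ≤ _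
  rw [← mul_one_div (u x), enorm_mul, mul_comm,
    Real.enorm_of_nonneg (by positivity : 0 ≤ 1 / ‖x‖ ^ 2)]

theorem aestronglyMeasurable_nonlocalKernel (hs0 : 0 < s) {v : Eucl n → ℝ}
    (hu : AEStronglyMeasurable u) (hv : AEStronglyMeasurable v) :
    AEStronglyMeasurable (nonlocalKernel s u v) := by
  have : nonlocalKernel s u v = fun q => diffQuot s u q * diffQuot s v q :=
    funext (nonlocalKernel_eq_diffQuot_mul hs0 u v)
  rw [this]
  exact (aestronglyMeasurable_diffQuot hu).mul (aestronglyMeasurable_diffQuot hv)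

/-- The form `ℬ(·, v)` is continuous on `W₀^{1,1}(Ω)` for test functions `v`. -/
theorem tendsto_mixedForm (hn : 1 ≤ n) (hs0 : 0 < s) (hs1 : s < 1) {v : Eucl n → ℝ}
    (hv : IsTestFunction Ω v) (hu : MemSobolevZero 1 Ω u G)
    (hφ : ∀ k, MemSobolevZero 1 Ω (φ k) (Φ k))
    (h1 : Tendsto (fun k => eLpNorm (fun x => φ k x - u x) 1 volume) atTop (𝓝 0))
    (h2 : Tendsto (fun k => eLpNorm (fun x => Φ k x - G x) 1 volume) atTop (𝓝 0)) :
    Integrable (fun x => inner ℝ (G x) (gradient v x)) ∧ Integrable (nonlocalKernel s u v) ∧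
      Tendsto (fun k => mixedForm s (φ k) (Φ k) v (gradient v)) atTop
        (𝓝 (mixedForm s u G v (gradient v))) := by
  obtain ⟨C, hC, nl⟩ := exists_nonlocalKernel_bound hn hs0 hs1 hv
  have int {w : Eucl n → ℝ} {W : Eucl n → Eucl n} (hw : MemSobolevZero 1 Ω w W) :
      Integrable (nonlocalKernel s w v) :=
    ⟨aestronglyMeasurable_nonlocalKernel hs0 hw.1.1 (hv.memLp 1).1,
      (nl Ω w W hw).trans_lt (ENNReal.mul_lt_top hC.lt_top (ENNReal.add_lt_top.2
        ⟨ENNReal.mul_lt_top (by simp) hw.1.2, hw.2.1.2⟩))⟩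
  have loc : Integrable (fun x => inner ℝ (G x) (gradient v x)) :=
    memLp_one_iff_integrable.1
      ((innerSL ℝ).memLp_of_bilin (p := 1) (q := ⊤) 1 hu.2.1 (hv.memLp_gradient ⊤))
  refine ⟨loc, int hu, ?_⟩
  have t1 := tendsto_integral_bilin (innerSL ℝ) (p := 1) (q := ⊤) hu.2.1 (fun k => (hφ k).2.1)
    (hv.memLp_gradient ⊤) h2
  have t2 : Tendsto (fun k => ∫ q, nonlocalKernel s (φ k) v q) atTop
      (𝓝 (∫ q, nonlocalKernel s u v q)) := by
    refine tendsto_integral_of_L1 _ (int hu).1 (Eventually.of_forall fun k => int (hφ k)) ?_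
    have lim : Tendsto (fun k => C * (2 * eLpNorm (fun x => φ k x - u x) 1 volume +
        eLpNorm (fun x => Φ k x - G x) 1 volume)) atTop (𝓝 0) := by
      have := ENNReal.Tendsto.const_mul (a := C)
        ((ENNReal.Tendsto.const_mul (a := 2) h1 (Or.inr (by simp))).add h2) (Or.inr hC)
      simpa using this
    refine tendsto_of_tendsto_of_tendsto_of_le_of_le tendsto_const_nhds lim (fun _ => zero_le)
      fun k => ?_
    refine le_trans (le_of_eq (lintegral_congr fun q => ?_))
      (nl Ω _ _ ((hφ k).sub le_rfl hu))
    congr 1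
    simp only [nonlocalKernel]
    ring
  exact t1.add (t2.const_mul _)

/-- The limit of a nonnegative nondecreasing approximating sequence for the truncations of `f`
is a distributional solution. -/
theorem IsApproximatingSequence.isDistributionalSolution (hn : 3 ≤ n) (hs0 : 0 < s) (hs1 : s < 1)
    (hΩ : IsOpen Ω) (hΩb : Bornology.IsBounded Ω) (hf : IntegrableOn f Ω)
    (hf0 : ∀ᵐ x ∂(volume.restrict Ω), 0 ≤ f x)
    (h : IsApproximatingSequence s γ Ω (fun k x => min (f x) (k : ℝ)) φ Φ)
    (hu0 : ∀ x, x ∉ Ω → u x = 0) (huν : MemLp u 1 (hardyMeasure Ω))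
    (hu : MemSobolevZero 1 Ω u G)
    (hφu : ∀ᵐ x, ∀ k, 0 ≤ φ k x ∧ φ k x ≤ u x)
    (hlim : ∀ᵐ x, Tendsto (fun k => φ k x) atTop (𝓝 (u x)))
    (h1 : Tendsto (fun k => eLpNorm (fun x => φ k x - u x) 1 volume) atTop (𝓝 0))
    (h2 : Tendsto (fun k => eLpNorm (fun x => Φ k x - G x) 1 volume) atTop (𝓝 0)) :
    IsDistributionalSolution s γ Ω f u G := by
  have hn1 : 1 ≤ n := by omega
  have hφ (k) : MemSobolevZero 1 Ω (φ k) (Φ k) :=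
    ((memX12_iff hn1 hs0 hs1).1 (h.2.1 k)).mono_exponent hΩ hΩb le_rfl (by simp)
  have huΩ := integrableOn_div_norm_sq hu.1.1 huν
  refine ⟨Eventually.of_forall hu0, huΩ, fun v hv => ?_⟩
  obtain ⟨B, hB⟩ := hv.2.1.exists_bound_of_continuous hv.1.continuous
  have hvm := hv.1.continuous.aestronglyMeasurable (μ := volume.restrict Ω)
  obtain ⟨i1, i2, lim⟩ := tendsto_mixedForm hn1 hs0 hs1 hv hu hφ h1 h2
  have i3' : IntegrableOn (fun x => u x * v x / ‖x‖ ^ 2) Ω := by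
    refine (huΩ.mul_bdd (c := B) hvm (Eventually.of_forall hB)).congr
      (Eventually.of_forall fun x => ?_)
    simp only []
    ring
  have out : ∀ x, x ∉ Ω → u x * v x / ‖x‖ ^ 2 = 0 := fun x hx => by simp [hu0 x hx]
  have i3 : Integrable (fun x => u x * v x / ‖x‖ ^ 2) :=
    (integrableOn_iff_integrable_of_support_subset fun x hx => by
      by_contra hx'; exact hx (out x hx')).1 i3'
  have i4 : IntegrableOn (fun x => f x * v x) Ω := hf.mul_bdd hvm (Eventually.of_forall hB)
  refine ⟨i1, i2, i3, i4, ?_⟩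
  have e (k) : mixedForm s (φ (k + 1)) (Φ (k + 1)) v (gradient v) =
      γ * (∫ x in Ω, φ k x * v x / (‖x‖ ^ 2 + 1 / ((k : ℝ) + 1))) +
        ∫ x in Ω, min (f x) ((k + 1 : ℕ) : ℝ) * v x :=
    h.2.2 k v _ ((memX12_iff hn1 hs0 hs1).2 (hv.memSobolevZero (by simp)))
  have t1 : Tendsto (fun k : ℕ => ∫ x in Ω, φ k x * v x / (‖x‖ ^ 2 + 1 / ((k : ℝ) + 1))) atTop
      (𝓝 (∫ x in Ω, u x * v x / ‖x‖ ^ 2)) := by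
    refine tendsto_integral_of_dominated_convergence (fun x => ‖u x * v x / ‖x‖ ^ 2‖)
      (fun k => (integrableOn_mul_div_add ((memX12_iff hn1 hs0 hs1).1 (h.2.1 k)).1
        (hv.memLp 2) k).1) i3'.norm (fun k => ?_) ?_
    · filter_upwards [ae_restrict_of_ae hφu, ae_restrict_of_ae (ae_ne_zero_eucl hn1)] with x hx hx0
      have hx' : 0 < ‖x‖ ^ 2 := by have := norm_pos_iff.2 hx0; positivity
      have : 0 < 1 / ((k : ℝ) + 1) := by positivity
      rw [norm_div, norm_div, norm_mul, norm_mul, Real.norm_of_nonneg (hx k).1,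
        Real.norm_of_nonneg ((hx k).1.trans (hx k).2),
        Real.norm_of_nonneg (by positivity : 0 ≤ ‖x‖ ^ 2),
        Real.norm_of_nonneg (by positivity : 0 ≤ ‖x‖ ^ 2 + 1 / ((k : ℝ) + 1))]
      have hux := (hx k).1.trans (hx k).2
      exact div_le_div₀ (by positivity) (mul_le_mul_of_nonneg_right (hx k).2 (norm_nonneg _)) hx'
        (by linarith)
    · filter_upwards [ae_restrict_of_ae hlim, ae_restrict_of_ae (ae_ne_zero_eucl hn1)] with x hx hx0
      have hx' : ‖x‖ ^ 2 ≠ 0 := by simpa using hx0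
      have h3 := (tendsto_one_div_add_atTop_nhds_zero_nat (𝕜 := ℝ)).const_add (‖x‖ ^ 2)
      rw [add_zero] at h3
      exact (hx.mul_const (v x)).div h3 hx'
  have t2 : Tendsto (fun k : ℕ => ∫ x in Ω, min (f x) ((k + 1 : ℕ) : ℝ) * v x) atTop
      (𝓝 (∫ x in Ω, f x * v x)) := by
    refine tendsto_integral_of_dominated_convergence (fun x => ‖f x * v x‖)
      (fun k => (hf.1.inf aestronglyMeasurable_const).mul hvm) i4.norm (fun k => ?_)
      (Eventually.of_forall fun x => ?_)
    · filter_upwards [hf0] with x hx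
      rw [norm_mul, norm_mul, Real.norm_of_nonneg hx,
        Real.norm_of_nonneg (le_min hx (Nat.cast_nonneg _))]
      exact mul_le_mul_of_nonneg_right (min_le_left _ _) (norm_nonneg _)
    · exact ((tendsto_add_atTop_iff_nat 1).2 (tendsto_min_natCast (f x))).mul_const (v x)
  have := tendsto_nhds_unique ((tendsto_add_atTop_iff_nat 1).2 lim)
    (((t1.const_mul γ).add t2).congr fun k => (e k).symm)
  rw [this, setIntegral_eq_integral_of_forall_compl_eq_zero out]
  ring

end Limit

/-! ### Limits of approximating sequences -/

section SOLA

variable {n : ℕ} {Ω : Set (Eucl n)} {s γ m : ℝ} {f : Eucl n → ℝ}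
  {φ : ℕ → Eucl n → ℝ} {Φ : ℕ → Eucl n → Eucl n}

theorem eLpNorm_sub_le_add {X E : Type*} [MeasurableSpace X] {μ : Measure X}
    [NormedAddCommGroup E] {p : ℝ≥0∞} (hp : 1 ≤ p) {a b c : X → E}
    (ha : AEStronglyMeasurable a μ) (hb : AEStronglyMeasurable b μ)
    (hc : AEStronglyMeasurable c μ) :
    eLpNorm (fun x => a x - b x) p μ ≤
      eLpNorm (fun x => a x - c x) p μ + eLpNorm (fun x => b x - c x) p μ := by
  refine le_trans (le_of_eq ?_) (eLpNorm_sub_le (ha.sub hc) (hb.sub hc) hp)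
  congr 1; ext x; simp

theorem eLpNorm_hardyCutoff_mul_le (k : ℕ) (w : Eucl n → ℝ) (p : ℝ≥0∞) (μ : Measure (Eucl n)) :
    eLpNorm (fun x => hardyCutoff k x * w x) p μ ≤ eLpNorm w p μ := by
  refine eLpNorm_mono fun x => ?_
  rw [norm_mul, Real.norm_of_nonneg (hardyCutoff_nonneg k x)]
  exact mul_le_of_le_one_left (norm_nonneg _) (hardyCutoff_le_one k x)

theorem isApproximatingSequence_zero (hn : 1 ≤ n) (hs0 : 0 < s) (hs1 : s < 1) (γ : ℝ) :
    IsApproximatingSequence s γ Ω (fun _ _ => 0) (fun _ _ => 0) (fun _ _ => 0) := by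
  refine ⟨Eventually.of_forall fun x => rfl,
    fun k => (memX12_iff hn hs0 hs1).2 (MemSobolevZero.zero (by simp)), fun k v V hv => ?_⟩
  simp [mixedForm, nonlocalKernel]

theorem sobolev_exponent_bounds (hn : 3 ≤ n) (hm1 : 1 < m)
    (hm2 : m < 2 * (n : ℝ) / ((n : ℝ) + 2)) :
    1 < (n : ℝ) * m / ((n : ℝ) - m) ∧ (n : ℝ) * m / ((n : ℝ) - m) ≤ 2 := by
  have hn' : (3 : ℝ) ≤ n := by exact_mod_cast hn
  obtain ⟨h1, h2, h3⟩ := two_mul_lt_of_lt hn hm2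
  have h4 : 0 < (n : ℝ) - m := by linarith
  rw [lt_div_iff₀ h4, div_le_iff₀ h4]
  constructor <;> nlinarith

/-- The solutions of the regularized problems for the truncations of `f` increase to a function
`u`; they converge strongly to `u` in `W₀^{1,m*}(Ω)`. -/
theorem IsApproximatingSequence.exists_limit (hn : 3 ≤ n) (hs0 : 0 < s) (hs1 : s < 1)
    (hΩ : IsOpen Ω) (hΩb : Bornology.IsBounded Ω) (hm1 : 1 < m)
    (hm2 : m < 2 * (n : ℝ) / ((n : ℝ) + 2))
    (hf : MemLp f (ENNReal.ofReal m) (volume.restrict Ω))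
    (hf0 : ∀ᵐ x ∂(volume.restrict Ω), 0 ≤ f x)
    (hγ0 : 0 < γ) (hγ : γ < (n : ℝ) * (m - 1) * ((n : ℝ) - 2 * m) / m ^ 2)
    (h : IsApproximatingSequence s γ Ω (fun k x => min (f x) (k : ℝ)) φ Φ) :
    ∃ (u : Eucl n → ℝ) (G : Eucl n → Eucl n), (∀ x, x ∉ Ω → u x = 0) ∧
      MemLp u 1 (hardyMeasure Ω) ∧
      MemSobolevZero (ENNReal.ofReal ((n : ℝ) * m / ((n : ℝ) - m))) Ω u G ∧
      (∀ᵐ x, ∀ k, 0 ≤ φ k x ∧ φ k x ≤ φ (k + 1) x ∧ φ k x ≤ u x) ∧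
      (∀ᵐ x, Tendsto (fun k => φ k x) atTop (𝓝 (u x))) ∧
      Tendsto (fun k => eLpNorm (fun x => φ k x - u x)
        (ENNReal.ofReal ((n : ℝ) * m / ((n : ℝ) - m))) volume) atTop (𝓝 0) ∧
      Tendsto (fun k => eLpNorm (fun x => Φ k x - G x)
        (ENNReal.ofReal ((n : ℝ) * m / ((n : ℝ) - m))) volume) atTop (𝓝 0) := by
  have hn1 : 1 ≤ n := by omega
  have hn' : (3 : ℝ) ≤ n := by exact_mod_cast hn
  obtain ⟨hr1, hr2⟩ := sobolev_exponent_bounds hn hm1 hm2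
  set r := (n : ℝ) * m / ((n : ℝ) - m)
  have hr1' : 1 ≤ ENNReal.ofReal r := ENNReal.one_le_ofReal.2 hr1.le
  have hr2' : ENNReal.ofReal r ≤ 2 := by
    rw [← ENNReal.ofReal_ofNat]; exact ENNReal.ofReal_le_ofReal hr2
  have hm1' : 1 ≤ ENNReal.ofReal m := ENNReal.one_le_ofReal.2 hm1.le
  have fin : IsFiniteMeasure (volume.restrict Ω) :=
    ⟨by rw [Measure.restrict_apply_univ]; exact hΩb.measure_lt_top⟩
  have fin' := isFiniteMeasure_hardyMeasure hn hΩ hΩb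
  obtain ⟨q, hq1, hq2, θ, C, hθ, hC, est⟩ :=
    exists_approximation_estimate hn hs0 hs1 hΩ hΩb hm1 hm2 hγ0 hγ
  have hg (k : ℕ) := memLp_min_natCast hf.1 hf0 (ENNReal.ofReal (2 * (n : ℝ) / ((n : ℝ) + 2))) k
  have hg0 (k : ℕ) : ∀ᵐ x ∂(volume.restrict Ω), 0 ≤ min (f x) (k : ℝ) := by
    filter_upwards [hf0] with x hx using le_min hx (Nat.cast_nonneg k)
  have hφ2 (k) := (memX12_iff hn1 hs0 hs1).1 (h.2.1 k)
  have pos := h.nonneg hn hs0 hs1 hΩb hγ0 hg0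
  have mono := h.le_succ hn hs0 hs1 hΩb hγ0 hg hg0 fun k => Eventually.of_forall fun x =>
    min_le_min_left _ (by push_cast; linarith)
  have ac := (hardyMeasure_absolutelyContinuous Ω).trans
    Measure.restrict_le_self.absolutelyContinuous
  have both : ∀ᵐ x, ∀ k, 0 ≤ φ k x ∧ φ k x ≤ φ (k + 1) x := by
    filter_upwards [ae_all_iff.2 pos, ae_all_iff.2 mono] with x h1 h2 k using ⟨h1 k, h2 k⟩
  have bound : ∀ k, eLpNorm (φ k) q (hardyMeasure Ω) ≤
      C * eLpNorm f (ENNReal.ofReal m) (volume.restrict Ω) / (1 - θ) := by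
    refine bounded_of_le_mul_add hθ ?_ fun k => ?_
    · rw [eLpNorm_congr_ae (ac.ae_eq h.1), eLpNorm_zero]
    · have := (est _ _ φ _ Φ _ hg (fun _ => MemLp.zero) h (isApproximatingSequence_zero hn1 hs0 hs1 γ)
        k k).1
      simp only [mul_zero, sub_zero] at this
      refine this.trans (add_le_add (mul_le_mul_right (eLpNorm_hardyCutoff_mul_le ..) _)
        (mul_le_mul_right ?_ _))
      refine eLpNorm_mono_ae ?_
      filter_upwards [hf0] with x hx
      rw [Pi.zero_apply, sub_zero, Real.norm_of_nonneg hx, Real.norm_of_nonneg (le_min hx (Nat.cast_nonneg _))]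
      exact min_le_left _ _
  have bt : C * eLpNorm f (ENNReal.ofReal m) (volume.restrict Ω) / (1 - θ) ≠ ⊤ :=
    ENNReal.div_ne_top (ENNReal.mul_ne_top hC hf.2.ne) (tsub_pos_of_lt hθ).ne'
  obtain ⟨u₀, hu₀, lim₀⟩ := exists_memLp_limit_of_monotone (one_pos.trans_le hq1).ne' bt
    (fun k => (hφ2 k).1.1.mono_ac ac) bound (ac.ae_le both)
  let u := Ω.indicator u₀
  have hu0 (x) (hx : x ∉ Ω) : u x = 0 := Set.indicator_of_notMem hx _
  have lim : ∀ᵐ x, Tendsto (fun k => φ k x) atTop (𝓝 (u x)) := by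
    have l1 := (ae_restrict_iff' hΩ.measurableSet).1
      ((absolutelyContinuous_hardyMeasure hn1 Ω).ae_le lim₀)
    filter_upwards [l1, ae_all_iff.2 fun k => (hφ2 k).ae_eq_zero hΩ (by simp)] with x hx1 hx2
    by_cases hx : x ∈ Ω
    · simpa only [u, Set.indicator_of_mem hx] using hx1 hx
    · rw [hu0 x hx]
      exact tendsto_const_nhds.congr fun k => (hx2 k hx).symm
  have all : ∀ᵐ x, ∀ k, 0 ≤ φ k x ∧ φ k x ≤ φ (k + 1) x ∧ φ k x ≤ u x := by
    filter_upwards [both, lim] with x h1 h2 k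
    exact ⟨(h1 k).1, (h1 k).2, (monotone_nat_of_le_succ fun k => (h1 k).2).ge_of_tendsto h2 k⟩
  have um : AEStronglyMeasurable u volume :=
    aestronglyMeasurable_of_tendsto_ae atTop (fun k => (hφ2 k).1.1) lim
  have huν : MemLp u q (hardyMeasure Ω) := by
    refine (memLp_congr_ae ?_).1 hu₀
    filter_upwards [lim₀, ac.ae_le lim] with x h1 h2 using tendsto_nhds_unique h1 h2
  -- The right-hand sides of the equations converge.
  have c0 : Tendsto (fun k => eLpNorm (fun x => hardyCutoff k x * φ k x - u x) q (hardyMeasure Ω))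
      atTop (𝓝 0) := by
    refine tendsto_eLpNorm_zero_of_dominated (one_pos.trans_le hq1).ne'
      (ne_top_of_le_ne_top (by simp) hq2) huν (fun k => ?_) (fun k => ?_) ?_
    · exact ((continuous_hardyCutoff k).aestronglyMeasurable.mul
        ((hφ2 k).1.1.mono_ac ac)).sub huν.1
    · filter_upwards [ac.ae_le all] with x hx
      have h1 := mul_nonneg (hardyCutoff_nonneg k x) (hx k).1
      have h2 := (mul_le_of_le_one_left (hx k).1 (hardyCutoff_le_one k x)).trans (hx k).2.2
      rw [Real.norm_eq_abs, abs_le]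
      constructor <;> linarith
    · filter_upwards [ac.ae_le lim, ac.ae_le (ae_ne_zero_eucl hn1)] with x h1 h2
      simpa using ((tendsto_hardyCutoff h2).mul h1).sub_const (u x)
  have b0 := (tendsto_add_atTop_iff_nat 1).2 (tendsto_eLpNorm_min_natCast_sub
    (one_pos.trans_le hm1').ne' ENNReal.ofReal_ne_top hf hf0)
  set c : ℕ → ℝ≥0∞ := fun k =>
    eLpNorm (fun x => hardyCutoff k x * φ k x - u x) q (hardyMeasure Ω) +
      eLpNorm (fun x => min (f x) ((k + 1 : ℕ) : ℝ) - f x) (ENNReal.ofReal m) (volume.restrict Ω)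
    with hc
  have c1 : Tendsto c atTop (𝓝 0) := by
    have := c0.add b0
    rwa [add_zero] at this
  have grad (k j) : eLpNorm (fun x => Φ (k + 1) x - Φ (j + 1) x) (ENNReal.ofReal r) volume ≤
      C * c k + C * c j := by
    refine ((est _ _ φ φ Φ Φ hg hg h h k j).2).trans ?_
    rw [← mul_add]
    refine mul_le_mul_right ?_ _
    have m1 (k) : AEStronglyMeasurable (fun x => hardyCutoff k x * φ k x) (hardyMeasure Ω) :=
      (continuous_hardyCutoff k).aestronglyMeasurable.mul ((hφ2 k).1.1.mono_ac ac)
    refine (add_le_add (eLpNorm_sub_le_add hq1 (m1 k) (m1 j) huν.1)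
      (eLpNorm_sub_le_add hm1' (hg (k + 1)).1 (hg (j + 1)).1 hf.1)).trans (le_of_eq ?_)
    simp only [hc]
    ring
  have hφr (k) : MemSobolevZero (ENNReal.ofReal r) Ω (φ k) (Φ k) :=
    (hφ2 k).mono_exponent hΩ hΩb hr1' hr2'
  obtain ⟨P, hP, poin⟩ := exists_poincare hΩb hr1.le (show r < n by linarith)
  have lim1 : Tendsto (fun k => C * c k) atTop (𝓝 0) := by
    simpa using ENNReal.Tendsto.const_mul c1 (Or.inr hC)
  have lim2 : Tendsto (fun k => P * (C * c k)) atTop (𝓝 0) := by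
    simpa using ENNReal.Tendsto.const_mul lim1 (Or.inr hP)
  obtain ⟨G, hG, tG⟩ := exists_limit_of_eLpNorm_sub_le hr1' (fun k => (hφr (k + 1)).2.1) lim1 grad
  obtain ⟨U, hU, tU⟩ := exists_limit_of_eLpNorm_sub_le hr1' (fun k => (hφr (k + 1)).1) lim2
    fun k j => by
      rw [← mul_add]
      exact (poin _ _ ((hφr (k + 1)).sub hr1' (hφr (j + 1)))).trans (mul_le_mul_right (grad k j) _)
  have hUu : U =ᵐ[volume] u := by
    obtain ⟨σ, hσ, ae⟩ := exists_subseq_tendsto_ae (one_pos.trans_le hr1').ne'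
      (fun k => (hφr (k + 1)).1.1) hU.1 tU
    filter_upwards [ae, lim] with x h1 h2
    exact tendsto_nhds_unique h1
      (((tendsto_add_atTop_iff_nat 1).2 h2).comp hσ.tendsto_atTop)
  have tu : Tendsto (fun k => eLpNorm (fun x => φ (k + 1) x - u x) (ENNReal.ofReal r) volume)
      atTop (𝓝 0) := by
    refine tU.congr fun k => eLpNorm_congr_ae ?_
    filter_upwards [hUu] with x hx
    rw [hx]
  have hu : MemSobolevZero (ENNReal.ofReal r) Ω u G :=
    MemSobolevZero.of_tendsto hr1' (fun k => hφr (k + 1)) ((memLp_congr_ae hUu).1 hU) hG tu tG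
  exact ⟨u, G, hu0, huν.mono_exponent hq1, hu, all, lim,
    (tendsto_add_atTop_iff_nat (f := fun k => eLpNorm (fun x => φ k x - u x)
      (ENNReal.ofReal r) volume) 1).1 tu,
    (tendsto_add_atTop_iff_nat (f := fun k => eLpNorm (fun x => Φ k x - G x)
      (ENNReal.ofReal r) volume) 1).1 tG⟩

/-- All limits of approximations agree: the solutions of the regularized problems for two
sequences of data with the same limit in `L^m(Ω)` approach each other. -/
theorem IsLimitOfApproximations.ae_eq (hn : 3 ≤ n) (hs0 : 0 < s) (hs1 : s < 1)
    (hΩ : IsOpen Ω) (hΩb : Bornology.IsBounded Ω) (hm1 : 1 < m)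
    (hm2 : m < 2 * (n : ℝ) / ((n : ℝ) + 2))
    (hf : MemLp f (ENNReal.ofReal m) (volume.restrict Ω))
    (hf0 : ∀ᵐ x ∂(volume.restrict Ω), 0 ≤ f x)
    (hγ0 : 0 < γ) (hγ : γ < (n : ℝ) * (m - 1) * ((n : ℝ) - 2 * m) / m ^ 2)
    (h : IsApproximatingSequence s γ Ω (fun k x => min (f x) (k : ℝ)) φ Φ) {u w : Eucl n → ℝ}
    (hlim : ∀ᵐ x ∂(volume.restrict Ω), Tendsto (fun k => φ k x) atTop (𝓝 (u x)))
    (hw : IsLimitOfApproximations s γ m Ω f w) : w =ᵐ[volume.restrict Ω] u := by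
  have hn1 : 1 ≤ n := by omega
  have hm1' : 1 ≤ ENNReal.ofReal m := ENNReal.one_le_ofReal.2 hm1.le
  have fin : IsFiniteMeasure (volume.restrict Ω) :=
    ⟨by rw [Measure.restrict_apply_univ]; exact hΩb.measure_lt_top⟩
  obtain ⟨q, hq1, hq2, θ, C, hθ, hC, est⟩ :=
    exists_approximation_estimate hn hs0 hs1 hΩ hΩb hm1 hm2 hγ0 hγ
  obtain ⟨g, wk, Wk, σ, hg, hgf, hwk, hσ, hwlim⟩ := hw
  have ht (k : ℕ) := memLp_min_natCast hf.1 hf0 (ENNReal.ofReal (2 * (n : ℝ) / ((n : ℝ) + 2))) k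
  have hφ2 (k) := (memX12_iff hn1 hs0 hs1).1 (h.2.1 k)
  have hw2 (k) := (memX12_iff hn1 hs0 hs1).1 (hwk.2.1 k)
  have hd (k) : MemLp (fun x => wk k x - φ k x) q (hardyMeasure Ω) :=
    ((hw2 k).sub (by simp) (hφ2 k)).memLp_hardyMeasure hn hΩ hΩb hq2
  have data : Tendsto (fun k : ℕ => C * (eLpNorm (fun x => g (k + 1) x - f x) (ENNReal.ofReal m)
      (volume.restrict Ω) + eLpNorm (fun x => min (f x) ((k + 1 : ℕ) : ℝ) - f x) (ENNReal.ofReal m)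
      (volume.restrict Ω))) atTop (𝓝 0) := by
    have h1 := (tendsto_add_atTop_iff_nat 1).2 hgf
    have h2 := (tendsto_add_atTop_iff_nat 1).2 (tendsto_eLpNorm_min_natCast_sub
      (one_pos.trans_le hm1').ne' ENNReal.ofReal_ne_top hf hf0)
    simpa using ENNReal.Tendsto.const_mul (h1.add h2) (Or.inr hC)
  have conv := tendsto_zero_of_le_mul_add hθ (fun k => (hd k).2.ne) data fun k => by
    refine (est _ _ wk φ Wk Φ hg ht hwk h k k).1.trans ?_
    refine add_le_add (mul_le_mul_right ?_ _) (mul_le_mul_right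
      (eLpNorm_sub_le_add hm1' (hg (k + 1)).1 (ht (k + 1)).1 hf.1) _)
    simp_rw [← mul_sub]
    exact eLpNorm_hardyCutoff_mul_le ..
  obtain ⟨τ, hτ, ae⟩ := exists_subseq_tendsto_ae (one_pos.trans_le hq1).ne'
    (f := fun _ => (0 : ℝ)) (fj := fun j x => wk (σ j) x - φ (σ j) x) (fun j => (hd (σ j)).1)
    aestronglyMeasurable_const (by simp only [sub_zero]; exact conv.comp hσ.tendsto_atTop)
  filter_upwards [(absolutelyContinuous_hardyMeasure hn1 Ω).ae_le ae, hwlim, hlim] with x h1 h2 h3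
  have h4 := (h2.comp hτ.tendsto_atTop).sub (h3.comp (hσ.comp hτ).tendsto_atTop)
  exact sub_eq_zero.1 (tendsto_nhds_unique h4 h1)

theorem ENNReal.holderConjugate_ofReal_div_sub_one {r : ℝ} (hr : 1 < r) :
    (ENNReal.ofReal r).HolderConjugate (ENNReal.ofReal (r / (r - 1))) := by
  have h0 : r ≠ 0 := by linarith
  have := ENNReal.holderTriple_ofReal (a := r) (b := r / (r - 1)) (c := 1) (by linarith)
    (div_pos (by linarith) (by linarith)) one_pos
    (by rw [inv_div, inv_eq_one_div, ← add_div, add_sub_cancel, div_self h0, inv_one])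
  rwa [ENNReal.ofReal_one] at this

theorem TendstoWeaklySobolevZero.of_tendsto {r : ℝ} (hr : 1 < r) {u : Eucl n → ℝ}
    {G : Eucl n → Eucl n} (hφ : ∀ k, MemSobolevZero (ENNReal.ofReal r) Ω (φ k) (Φ k))
    (hu : MemSobolevZero (ENNReal.ofReal r) Ω u G)
    (t1 : Tendsto (fun k => eLpNorm (fun x => φ k x - u x) (ENNReal.ofReal r) volume) atTop (𝓝 0))
    (t2 : Tendsto (fun k => eLpNorm (fun x => Φ k x - G x) (ENNReal.ofReal r) volume) atTop
      (𝓝 0)) : TendstoWeaklySobolevZero r Ω φ Φ u G := by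
  have := ENNReal.holderConjugate_ofReal_div_sub_one hr
  exact ⟨hφ, hu,
    fun H hH => tendsto_integral_bilin (ContinuousLinearMap.mul ℝ ℝ) hu.1 (fun k => (hφ k).1) hH t1,
    fun H hH => tendsto_integral_bilin (innerSL ℝ) hu.2.1 (fun k => (hφ k).2.1) hH t2⟩

/-- The first approximation is nontrivial if its datum is. -/
theorem IsApproximatingSequence.eq_zero_of_eq_zero (hn : 3 ≤ n) (hs0 : 0 < s) (hs1 : s < 1)
    (hΩ : IsOpen Ω) (hΩb : Bornology.IsBounded Ω) {g : ℕ → Eucl n → ℝ}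
    (h : IsApproximatingSequence s γ Ω g φ Φ) (hg : MemLp (g 1) 1 (volume.restrict Ω))
    (h0 : φ 1 =ᵐ[volume] 0) : g 1 =ᵐ[volume.restrict Ω] 0 := by
  have hn1 : 1 ≤ n := by omega
  have h2 := (memX12_iff hn1 hs0 hs1).1 (h.2.1 1)
  have hΦ : Φ 1 =ᵐ[volume] 0 := by
    filter_upwards [h2.gradient_eq_zero_of_eq_zero (by simp) (by simp), h0] with x h1 h3
    exact h1 h3
  have key := hΩ.ae_eq_zero_of_integral_contDiff_smul_eq_zero (μ := volume.restrict Ω) (f := g 1)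
    ((memLp_one_iff_integrable.1 hg).locallyIntegrable.locallyIntegrableOn Ω)
    fun v hv hvc hvs => by
      have tv : IsTestFunction Ω v := ⟨hv, hvc, hvs⟩
      have eq := h.2.2 0 v _ ((memX12_iff hn1 hs0 hs1).2 (tv.memSobolevZero (by simp)))
      have z1 : ∫ x, inner ℝ (Φ (0 + 1) x) (gradient v x) = 0 :=
        integral_eq_zero_of_ae (by filter_upwards [hΦ] with x hx; simp [hx])
      have z2 : ∫ q, nonlocalKernel s (φ (0 + 1)) v q = 0 := by
        obtain ⟨C, hC, nl⟩ := exists_nonlocalKernel_bound hn1 hs0 hs1 tv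
        have := nl Ω _ _ (h2.mono_exponent hΩ hΩb le_rfl (by simp))
        rw [eLpNorm_congr_ae h0, eLpNorm_congr_ae hΦ, eLpNorm_zero, eLpNorm_zero, mul_zero,
          add_zero, mul_zero] at this
        exact enorm_eq_zero.1 (le_antisymm ((enorm_integral_le_lintegral_enorm _).trans this)
          zero_le)
      have z3 : ∫ x in Ω, φ 0 x * v x / (‖x‖ ^ 2 + 1 / (((0 : ℕ) : ℝ) + 1)) = 0 :=
        integral_eq_zero_of_ae (by
          filter_upwards [ae_restrict_of_ae h.1] with x hx
          simp [hx])
      rw [mixedForm, z1, z2, z3, mul_zero, mul_zero, add_zero, zero_add] at eq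
      refine Eq.trans ?_ eq.symm
      congr 1; ext x; rw [smul_eq_mul, mul_comm]
  filter_upwards [key, ae_restrict_mem hΩ.measurableSet] with x h1 h3 using h1 h3

end SOLA

theorem theorem1p4 (n : ℕ) (hn : 3 ≤ n) (s : ℝ) (hs0 : 0 < s) (hs1 : s < 1)
    (Ω : Set (Eucl n)) (hΩ : IsOpen Ω) (hΩb : Bornology.IsBounded Ω) (h0 : (0 : Eucl n) ∈ Ω)
    (m : ℝ) (hm1 : 1 < m) (hm2 : m < 2 * (n : ℝ) / ((n : ℝ) + 2))
    (f : Eucl n → ℝ) (hf : MemLp f (ENNReal.ofReal m) (volume.restrict Ω))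
    (hf0 : ∀ᵐ x ∂(volume.restrict Ω), 0 ≤ f x) (hfne : ¬ f =ᵐ[volume.restrict Ω] 0)
    (γ : ℝ) (hγ0 : 0 < γ) (hγ : γ < (n : ℝ) * (m - 1) * ((n : ℝ) - 2 * m) / m ^ 2) :
    ∃ (u : Eucl n → ℝ) (G : Eucl n → Eucl n),
      MemSobolevZero (ENNReal.ofReal ((n : ℝ) * m / ((n : ℝ) - m))) Ω u G ∧
      (∀ᵐ x ∂(volume.restrict Ω), 0 < u x) ∧
      IsDistributionalSolution s γ Ω f u G ∧
      (∃ (φ : ℕ → Eucl n → ℝ) (Φ : ℕ → Eucl n → Eucl n),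
        IsApproximatingSequence s γ Ω (fun k x => min (f x) (k : ℝ)) φ Φ ∧
        (∀ᵐ x ∂(volume.restrict Ω), ∀ k, 0 ≤ φ k x ∧ φ k x ≤ φ (k + 1) x) ∧
        (∀ᵐ x ∂(volume.restrict Ω), Tendsto (fun k => φ k x) atTop (𝓝 (u x))) ∧
        TendstoWeaklySobolevZero ((n : ℝ) * m / ((n : ℝ) - m)) Ω φ Φ u G ∧
        Tendsto (fun k => eLpNorm (fun x => φ k x / ‖x‖ ^ 2 - u x / ‖x‖ ^ 2) 1
          (volume.restrict Ω)) atTop (𝓝 0)) ∧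
      ∀ w : Eucl n → ℝ, IsLimitOfApproximations s γ m Ω f w → w =ᵐ[volume.restrict Ω] u := by
  have hn1 : 1 ≤ n := by omega
  obtain ⟨hr1, hr2⟩ := sobolev_exponent_bounds hn hm1 hm2
  have hr1' : 1 ≤ ENNReal.ofReal ((n : ℝ) * m / ((n : ℝ) - m)) := ENNReal.one_le_ofReal.2 hr1.le
  have hr2' : ENNReal.ofReal ((n : ℝ) * m / ((n : ℝ) - m)) ≤ 2 := by
    rw [← ENNReal.ofReal_ofNat]; exact ENNReal.ofReal_le_ofReal hr2
  have fin : IsFiniteMeasure (volume.restrict Ω) :=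
    ⟨by rw [Measure.restrict_apply_univ]; exact hΩb.measure_lt_top⟩
  have hg0 (k : ℕ) : ∀ᵐ x ∂(volume.restrict Ω), 0 ≤ min (f x) (k : ℝ) := by
    filter_upwards [hf0] with x hx using le_min hx (Nat.cast_nonneg k)
  obtain ⟨φ, Φ, h⟩ := exists_isApproximatingSequence hn hs0 hs1 hΩ hΩb γ
    (memLp_min_natCast hf.1 hf0 2)
  obtain ⟨u, G, hu0, huν, hu, all, lim, t1, t2⟩ :=
    h.exists_limit hn hs0 hs1 hΩ hΩb hm1 hm2 hf hf0 hγ0 hγ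
  have hφ2 (k) := (memX12_iff hn1 hs0 hs1).1 (h.2.1 k)
  have hφ (k) : MemSobolevZero (ENNReal.ofReal ((n : ℝ) * m / ((n : ℝ) - m))) Ω (φ k) (Φ k) :=
    (hφ2 k).mono_exponent hΩ hΩb hr1' hr2'
  have to_one {E : Type} [NormedAddCommGroup E] {a : ℕ → Eucl n → E} (ha : ∀ k,
      AEStronglyMeasurable (a k)) (ha0 : ∀ k, ∀ᵐ x, x ∉ Ω → a k x = 0)
      (t : Tendsto (fun k => eLpNorm (a k) (ENNReal.ofReal ((n : ℝ) * m / ((n : ℝ) - m))) volume)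
        atTop (𝓝 0)) : Tendsto (fun k => eLpNorm (a k) 1 volume) atTop (𝓝 0) := by
    refine tendsto_of_tendsto_of_tendsto_of_le_of_le tendsto_const_nhds ?_ (fun _ => zero_le)
      fun k => eLpNorm_le_of_ae_eq_zero hΩ hr1' (ha k) (ha0 k)
    simpa using ENNReal.Tendsto.mul_const t (Or.inr (rpow_measure_ne_top hΩb le_rfl hr1'))
  have hd (k) := (hφ k).sub hr1' hu
  refine ⟨u, G, hu, ?_, ?_, ⟨φ, Φ, h, ?_, ae_restrict_of_ae lim, 
    .of_tendsto hr1 hφ hu t1 t2, ?_⟩, ?_⟩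
  · -- Positivity: `u` lies above the first nontrivial approximation, a supersolution.
    have h1 := h.mixedForm_nonneg (k := 0) hγ0 hn hs0 hs1 (hg0 1)
      (by filter_upwards [all] with x hx using (hx 0).1)
    have hne : ¬ φ 1 =ᵐ[volume] 0 := fun h0 => hfne (by
      filter_upwards [h.eq_zero_of_eq_zero hn hs0 hs1 hΩ hΩb (memLp_min_natCast hf.1 hf0 1 1) h0]
        with x hx
      rcases min_choice (f x) ((1 : ℕ) : ℝ) with h2 | h2
      · exact h2.symm.trans hx
      · rw [h2] at hx; simp at hx)
    have h2 := (hφ2 1).pos_of_supersolution hn1 hs0 hs1 hΩ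
      (by filter_upwards [all] with x hx using (hx _).1) hne h1
    rw [ae_restrict_iff' hΩ.measurableSet]
    filter_upwards [h2, all] with x hx1 hx2 hx
    exact (hx1 hx).trans_le (hx2 _).2.2
  · exact h.isDistributionalSolution hn hs0 hs1 hΩ hΩb
      (memLp_one_iff_integrable.1 (hf.mono_exponent (ENNReal.one_le_ofReal.2 hm1.le))) hf0 hu0 huν
      (hu.mono_exponent hΩ hΩb le_rfl hr1')
      (by filter_upwards [all] with x hx k using ⟨(hx k).1, (hx k).2.2⟩) lim
      (to_one (fun k => (hd k).1.1) (fun k => (hd k).ae_eq_zero hΩ hr1') t1)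
      (to_one (fun k => (hd k).2.1.1) (fun k => (hd k).gradient_ae_eq_zero hΩ hr1') t2)
  · exact ae_restrict_of_ae (all.mono fun x hx k => ⟨(hx k).1, (hx k).2.1⟩)
  · have ac := (hardyMeasure_absolutelyContinuous Ω).trans
      Measure.restrict_le_self.absolutelyContinuous
    have t := tendsto_eLpNorm_zero_of_dominated (fj := fun k x => φ k x - u x) one_ne_zero
      ENNReal.one_ne_top huν (fun k => ((hφ k).1.1.mono_ac ac).sub huν.1) (fun k => by
        filter_upwards [ac.ae_le all] with x hx
        have h1 := (hx k).1
        have h2 := (hx k).2.2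
        rw [Real.norm_eq_abs, abs_le]
        constructor <;> linarith) (by
        filter_upwards [ac.ae_le lim] with x hx
        simpa using hx.sub_const (u x))
    refine t.congr fun k => ?_
    rw [eLpNorm_one_eq_lintegral_enorm, eLpNorm_one_eq_lintegral_enorm, lintegral_hardyMeasure]
    refine lintegral_congr fun x => ?_
    rw [← sub_div, ← mul_one_div (φ k x - u x), enorm_mul, mul_comm,
      Real.enorm_of_nonneg (by positivity : 0 ≤ 1 / ‖x‖ ^ 2)]
  · exact fun w hw => hw.ae_eq hn hs0 hs1 hΩ hΩb hm1 hm2 hf hf0 hγ0 hγ h (ae_restrict_of_ae lim)
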